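/- **Conventions.** Let $V$ be a category. A functor $E$ on finite sequences of objects of $V$ is a family of functors $E_n:V^n\to V$ ($n\ge 0$); write $\mathop{E}_i X_i$ or $\mathop{E}_{1\le i\le n}X_i$ for $E_n(X_1,\dots,X_n)$. A *multitensor* on $V$ is such an $E$ with natural maps $u_Z:Z\to E_1Z$ and $\sigma_{Z_{ij}}:\mathop{E}_i\mathop{E}_jZ_{ij}\to\mathop{E}_{ij}Z_{ij}$ (for all doubly nested finite sequences, blocks possibly empty) such that $\sigma\circ uE_i=\mathrm{id}$, $\sigma\circ \mathop{E}_iu=\mathrm{id}$ and $\sigma\circ\sigma \mathop{E}_k=\sigma\circ\mathop{E}_i\sigma:\mathop{E}_i\mathop{E}_j\mathop{E}_kZ_{ijk}\to\mathop{E}_{ijk}Z_{ijk}$. A multitensor map $E\to F$ is a natural family $E_n\to F_n$ compatible with units and substitutions. The maps $u$ and $\sigma$ make $E_1$ a monad. $E$ is *distributive* if every $E_n$ preserves coproducts in each variable. $\mathcal GV$ is the category of $V$-graphs: an object $X$ is a set of objects with an object $X(a,b)$ of $V$ for each pair $(a,b)$ of them, and a morphism is a function on objects with maps on homs; $\mathcal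 G(-)$ of a functor or monad is its application to homs. An *$E$-category* is $X\in\mathcal GV$ with maps $\kappa:\mathop{E}_iX(x_{i-1},x_i)\to X(x_0,x_n)$ for all $n\ge0$ and all $x_0,\dots,x_n$, such that $\kappa\circ u=\mathrm{id}$ and $\kappa\circ\sigma=\kappa\circ\mathop{E}_i\kappa$; $E$-functors are the graph morphisms commuting with all $\kappa$, and $E\text{-Cat}$ is the resulting category. If $V$ has coproducts and $E$ is distributive, $\Gamma E$ is the monad on $\mathcal GV$ for which $\Gamma E(X)$ has the objects of $X$ and $$\Gamma E(X)(a,b)=\coprod_{a=x_0,\dots,x_n=b}\mathop{E}_iX(x_{i-1},x_i),$$ with coproduct inclusions $k_{x_i}$; its unit and multiplication are identities on objects, and on homs the unit is $k\circ u$ and the multiplication is the map $\mu$ determined by $\mu\circ k\circ\mathop{E}_ik=k\circ\sigma$ for all doubly nested sequences of objects. **Theorem.** Let $V$ be a category, $(E,u,\sigma)$ a multitensor on $V$ and $(T,\eta,\mu)$ a monad on $V$, with category of algebras $U^T:V^T\to V$. Write $EM(T)$ for the family of functors $(X_1,\dots,X_n)\mapsto\mathop{E}_iTX_i$. There are bijections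 between the following types of data. 1. Opmonoidal monad coherences for $T$: natural maps $\tau_{X_i}:T\mathop{E}_iX_i\to\mathop{E}_iTX_i$, for all finite sequences, such that $\tau\circ Tu=uT$, $\ \tau\circ T\sigma=\sigma T\circ\mathop{E}_i\tau\circ\tau\mathop{E}_j$, $\ \tau\circ\eta\mathop{E}_i=\mathop{E}_i\eta$, $\ \tau\circ\mu\mathop{E}_i=\mathop{E}_i\mu\circ\tau T\circ T\tau$. 2. Natural maps $\sigma'_{X_{ij}}:\mathop{E}_iT\mathop{E}_jTX_{ij}\to\mathop{E}_{ij}TX_{ij}$ which, together with $u'_X=u_{TX}\eta_X$, make $EM(T)$ a multitensor, such that $E\eta:E\to EM(T)$ is a multitensor map, $uT:T\to E_1T$ is a monad map, and the composite $\mathop{E}_iTX_i\to\mathop{E}_iTE_1TX_i\to\mathop{E}_iTX_i$ of $\mathop{E}_i(\eta uT)$ and $\sigma'$ is the identity. 3. Liftings of $E$ to $V^T$, that is, multitensors $(E',u',\sigma')$ on $V^T$ with $U^TE'_n=E_n(U^T)^n$ for all $n$, whose unit and substitution have those of $E$ (at the underlying objects) as underlying maps in $V$. The data corresponding to $\tau$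 are given by $\sigma'=\mathop{E}_{ij}\mu\circ\sigma TT\circ\mathop{E}_i\tau T$, and by the $T$-algebra structure $\mathop{E}_ix_i\circ\tau_{X_i}$ on $\mathop{E}_iX_i$ for $T$-algebras $(X_i,x_i)$. For any instance of such corresponding data there is an isomorphism of categories $$EM(T)\text{-Cat}\;\cong\;E'\text{-Cat}$$ commuting with the forgetful functors into $\mathcal GV$. If in addition $V$ has coproducts, $T$ preserves them and $E$ is distributive, then these data are also in bijection with 4. Identity-on-objects morphisms $\lambda_X:\mathcal G(T)\,\Gamma E(X)\to\Gamma E\,\mathcal G(T)(X)$, natural in $X\in\mathcal GV$, which form a distributive law of the monad $\Gamma E$ over the monad $\mathcal G(T)$ (that is, with $S=\Gamma E$ and $R=\mathcal G(T)$, a transformation $\lambda:RS\to SR$ compatible with the units and multiplications of both monads), where $\lambda$ corresponds to $\tau$ when $\lambda_X\circ T(k_{x_i})=k_{x_i}\circ\tau_{X(x_{i-1},x_i)}$ for every $X$ and every sequence $(x_0,\dots,x_n)$ of its objects. -/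

import Mathlib

open CategoryTheory CategoryTheory.Limits

attribute [-instance] CategoryTheory.catToReflQuiver

universe v u v₁ u₁ w

namespace MultitensorLaw

/-! ### Sequences and their subdivisions into consecutive blocks -/

/-- A subdivision of the sequence of positions `0, …, N - 1` into `k` consecutive (possibly empty)
blocks. Block `i` begins at `cut i.castSucc`, ends just before `cut i.succ`, and has `len i`
elements. Thus a doubly nested sequence `X_ij` (`1 ≤ i ≤ k`, `1 ≤ j ≤ len i`) is the same as a
sequence of length `N` together with a subdivision of it. -/
structure Subdivision (N k : ℕ) where
  cut : Fin (k + 1) → Fin (N + 1)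
  len : Fin k → ℕ
  cut_zero : cut 0 = 0
  cut_last : cut (Fin.last k) = Fin.last N
  cut_succ : ∀ i : Fin k, (cut i.succ : ℕ) = (cut i.castSucc : ℕ) + len i

namespace Subdivision

variable {N M k : ℕ}

/-- The position, in the whole sequence, of the `j`-th element of the `i`-th block. -/
def index (d : Subdivision N k) (i : Fin k) (j : Fin (d.len i)) : Fin N :=
  ⟨(d.cut i.castSucc : ℕ) + j, by
    have h1 := d.cut_succ i
    have h2 := (d.cut i.succ).isLt
    have h3 := j.isLt
    omega⟩

theorem cut_mono (d : Subdivision N k) : Monotone d.cut :=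
  Fin.monotone_iff_le_succ.2 fun i => by
    have h1 := d.cut_succ i
    rw [Fin.le_def]
    omega

/-- The subdivision into a single block. -/
def whole (N : ℕ) : Subdivision N 1 where
  cut := Fin.cases 0 fun _ => Fin.last N
  len := fun _ => N
  cut_zero := rfl
  cut_last := rfl
  cut_succ := fun i => by
    obtain rfl : i = 0 := Subsingleton.elim _ _
    exact (Nat.zero_add N).symm

/-- The subdivision into blocks of length one. -/
def singles (N : ℕ) : Subdivision N N where
  cut := fun i => i
  len := fun _ => 1
  cut_zero := rfl
  cut_last := rfl
  cut_succ := fun i => by simp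

/-- If `N` positions are divided into `M` blocks and these `M` blocks are divided into `k` groups,
then the `N` positions are divided into `k` large blocks. -/
def comp (d : Subdivision N M) (c : Subdivision M k) : Subdivision N k where
  cut := fun i => d.cut (c.cut i)
  len := fun i => (d.cut (c.cut i.succ) : ℕ) - (d.cut (c.cut i.castSucc) : ℕ)
  cut_zero := by rw [c.cut_zero, d.cut_zero]
  cut_last := by rw [c.cut_last, d.cut_last]
  cut_succ := fun i => by
    have h := d.cut_mono (c.cut_mono (Fin.castSucc_lt_succ (i := i)).le)
    rw [Fin.le_def] at h
    omega

theorem cut_bound (c : Subdivision M k) (i : Fin k) (j : Fin (c.len i + 1)) :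
    (c.cut i.castSucc : ℕ) + j < M + 1 := by
  have h1 := c.cut_succ i
  have h2 := (c.cut i.succ).isLt
  have h3 := j.isLt
  omega

/-- The subdivision of the `i`-th large block of `d.comp c` into those blocks of `d` which make it
up. -/
def restrict (d : Subdivision N M) (c : Subdivision M k) (i : Fin k) :
    Subdivision ((d.comp c).len i) (c.len i) where
  cut := fun j =>
    ⟨(d.cut ⟨(c.cut i.castSucc : ℕ) + j, c.cut_bound i j⟩ : ℕ) - (d.cut (c.cut i.castSucc) : ℕ), by
      have h : d.cut ⟨(c.cut i.castSucc : ℕ) + j, c.cut_bound i j⟩ ≤ d.cut (c.cut i.succ) := by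
        apply d.cut_mono
        rw [Fin.le_def, c.cut_succ i]
        have h3 := j.isLt
        simp only
        omega
      rw [Fin.le_def] at h
      simp only [comp]
      omega⟩
  len := fun j => d.len (c.index i j)
  cut_zero := by
    ext
    simp
  cut_last := by
    ext
    have h : (⟨(c.cut i.castSucc : ℕ) + (Fin.last (c.len i) : Fin (c.len i + 1)),
        c.cut_bound i _⟩ : Fin (M + 1)) = c.cut i.succ := by
      ext
      simp [c.cut_succ i]
    simp only [h]
    rfl
  cut_succ := fun j => by
    have h1 := d.cut_succ (c.index i j)
    have h2 : d.cut (c.cut i.castSucc) ≤ d.cut (c.index i j).castSucc := by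
      apply d.cut_mono
      rw [Fin.le_def]
      simp [index]
    rw [Fin.le_def] at h2
    change (d.cut (c.index i j).succ : ℕ) - (d.cut (c.cut i.castSucc) : ℕ) =
      ((d.cut (c.index i j).castSucc : ℕ) - (d.cut (c.cut i.castSucc) : ℕ)) + d.len (c.index i j)
    omega

theorem index_whole (N : ℕ) (i : Fin 1) (j : Fin N) : (whole N).index i j = j := by
  obtain rfl : i = 0 := Subsingleton.elim _ _
  ext
  simp [index, whole]

/-- Passing to positions in two steps agrees with passing to positions in one step. -/
theorem index_comp (d : Subdivision N M) (c : Subdivision M k) (i : Fin k) (j : Fin (c.len i))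
    (l : Fin (d.len (c.index i j))) :
    (d.comp c).index i ((d.restrict c i).index j l) = d.index (c.index i j) l := by
  have h2 : d.cut (c.cut i.castSucc) ≤ d.cut (c.index i j).castSucc := by
    apply d.cut_mono
    rw [Fin.le_def]
    simp [index]
  rw [Fin.le_def] at h2
  ext
  change (d.cut (c.cut i.castSucc) : ℕ) +
      (((d.cut (c.index i j).castSucc : ℕ) - (d.cut (c.cut i.castSucc) : ℕ)) + l) =
    (d.cut (c.index i j).castSucc : ℕ) + l
  omega

end Subdivision

/-! ### Multitensors -/

/-- A functor `E : MV → V` on the category of finite sequences of objects of `V`: since maps of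
sequences only exist between sequences of the same length, this is a functor `Eₙ : Vⁿ → V` for
every `n`. -/
abbrev TensorFamily (V : Type u) [Category.{v} V] := ∀ n : ℕ, (Fin n → V) ⥤ V

section

variable {V : Type u} [Category.{v} V]

/-- The action of `E` on a sequence of maps. -/
def TensorFamily.tmap (E : TensorFamily V) {n : ℕ} {X Y : Fin n → V} (f : ∀ i, X i ⟶ Y i) :
    (E n).obj X ⟶ (E n).obj Y :=
  (E n).map f

/-- The unit and substitution making a functor `E : MV → V` into a multitensor.

The unit at a sequence `(X₀)` of length one is a map `X₀ ⟶ E (X₀)`. The substitution is indexed by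
a sequence `X` of length `N` together with a subdivision `d` of it, and is a map
`E_i E_j X_ij ⟶ E_ij X_ij` where `X_ij` is the `j`-th element of the `i`-th block. -/
@[ext]
structure MultitensorStruct (E : TensorFamily V) where
  unit : ∀ X : Fin 1 → V, X 0 ⟶ (E 1).obj X
  sub : ∀ {N k : ℕ} (d : Subdivision N k) (X : Fin N → V),
    (E k).obj (fun i => (E (d.len i)).obj fun j => X (d.index i j)) ⟶ (E N).obj X
  unit_naturality : ∀ {X Y : Fin 1 → V} (f : ∀ i, X i ⟶ Y i),
    f 0 ≫ unit Y = unit X ≫ E.tmap f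
  sub_naturality : ∀ {N k : ℕ} (d : Subdivision N k) {X Y : Fin N → V} (f : ∀ i, X i ⟶ Y i),
    E.tmap (fun i => E.tmap fun j => f (d.index i j)) ≫ sub d Y = sub d X ≫ E.tmap f
  /-- The composite `E_i X_i ⟶ E₁ E_i X_i ⟶ E_i X_i` is the identity. The `eqToHom` identifies
  `X` with the sequence of elements of its only block. -/
  unit_sub : ∀ {N : ℕ} (X : Fin N → V),
    unit (fun i : Fin 1 => (E N).obj fun j => X ((Subdivision.whole N).index i j)) ≫
        sub (Subdivision.whole N) X =
      E.tmap fun j => eqToHom (congrArg X (Subdivision.index_whole N 0 j))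
  /-- The composite `E_i X_i ⟶ E_i E₁ X_i ⟶ E_i X_i` is the identity. -/
  sub_unit : ∀ {N : ℕ} (X : Fin N → V),
    E.tmap (fun i => unit fun j => X ((Subdivision.singles N).index i j)) ≫
        sub (Subdivision.singles N) X =
      𝟙 ((E N).obj X)
  /-- The two composites `E_i E_j E_l X_ijl ⟶ E_ijl X_ijl` agree. The `eqToHom` identifies the
  two ways of addressing the element `X_ijl`. -/
  assoc : ∀ {N M k : ℕ} (d : Subdivision N M) (c : Subdivision M k) (X : Fin N → V),
    sub c (fun a => (E (d.len a)).obj fun l => X (d.index a l)) ≫ sub d X =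
      E.tmap (fun i =>
          E.tmap (fun j => E.tmap fun l =>
            eqToHom (congrArg X (Subdivision.index_comp d c i j l).symm)) ≫
          sub (d.restrict c i) fun l => X ((d.comp c).index i l)) ≫
        sub (d.comp c) X

end

/-- A multitensor (that is, a lax monoidal structure) on a category. -/
structure Multitensor (V : Type u) [Category.{v} V] where
  tensor : TensorFamily V
  str : MultitensorStruct tensor


section

variable {V : Type u} [Category.{v} V]

theorem TensorFamily.tmap_id (E : TensorFamily V) {n : ℕ} (X : Fin n → V) :
    E.tmap (fun i => 𝟙 (X i)) = 𝟙 ((E n).obj X) :=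
  (E n).map_id X

theorem TensorFamily.tmap_comp (E : TensorFamily V) {n : ℕ} {X Y Z : Fin n → V}
    (f : ∀ i, X i ⟶ Y i) (g : ∀ i, Y i ⟶ Z i) :
    E.tmap f ≫ E.tmap g = E.tmap fun i => f i ≫ g i :=
  ((E n).map_comp f g).symm

theorem Subdivision.eq_whole (d : Subdivision 1 1) : d = Subdivision.whole 1 := by
  obtain ⟨cut, len, h0, h1, h2⟩ := d
  have hc : cut = (Subdivision.whole 1).cut := by
    funext i
    fin_cases i
    · exact h0
    · exact h1
  subst hc
  have hl : len = (Subdivision.whole 1).len := by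
    funext i
    have h3 := h2 i
    rw [(Subdivision.whole 1).cut_succ i] at h3
    omega
  subst hl
  rfl

theorem MultitensorStruct.sub_sub_one {E : TensorFamily V} (S : MultitensorStruct E) (X : V)
    (e : Subdivision 1 1) (r : ∀ i : Fin 1, Subdivision (e.len i) 1) :
    HEq (E.tmap (fun i => S.sub (r i) fun _ => X) ≫ S.sub e fun _ => X)
      (E.tmap (fun _ : Fin 1 => S.sub (Subdivision.whole 1) fun _ => X) ≫
        S.sub (Subdivision.whole 1) fun _ => X) := by
  obtain rfl := e.eq_whole
  obtain rfl : r = fun _ => Subdivision.whole 1 := funext fun i => (r i).eq_whole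
  rfl

/-- The monad on `V` whose endofunctor is `E₁`, the restriction of the multitensor `E` to sequences
of length one. -/
def Multitensor.unaryMonad (E : Multitensor V) : Monad V where
  obj X := (E.tensor 1).obj fun _ => X
  map f := E.tensor.tmap fun _ => f
  map_id X := E.tensor.tmap_id _
  map_comp f g := (E.tensor.tmap_comp _ _).symm
  η := { app := fun X => E.str.unit fun _ => X
         naturality := fun X Y f => E.str.unit_naturality fun _ => f }
  μ := { app := fun X => E.str.sub (Subdivision.whole 1) fun _ => X
         naturality := fun X Y f => E.str.sub_naturality (Subdivision.whole 1) fun _ => f }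
  assoc X := by
    have h := E.str.assoc (Subdivision.whole 1) (Subdivision.whole 1) fun _ => X
    simp only [eqToHom_refl, TensorFamily.tmap_id] at h
    have h1 := h.trans (congrArg (fun F => E.tensor.tmap F ≫ E.str.sub _ fun _ => X)
      (funext fun i => Category.id_comp _))
    exact eq_of_heq ((E.str.sub_sub_one X ((Subdivision.whole 1).comp (Subdivision.whole 1))
      ((Subdivision.whole 1).restrict (Subdivision.whole 1))).symm.trans (heq_of_eq h1.symm))
  left_unit X := by
    have h := E.str.unit_sub (fun _ : Fin 1 => X)
    simpa [TensorFamily.tmap_id] using h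
  right_unit X := by
    have h := E.str.sub_unit (fun _ : Fin 1 => X)
    have e : (E.str.sub (Subdivision.singles 1) fun _ => X) =
        E.str.sub (Subdivision.whole 1) fun _ => X := by
      apply eq_of_heq
      have : ∀ d : Subdivision 1 1, d = Subdivision.whole 1 → HEq (E.str.sub d fun _ => X)
          (E.str.sub (Subdivision.whole 1) fun _ => X) := by
        rintro d rfl
        rfl
      exact this _ (Subdivision.eq_whole _)
    exact (congrArg (fun g => (E.tensor.tmap fun _ => E.str.unit fun _ => X) ≫ g) e).symm.trans h

end

/-! ### Enriched graphs -/

/-- A graph enriched in `V`. -/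
structure EnrichedGraph (V : Type u) [Category.{v} V] where
  carrier : Type w
  hom : carrier → carrier → V

namespace EnrichedGraph

section

variable {V : Type u} [Category.{v} V] {W : Type u₁} [Category.{v₁} W]

/-- Morphisms of enriched graphs. -/
@[ext]
structure Hom (X Y : EnrichedGraph.{v, u, w} V) where
  obj : X.carrier → Y.carrier
  map : ∀ a b : X.carrier, X.hom a b ⟶ Y.hom (obj a) (obj b)

instance : Category (EnrichedGraph.{v, u, w} V) where
  Hom := Hom
  id X := ⟨fun a => a, fun _ _ => 𝟙 _⟩
  comp f g := ⟨fun a => g.obj (f.obj a), fun a b => f.map a b ≫ g.map (f.obj a) (f.obj b)⟩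
  id_comp f := by simp
  comp_id f := by simp
  assoc f g h := by simp

@[simp] theorem id_obj (X : EnrichedGraph.{v, u, w} V) (a : X.carrier) : Hom.obj (𝟙 X) a = a := rfl

@[simp] theorem id_map (X : EnrichedGraph.{v, u, w} V) (a b : X.carrier) :
    Hom.map (𝟙 X) a b = 𝟙 (X.hom a b) := rfl

@[simp] theorem comp_obj {X Y Z : EnrichedGraph.{v, u, w} V} (f : X ⟶ Y) (g : Y ⟶ Z)
    (a : X.carrier) : Hom.obj (f ≫ g) a = g.obj (f.obj a) := rfl

@[simp] theorem comp_map {X Y Z : EnrichedGraph.{v, u, w} V} (f : X ⟶ Y) (g : Y ⟶ Z)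
    (a b : X.carrier) : Hom.map (f ≫ g) a b = f.map a b ≫ g.map (f.obj a) (f.obj b) := rfl

/-- The identity-on-objects morphism given by a family of maps between the homs. -/
def Hom.ofHoms {S : Type w} {X Y : S → S → V} (f : ∀ a b, X a b ⟶ Y a b) :
    (⟨S, X⟩ : EnrichedGraph.{v, u, w} V) ⟶ ⟨S, Y⟩ :=
  ⟨fun a => a, f⟩

/-- Applying a functor to the homs of a graph. -/
def mapFunctor (F : V ⥤ W) : EnrichedGraph.{v, u, w} V ⥤ EnrichedGraph.{v₁, u₁, w} W where
  obj X := ⟨X.carrier, fun a b => F.obj (X.hom a b)⟩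
  map f := ⟨f.obj, fun a b => F.map (f.map a b)⟩
  map_id X := by
    refine Hom.ext rfl (heq_of_eq ?_)
    funext a b
    exact F.map_id _
  map_comp f g := by
    refine Hom.ext rfl (heq_of_eq ?_)
    funext a b
    exact F.map_comp _ _

/-- The monad `G(T)` on graphs induced by a monad `T`. -/
def mapMonad (T : Monad V) : Monad (EnrichedGraph.{v, u, w} V) where
  toFunctor := mapFunctor T.toFunctor
  η :=
    { app := fun X => Hom.ofHoms fun a b => T.η.app (X.hom a b)
      naturality := fun X Y f => by
        refine Hom.ext rfl (heq_of_eq ?_)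
        funext a b
        exact T.η.naturality _ }
  μ :=
    { app := fun X => Hom.ofHoms fun a b => T.μ.app (X.hom a b)
      naturality := fun X Y f => by
        refine Hom.ext rfl (heq_of_eq ?_)
        funext a b
        exact T.μ.naturality _ }
  assoc X := by
    refine Hom.ext rfl (heq_of_eq ?_)
    funext a b
    exact T.assoc _
  left_unit X := by
    refine Hom.ext rfl (heq_of_eq ?_)
    funext a b
    exact T.left_unit _
  right_unit X := by
    refine Hom.ext rfl (heq_of_eq ?_)
    funext a b
    exact T.right_unit _

end

end EnrichedGraph

/-- A finite sequence `(x₀, …, xₙ)` with `x₀ = a` and `xₙ = b`. -/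
structure Chain {S : Type w} (a b : S) where
  len : ℕ
  pt : Fin (len + 1) → S
  pt_zero : pt 0 = a
  pt_last : pt (Fin.last len) = b

namespace Chain

variable {S : Type w} {R : Type v}

/-- The sequence `(a, b)`. -/
abbrev pair (a b : S) : Chain a b where
  len := 1
  pt := Fin.cases a fun _ => b
  pt_zero := rfl
  pt_last := rfl

/-- The image of a sequence under a function. -/
abbrev image (f : S → R) {a b : S} (p : Chain a b) : Chain (f a) (f b) where
  len := p.len
  pt := fun i => f (p.pt i)
  pt_zero := congrArg f p.pt_zero
  pt_last := congrArg f p.pt_last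

/-- The sequence of end points of the blocks of a subdivided sequence. -/
abbrev coarse {a b : S} (p : Chain a b) {k : ℕ} (d : Subdivision p.len k) : Chain a b where
  len := k
  pt := fun i => p.pt (d.cut i)
  pt_zero := by rw [d.cut_zero, p.pt_zero]
  pt_last := by rw [d.cut_last, p.pt_last]

/-- The part of a subdivided sequence which lies over its `i`-th block. -/
abbrev block {a b : S} (p : Chain a b) {k : ℕ} (d : Subdivision p.len k) (i : Fin k) :
    Chain (p.pt (d.cut i.castSucc)) (p.pt (d.cut i.succ)) where
  len := d.len i
  pt := fun j => p.pt ⟨(d.cut i.castSucc : ℕ) + j, d.cut_bound i j⟩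
  pt_zero := rfl
  pt_last := by
    congr 1
    ext
    exact (d.cut_succ i).symm

end Chain

/-- The sequence `X(x₀, x₁), …, X(xₙ₋₁, xₙ)` of homs along a sequence of objects of a graph. -/
abbrev EnrichedGraph.homs {V : Type u} [Category.{v} V] (X : EnrichedGraph.{v, u, w} V)
    {a b : X.carrier} (p : Chain a b) : Fin p.len → V :=
  fun i => X.hom (p.pt i.castSucc) (p.pt i.succ)

/-! ### Categories enriched in a multitensor -/

/-- A category enriched in a multitensor `E`. -/
structure MultitensorCat {V : Type u} [Category.{v} V] (E : Multitensor V) where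
  graph : EnrichedGraph.{v, u, w} V
  κ : ∀ {a b : graph.carrier} (p : Chain a b),
    (E.tensor p.len).obj (graph.homs p) ⟶ graph.hom a b
  unit_κ : ∀ a b : graph.carrier,
    E.str.unit (graph.homs (Chain.pair a b)) ≫ κ (Chain.pair a b) = 𝟙 (graph.hom a b)
  sub_κ : ∀ {a b : graph.carrier} (p : Chain a b) {k : ℕ} (d : Subdivision p.len k),
    E.str.sub d (graph.homs p) ≫ κ p =
      E.tensor.tmap (fun i => κ (p.block d i)) ≫ κ (p.coarse d)

namespace MultitensorCat

variable {V : Type u} [Category.{v} V] {E : Multitensor V}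

/-- A morphism of graphs underlies an `E`-functor when it is compatible with all compositions. -/
@[ext]
structure Hom (C D : MultitensorCat.{v, u, w} E) where
  toHom : C.graph ⟶ D.graph
  κ_map : ∀ {a b : C.graph.carrier} (p : Chain a b),
    C.κ p ≫ toHom.map a b =
      E.tensor.tmap (fun i => toHom.map (p.pt i.castSucc) (p.pt i.succ)) ≫ D.κ (p.image toHom.obj)

instance : Category (MultitensorCat.{v, u, w} E) where
  Hom := Hom
  id C := ⟨𝟙 C.graph, fun p => by
    simp only [EnrichedGraph.id_map, Category.comp_id]
    exact ((congrArg (· ≫ C.κ p) (E.tensor.tmap_id (C.graph.homs p))).trans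
      (Category.id_comp _)).symm⟩
  comp {C D F} f g := ⟨f.toHom ≫ g.toHom, fun {a b} p => by
    have h1 := f.κ_map p
    have h2 := g.κ_map (p.image f.toHom.obj)
    rw [EnrichedGraph.comp_map, ← Category.assoc, h1, Category.assoc, h2, ← Category.assoc,
      TensorFamily.tmap_comp]
    rfl⟩
  id_comp f := Hom.ext (Category.id_comp _)
  comp_id f := Hom.ext (Category.comp_id _)
  assoc f g h := Hom.ext (Category.assoc _ _ _)

/-- The forgetful functor from `E`-categories to graphs. -/
def forget (E : Multitensor V) : MultitensorCat.{v, u, w} E ⥤ EnrichedGraph.{v, u, w} V where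
  obj C := C.graph
  map f := f.toHom

end MultitensorCat

/-! ### Distributive multitensors -/

section

variable {V : Type u} [Category.{v} V]

/-- The functor `V → Vⁿ` which varies the `i`-th entry of a sequence, keeping the other entries
fixed. -/
def slot {n : ℕ} (X : Fin n → V) (i : Fin n) : V ⥤ (Fin n → V) :=
  Functor.pi' fun j => if j = i then 𝟭 V else (Functor.const V).obj (X j)

/-- A multitensor is distributive when each `Eₙ` preserves coproducts in each variable. -/
def Multitensor.IsDistributive (E : Multitensor V) : Prop :=
  ∀ (n : ℕ) (X : Fin n → V) (i : Fin n) (J : Type w),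
    PreservesColimitsOfShape (Discrete J) (slot X i ⋙ E.tensor n)

/-- The universal property of a coproduct. -/
def IsCoprod {J : Type w} {A : J → V} {C : V} (inj : ∀ j, A j ⟶ C) : Prop :=
  ∀ (Q : V) (h : ∀ j, A j ⟶ Q), ∃! f : C ⟶ Q, ∀ j, inj j ≫ f = h j

namespace IsCoprod

theorem of_isColimit {J : Type w} {A : J → V} {C : V} (inj : ∀ j, A j ⟶ C)
    (hc : IsColimit (Cofan.mk C inj)) : IsCoprod inj := by
  intro Q h
  refine ⟨Cofan.IsColimit.desc hc h, fun j => Cofan.IsColimit.fac hc h j, fun g hg => ?_⟩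
  refine Cofan.IsColimit.hom_ext hc _ _ fun j => ?_
  exact (hg j).trans (Cofan.IsColimit.fac hc h j).symm

theorem isColimit {J : Type w} {A : J → V} {C : V} {inj : ∀ j, A j ⟶ C}
    (hc : IsCoprod inj) : Nonempty (IsColimit (Cofan.mk C inj)) :=
  ⟨Cofan.IsColimit.mk _ (fun t => (hc t.pt t.inj).choose)
    (fun t j => (hc t.pt t.inj).choose_spec.1 j)
    fun t m hm => (hc t.pt t.inj).choose_spec.2 m hm⟩

theorem map {J : Type w} {A : J → V} {C : V} {inj : ∀ j, A j ⟶ C}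
    (hc : IsCoprod inj) (F : V ⥤ V) [PreservesColimitsOfShape (Discrete J) F] :
    IsCoprod fun j => F.map (inj j) :=
  of_isColimit _ (isColimitCofanMkObjOfIsColimit F _ _ hc.isColimit.some)

theorem sigma {J : Type w} (A : J → V) [HasCoproduct A] : IsCoprod (Sigma.ι A) :=
  of_isColimit _ (coproductIsCoproduct A)

theorem hom_ext {J : Type w} {A : J → V} {C : V} {inj : ∀ j, A j ⟶ C}
    (hc : IsCoprod inj) {Q : V} {f g : C ⟶ Q} (h : ∀ j, inj j ≫ f = inj j ≫ g) : f = g :=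
  (hc Q fun j => inj j ≫ g).unique h fun _ => rfl

/-- Coproducts may be reindexed along a bijection, and the objects involved may be replaced by
isomorphic ones. -/
theorem reindex {J : Type w} {A : J → V} {C : V} {inj : ∀ j, A j ⟶ C} (hc : IsCoprod inj)
    {K : Type u₁} (e : K → J) (he : Function.Bijective e) {B : K → V} (α : ∀ x, B x ≅ A (e x))
    {D : V} (β : C ≅ D) (inj' : ∀ x, B x ⟶ D)
    (h : ∀ x, inj' x = (α x).hom ≫ inj (e x) ≫ β.hom) : IsCoprod inj' := by
  intro Q g
  have h1 : ∀ j, ∃ r : A j ⟶ Q, ∀ (x : K) (hx : e x = j),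
      r = eqToHom (by rw [hx]) ≫ (α x).inv ≫ g x := by
    intro j
    obtain ⟨x, rfl⟩ := he.2 j
    refine ⟨(α x).inv ≫ g x, fun y hy => ?_⟩
    obtain rfl := he.1 hy
    simp
  choose r hr using h1
  obtain ⟨f, hf, hu⟩ := hc Q r
  refine ⟨β.inv ≫ f, fun x => ?_, fun f' hf' => ?_⟩
  · have h2 := hr (e x) x rfl
    simp only [eqToHom_refl, Category.id_comp] at h2
    simp [h, hf, h2]
  · rw [Iso.eq_inv_comp]
    apply hu
    intro j
    obtain ⟨x, rfl⟩ := he.2 j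
    have h2 := hr (e x) x rfl
    simp only [eqToHom_refl, Category.id_comp] at h2
    have h3 := hf' x
    rw [h] at h3
    simp only [h2, ← h3, Category.assoc, Iso.inv_hom_id_assoc]

/-- A coproduct of coproducts is a coproduct. -/
theorem trans {J : Type w} {B : J → V} {C : V} {p : ∀ x, B x ⟶ C} (hp : IsCoprod p)
    {K : J → Type u₁} {A : ∀ x, K x → V} {q : ∀ x y, A x y ⟶ B x} (hq : ∀ x, IsCoprod (q x)) :
    IsCoprod fun y : (Σ x, K x) => q y.1 y.2 ≫ p y.1 := by
  intro Q h
  choose f hf hu using fun x => hq x Q fun y => h ⟨x, y⟩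
  obtain ⟨g, hg, hv⟩ := hp Q f
  refine ⟨g, fun y => ?_, fun g' hg' => hv _ fun x => hu _ _ fun y => ?_⟩
  · simp [hg, hf]
  · have := hg' ⟨x, y⟩
    simpa using this

end IsCoprod

/-- The preservation of coproducts in each variable, in terms of universal properties. -/
def PreservesInEach {k : ℕ} (F : (Fin k → V) ⥤ V) : Prop :=
  ∀ (i : Fin k) (J : Type w) (B : J → Fin k → V) (C : Fin k → V) (inj : ∀ x j, B x j ⟶ C j),
    (∀ x j, j ≠ i → IsIso (inj x j)) → IsCoprod (fun x => inj x i) →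
      IsCoprod (A := fun x => F.obj (B x)) (C := F.obj C) fun x => F.map (inj x)

theorem slot_eval_self {n : ℕ} (X : Fin n → V) (i : Fin n) :
    slot X i ⋙ Pi.eval _ i = 𝟭 V := by
  rw [slot, Functor.pi'_eval, if_pos rfl]

theorem slot_eval_ne {n : ℕ} (X : Fin n → V) (i j : Fin n) (h : j ≠ i) :
    slot X i ⋙ Pi.eval _ j = (Functor.const V).obj (X j) := by
  rw [slot, Functor.pi'_eval, if_neg h]

theorem preservesInEach_of_slot {k : ℕ} (F : (Fin k → V) ⥤ V)
    (hF : ∀ (X : Fin k → V) (i : Fin k) (J : Type w),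
      PreservesColimitsOfShape (Discrete J) (slot X i ⋙ F)) : PreservesInEach.{v, u, w} F := by
  intro i J B C inj hiso hc
  have := hF C i J
  have h1 : ∀ j, ∃ β : (slot C i).obj (C i) j ≅ C j, ∀ x,
      ∃ α : B x j ≅ (slot C i).obj (B x i) j,
        inj x j = α.hom ≫ (slot C i).map (inj x i) j ≫ β.hom := by
    intro j
    by_cases hj : j = i
    · subst hj
      let s := eqToIso (slot_eval_self C j)
      refine ⟨s.app (C j), fun x => ⟨(s.app (B x j)).symm, ?_⟩⟩
      exact (NatIso.naturality_1 s (inj x j)).symm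
    · let s := eqToIso (slot_eval_ne C i j hj)
      refine ⟨s.app (C i), fun x => ?_⟩
      have := hiso x j hj
      refine ⟨asIso (inj x j) ≪≫ (s.app (B x i)).symm, ?_⟩
      exact ((Category.assoc _ _ _).trans ((congrArg (inj x j ≫ ·)
        (NatIso.naturality_1 s (inj x i))).trans (Category.comp_id _))).symm
  choose β α h2 using h1
  refine (hc.map (slot C i ⋙ F)).reindex id Function.bijective_id
    (fun x => F.mapIso (Pi.isoMk fun j => α j x)) (F.mapIso (Pi.isoMk β)) _ fun x => ?_
  have h3 : (inj x : B x ⟶ C) = (Pi.isoMk fun j => α j x : B x ≅ (slot C i).obj (B x i)).hom ≫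
      (slot C i).map (inj x i) ≫ (Pi.isoMk β : (slot C i).obj (C i) ≅ C).hom :=
    funext fun j => h2 j x
  refine (congrArg F.map h3).trans ?_
  rw [F.map_comp, F.map_comp]
  rfl

/-- Adjoining a fixed first entry to a sequence. -/
def consLeft {k : ℕ} (Z : V) : (Fin k → V) ⥤ (Fin (k + 1) → V) where
  obj X := Fin.cases Z X
  map f := Fin.cases (𝟙 Z) f
  map_id X := by
    funext i
    exact Fin.cases rfl (fun _ => rfl) i
  map_comp f g := by
    funext i
    exact Fin.cases (Category.id_comp _).symm (fun _ => rfl) i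

/-- A functor of several variables which preserves coproducts in each variable sends a sequence of
coproducts to a coproduct. -/
theorem isCoprod_multi : ∀ {k : ℕ} (F : (Fin k → V) ⥤ V) (_ : PreservesInEach.{v, u, w} F)
    {J : Fin k → Type w} {A : ∀ i, J i → V} {C : Fin k → V} (inj : ∀ i x, A i x ⟶ C i)
    (_ : ∀ i, IsCoprod (inj i)),
    IsCoprod (A := fun z : ∀ i, J i => F.obj fun i => A i (z i)) (C := F.obj C)
      fun z => F.map fun i => inj i (z i)
  | 0, F, hF, J, A, C, inj, h => by
    intro Q g
    let z₀ : ∀ i : Fin 0, J i := fun i => i.elim0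
    have hu : ∀ z : ∀ i, J i, z = z₀ := fun z => funext fun i => i.elim0
    let θ : C ⟶ fun i => A i (z₀ i) := fun i => i.elim0
    let θ' : (fun i => A i (z₀ i)) ⟶ C := fun i => inj i (z₀ i)
    have h1 : θ ≫ θ' = 𝟙 _ := funext fun i => i.elim0
    have h2 : θ' ≫ θ = 𝟙 _ := funext fun i => i.elim0
    refine ⟨F.map θ ≫ g z₀, fun z => ?_, fun f hf => ?_⟩
    · obtain rfl := hu z
      change F.map θ' ≫ F.map θ ≫ _ = _
      rw [← Category.assoc, ← F.map_comp, h2, F.map_id, Category.id_comp]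
    · have h3 : F.map θ' ≫ f = g z₀ := hf z₀
      rw [← h3, ← Category.assoc, ← F.map_comp, h1, F.map_id, Category.id_comp]
  | k + 1, F, hF, J, A, C, inj, h => by
    let C' : Fin k → V := fun i => C i.succ
    let p : ∀ x : J 0, ∀ j, (Fin.cases (A 0 x) C' : Fin (k + 1) → V) j ⟶ C j :=
      fun x => Fin.cases (inj 0 x) fun i => 𝟙 _
    have h0 : IsCoprod fun x => F.map (p x : (Fin.cases (A 0 x) C' : Fin (k + 1) → V) ⟶ C) := by
      refine hF 0 (J 0) _ C p (fun x j => ?_) (h 0)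
      refine Fin.cases (fun h => absurd rfl h) (fun i _ => ?_) j
      exact (inferInstance : IsIso (𝟙 (C i.succ)))
    have h1 : ∀ x : J 0, IsCoprod fun z : ∀ i : Fin k, J i.succ =>
        (consLeft (A 0 x) ⋙ F).map fun i => inj i.succ (z i) := by
      intro x
      refine isCoprod_multi (consLeft (A 0 x) ⋙ F) (fun i J' B D inj' hiso hD => ?_)
        (fun (i : Fin k) (y : J i.succ) => inj i.succ y) fun i => h i.succ
      refine hF i.succ J' (fun y => (consLeft (A 0 x)).obj (B y)) ((consLeft (A 0 x)).obj D)
        (fun y => (consLeft (A 0 x)).map (inj' y)) (fun y j => ?_) hD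
      refine Fin.cases (fun _ => ?_) (fun j hj => ?_) j
      · exact (inferInstance : IsIso (𝟙 (A 0 x)))
      · exact hiso y j fun e => hj (congrArg Fin.succ e)
    have h2 := h0.trans h1
    let ψ : ∀ B : Fin (k + 1) → V, B ≅ (Fin.cases (B 0) (fun i => B i.succ) : Fin (k + 1) → V) :=
      fun B => Pi.isoMk (Fin.cases (Iso.refl _) fun i => Iso.refl _)
    refine h2.reindex (fun z : ∀ i, J i => ⟨z 0, fun i => z i.succ⟩) ⟨fun z z' e => ?_, fun y => ?_⟩
      (fun z => F.mapIso (ψ fun i => A i (z i))) (Iso.refl _) _ fun z => ?_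
    · funext i
      have e1 := congrArg Sigma.fst e
      have e2 := e
      simp only [Sigma.mk.injEq] at e2
      exact Fin.cases e2.1 (fun i => congrFun (eq_of_heq e2.2) i) i
    · exact ⟨Fin.cases y.1 y.2, rfl⟩
    · have h3 : (fun i => inj i (z i) : (fun i => A i (z i)) ⟶ C) =
          (ψ fun i => A i (z i)).hom ≫
          (consLeft (A 0 (z 0))).map (fun i => inj i.succ (z i.succ)) ≫ p (z 0) := by
        funext i
        refine Fin.cases ?_ (fun i => ?_) i
        · change _ = 𝟙 _ ≫ 𝟙 _ ≫ inj 0 (z 0)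
          simp
        · change _ = 𝟙 _ ≫ inj i.succ (z i.succ) ≫ 𝟙 _
          simp
      refine (congrArg F.map h3).trans ?_
      rw [F.map_comp]
      refine congrArg (F.map (ψ fun i => A i (z i)).hom ≫ ·) ?_
      refine (F.map_comp _ _).trans ?_
      exact (Category.comp_id _).symm

end

/-! ### Doubly nested sequences -/

namespace Subdivision

variable {N k : ℕ}

theorem exists_index (d : Subdivision N k) (s : Fin N) :
    ∃ (i : Fin k) (j : Fin (d.len i)), d.index i j = s := by
  have h : ∀ m : Fin (k + 1), (s : ℕ) < d.cut m →
      ∃ (i : Fin k) (j : Fin (d.len i)), d.index i j = s := by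
    intro m
    induction m using Fin.induction with
    | zero =>
      intro h
      rw [d.cut_zero] at h
      exact absurd h (Nat.not_lt_zero _)
    | succ i ih =>
      intro h
      by_cases h' : (s : ℕ) < d.cut i.castSucc
      · exact ih h'
      · have h1 := d.cut_succ i
        refine ⟨i, ⟨(s : ℕ) - d.cut i.castSucc, by omega⟩, ?_⟩
        ext
        simp only [index]
        omega
  refine h (Fin.last k) ?_
  rw [d.cut_last]
  exact s.isLt

theorem index_lt (d : Subdivision N k) {i i' : Fin k} (h : i < i') (j : Fin (d.len i))
    (j' : Fin (d.len i')) : d.index i j < d.index i' j' := by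
  have h1 := d.cut_succ i
  have h2 : d.cut i.succ ≤ d.cut i'.castSucc := by
    apply d.cut_mono
    rw [Fin.le_def]
    rw [Fin.lt_def] at h
    simp only [Fin.val_succ, Fin.val_castSucc]
    omega
  rw [Fin.le_def] at h2
  have h3 := j.isLt
  rw [Fin.lt_def]
  simp only [index]
  omega

theorem index_inj (d : Subdivision N k) {i i' : Fin k} {j : Fin (d.len i)} {j' : Fin (d.len i')}
    (h : d.index i j = d.index i' j') : i = i' ∧ (j : ℕ) = j' := by
  have hi : i = i' := by
    rcases lt_trichotomy i i' with h1 | h1 | h1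
    · exact absurd h (d.index_lt h1 j j').ne
    · exact h1
    · exact absurd h (d.index_lt h1 j' j).ne'
  subst hi
  refine ⟨rfl, ?_⟩
  have := congrArg Fin.val h
  simpa [index] using this

theorem exists_extend (d : Subdivision N k) {P : Fin N → Type w}
    (z : ∀ i j, P (d.index i j)) : ∃ z' : ∀ s, P s, ∀ i j, z' (d.index i j) = z i j := by
  have h : ∀ s, ∃ q : P s, ∀ i j, d.index i j = s → HEq q (z i j) := by
    intro s
    obtain ⟨i, j, rfl⟩ := d.exists_index s
    refine ⟨z i j, fun i' j' h => ?_⟩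
    obtain ⟨rfl, h2⟩ := d.index_inj h
    obtain rfl := Fin.ext h2
    rfl
  choose z' hz using h
  exact ⟨z', fun i j => eq_of_heq (hz _ i j rfl)⟩

theorem eq_of_len {d d' : Subdivision N k} (h : d.len = d'.len) : d = d' := by
  obtain ⟨cut, len, h0, h1, h2⟩ := d
  obtain ⟨cut', len', h0', h1', h2'⟩ := d'
  obtain rfl : len = len' := h
  obtain rfl : cut = cut' := by
    funext i
    induction i using Fin.induction with
    | zero => rw [h0, h0']
    | succ i ih =>
      ext
      rw [h2, h2', ih]
  rfl

theorem total_eq_of_len {N' : ℕ} {d : Subdivision N k} {d' : Subdivision N' k}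
    (h : d.len = d'.len) : N = N' := by
  have : ∀ i, (d.cut i : ℕ) = d'.cut i := by
    intro i
    induction i using Fin.induction with
    | zero => rw [d.cut_zero, d'.cut_zero]; rfl
    | succ i ih => rw [d.cut_succ, d'.cut_succ, ih, h]
  have := this (Fin.last k)
  rwa [d.cut_last, d'.cut_last] at this

end Subdivision

/-- Joining sequences end to end. -/
theorem exists_join {S : Type w} (n : ℕ → ℕ) (z : ℕ → ℕ → S)
    (hz : ∀ i, z (i + 1) 0 = z i (n i)) (m : ℕ) :
    ∃ f : ℕ → S, f (∑ x ∈ Finset.range m, n x) = z m 0 ∧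
      ∀ i < m, ∀ j ≤ n i, f ((∑ x ∈ Finset.range i, n x) + j) = z i j := by
  induction m with
  | zero => exact ⟨fun _ => z 0 0, rfl, fun i hi => absurd hi (Nat.not_lt_zero _)⟩
  | succ m ih =>
    obtain ⟨f, hf, hf'⟩ := ih
    have key : ∀ j ≤ n m, (if (∑ x ∈ Finset.range m, n x) + j ≤ ∑ x ∈ Finset.range m, n x then
        f ((∑ x ∈ Finset.range m, n x) + j) else
        z m ((∑ x ∈ Finset.range m, n x) + j - ∑ x ∈ Finset.range m, n x)) = z m j := by
      intro j _
      split_ifs with h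
      · obtain rfl : j = 0 := by omega
        exact hf
      · rw [Nat.add_sub_cancel_left]
    refine ⟨fun s => if s ≤ ∑ x ∈ Finset.range m, n x then f s else
      z m (s - ∑ x ∈ Finset.range m, n x), ?_, fun i hi j hj => ?_⟩
    · rw [Finset.sum_range_succ, hz]
      exact key _ le_rfl
    · rcases Nat.lt_succ_iff_lt_or_eq.1 hi with h | rfl
      · have h1 : (∑ x ∈ Finset.range i, n x) + j ≤ ∑ x ∈ Finset.range m, n x := by
          have h2 : ∑ x ∈ Finset.range (i + 1), n x ≤ ∑ x ∈ Finset.range m, n x :=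
            Finset.sum_le_sum_of_subset (Finset.range_subset_range.2 h)
          rw [Finset.sum_range_succ] at h2
          omega
        simp only [if_pos h1]
        exact hf' i h j hj
      · exact key j hj

namespace Chain

variable {S : Type w}

/-- The underlying sequence of a chain. -/
def data {a b : S} (p : Chain a b) : Σ n : ℕ, Fin (n + 1) → S := ⟨p.len, p.pt⟩

theorem ext_data {a b : S} {p q : Chain a b} (h : p.data = q.data) : p = q := by
  obtain ⟨n, f, h0, h1⟩ := p
  obtain ⟨m, g, h0', h1'⟩ := q
  obtain ⟨h2, h3⟩ := Sigma.mk.inj h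
  simp only at h2
  subst h2
  obtain rfl := eq_of_heq h3
  rfl

/-- A sequence together with a chain between any two consecutive elements. -/
abbrev Nested (a b : S) := Σ y : Chain a b, ∀ i : Fin y.len, Chain (y.pt i.castSucc) (y.pt i.succ)

/-- A sequence together with a subdivision. -/
abbrev Divided (a b : S) := Σ p : Chain a b, Σ k : ℕ, Subdivision p.len k

/-- A subdivided sequence regarded as a doubly nested sequence. -/
def Divided.nested {a b : S} (t : Divided a b) : Nested a b :=
  ⟨t.1.coarse t.2.2, fun i => t.1.block t.2.2 i⟩

theorem nested_injective {a b : S} :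
    Function.Injective (Divided.nested : Divided a b → Nested a b) := by
  rintro ⟨p, k, d⟩ ⟨p', k', d'⟩ h
  have h1 := congrArg (fun t : Nested a b =>
    (⟨t.1.len, fun i => (t.2 i).data⟩ : Σ k : ℕ, Fin k → Σ n : ℕ, Fin (n + 1) → S)) h
  obtain ⟨h2, h3⟩ := Sigma.mk.inj h1
  change k = k' at h2
  subst h2
  have h4 : ∀ i, (p.block d i).data = (p'.block d' i).data := congrFun (eq_of_heq h3)
  have hl : d.len = d'.len := funext fun i => congrArg Sigma.fst (h4 i)
  obtain ⟨n, f, h0, hn⟩ := p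
  obtain ⟨n', f', h0', hn'⟩ := p'
  obtain rfl : n = n' := Subdivision.total_eq_of_len hl
  obtain rfl := Subdivision.eq_of_len hl
  obtain rfl : f = f' := by
    funext s
    refine Fin.cases (h0.trans h0'.symm) (fun s => ?_) s
    obtain ⟨i, j, rfl⟩ := d.exists_index s
    have h5 := eq_of_heq (Sigma.mk.inj (h4 i)).2
    exact congrFun h5 j.succ
  rfl

theorem nested_surjective {a b : S} :
    Function.Surjective (Divided.nested : Divided a b → Nested a b) := by
  rintro ⟨y, z⟩
  let n : ℕ → ℕ := fun i => if h : i < y.len then (z ⟨i, h⟩).len else 0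
  let zz : ℕ → ℕ → S := fun i j => if h : i < y.len then
    (if h' : j < (z ⟨i, h⟩).len + 1 then (z ⟨i, h⟩).pt ⟨j, h'⟩ else b) else b
  have hn : ∀ i : Fin y.len, n i = (z i).len := fun i => dif_pos i.isLt
  have hzz : ∀ (i : Fin y.len) (j : Fin ((z i).len + 1)), zz i j = (z i).pt j := by
    intro i j
    change dite _ _ _ = _
    rw [dif_pos i.isLt]
    exact dif_pos j.isLt
  have hzs : ∀ i : Fin y.len, zz i 0 = y.pt i.castSucc := fun i =>
    (hzz i 0).trans (z i).pt_zero
  have hze : ∀ i : Fin y.len, zz i (n i) = y.pt i.succ := fun i => by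
    rw [hn]
    exact (hzz i (Fin.last _)).trans (z i).pt_last
  have hb : ∀ i, y.len ≤ i → ∀ j, zz i j = b := fun i hi j => dif_neg (by omega)
  have hz : ∀ i, zz (i + 1) 0 = zz i (n i) := by
    intro i
    rcases lt_trichotomy (i + 1) y.len with h | h | h
    · have h1 := hzs ⟨i + 1, h⟩
      have h2 := hze ⟨i, by omega⟩
      exact h1.trans h2.symm
    · have h2 := hze ⟨i, by omega⟩
      rw [hb _ h.ge]
      refine (Eq.trans h2 ?_).symm
      refine Eq.trans ?_ y.pt_last
      congr 1
      ext
      exact h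
    · rw [hb _ h.le, hb _ (by omega)]
  obtain ⟨f, hf, hf'⟩ := exists_join n zz hz y.len
  let c : ℕ → ℕ := fun i => ∑ x ∈ Finset.range i, n x
  have hc : ∀ i ≤ y.len, c i ≤ c y.len := fun i hi =>
    Finset.sum_le_sum_of_subset (Finset.range_subset_range.2 hi)
  have hcz : ∀ i : Fin (y.len + 1), f (c i) = y.pt i := by
    intro i
    refine Fin.lastCases ?_ (fun i => ?_) i
    · refine hf.trans ((hb _ le_rfl _).trans y.pt_last.symm)
    · exact (hf' i i.isLt 0 (Nat.zero_le _)).trans (hzs i)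
  let p : Chain a b :=
    { len := c y.len
      pt := fun i => f i
      pt_zero := (hcz 0).trans y.pt_zero
      pt_last := (hcz (Fin.last _)).trans y.pt_last }
  let d : Subdivision p.len y.len :=
    { cut := fun i => ⟨c i, Nat.lt_succ_of_le (hc i (Nat.le_of_lt_succ i.isLt))⟩
      len := fun i => (z i).len
      cut_zero := rfl
      cut_last := rfl
      cut_succ := fun i => by
        simp only [Fin.val_succ, Fin.val_castSucc]
        rw [← hn i]
        exact Finset.sum_range_succ _ _ }
  refine ⟨⟨p, y.len, d⟩, ?_⟩
  have hy : p.coarse d = y := by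
    refine ext_data ?_
    have : (p.coarse d).pt = y.pt := funext hcz
    exact congrArg (Sigma.mk y.len) this
  have hblock : ∀ i : Fin y.len, (p.block d i).data = (z i).data := by
    intro i
    have : (p.block d i).pt = (z i).pt := by
      funext j
      refine Eq.trans ?_ (hzz i j)
      refine hf' i i.isLt j ?_
      rw [hn]
      exact Nat.le_of_lt_succ j.isLt
    exact congrArg (Sigma.mk (z i).len) this
  have gen : ∀ (y' : Chain a b) (_ : y' = y)
      (z' : ∀ i : Fin y'.len, Chain (y'.pt i.castSucc) (y'.pt i.succ)),
      (∀ (i : Fin y'.len) (i' : Fin y.len), (i : ℕ) = i' → (z' i).data = (z i').data) →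
      (⟨y', z'⟩ : Nested a b) = ⟨y, z⟩ := by
    rintro y' rfl z' h
    obtain rfl : z' = z := funext fun i => ext_data (h i i rfl)
    rfl
  refine gen _ hy _ fun i i' h => ?_
  obtain rfl : i = i' := Fin.ext h
  exact hblock i

end Chain

/-! ### The monad on enriched graphs associated to a distributive multitensor -/

namespace Gamma

variable {V : Type u} [Category.{v} V] [HasCoproducts.{w} V] (E : Multitensor V)

/-- The graph `Γ(E)(X)`: it has the objects of `X`, and its hom from `a` to `b` is the coproduct of
the objects `E_i X(x_{i-1}, x_i)` over all sequences `a = x₀, …, xₙ = b`. -/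
noncomputable def onObj (X : EnrichedGraph.{v, u, w} V) : EnrichedGraph.{v, u, w} V where
  carrier := X.carrier
  hom a b := ∐ fun p : Chain a b => (E.tensor p.len).obj (X.homs p)

/-- The inclusion of the summand indexed by a sequence. -/
noncomputable def inj (X : EnrichedGraph.{v, u, w} V) {a b : X.carrier} (p : Chain a b) :
    (E.tensor p.len).obj (X.homs p) ⟶ (onObj E X).hom a b :=
  Sigma.ι (fun p : Chain a b => (E.tensor p.len).obj (X.homs p)) p

theorem isCoprod_inj (X : EnrichedGraph.{v, u, w} V) (a b : X.carrier) :
    IsCoprod fun p : Chain a b => inj E X p :=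
  IsCoprod.sigma _

/-- The action of `Γ(E)` on a morphism of graphs. -/
noncomputable def onMap {X Y : EnrichedGraph.{v, u, w} V} (f : X ⟶ Y) : onObj E X ⟶ onObj E Y where
  obj := f.obj
  map a b := Sigma.desc fun p : Chain a b =>
    E.tensor.tmap (fun i => f.map (p.pt i.castSucc) (p.pt i.succ)) ≫ inj E Y (p.image f.obj)

theorem inj_onMap {X Y : EnrichedGraph.{v, u, w} V} (f : X ⟶ Y) {a b : X.carrier}
    (p : Chain a b) : inj E X p ≫ (onMap E f).map a b =
      E.tensor.tmap (fun i => f.map (p.pt i.castSucc) (p.pt i.succ)) ≫ inj E Y (p.image f.obj) :=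
  Sigma.ι_desc _ _

/-- The endofunctor `Γ(E)`. -/
noncomputable def functor : EnrichedGraph.{v, u, w} V ⥤ EnrichedGraph.{v, u, w} V where
  obj := onObj E
  map := onMap E
  map_id X := by
    refine EnrichedGraph.Hom.ext rfl (heq_of_eq ?_)
    funext a b
    refine (isCoprod_inj E X a b).hom_ext fun p => (inj_onMap E (𝟙 X) p).trans ?_
    refine (congrArg (· ≫ inj E X p) (E.tensor.tmap_id (X.homs p))).trans ?_
    exact (Category.id_comp _).trans (Category.comp_id _).symm
  map_comp {X Y Z} f g := by
    refine EnrichedGraph.Hom.ext rfl (heq_of_eq ?_)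
    funext a b
    refine (isCoprod_inj E X a b).hom_ext fun p => (inj_onMap E (f ≫ g) p).trans ?_
    refine Eq.trans ?_ (Category.assoc _ _ _)
    refine Eq.trans ?_ (congrArg (· ≫ (onMap E g).map (f.obj a) (f.obj b)) (inj_onMap E f p)).symm
    refine Eq.trans ?_ (Category.assoc _ _ _).symm
    refine Eq.trans ?_ (congrArg (E.tensor.tmap _ ≫ ·) (inj_onMap E g (p.image f.obj))).symm
    refine Eq.trans ?_ (Category.assoc _ _ _)
    exact congrArg (· ≫ inj E Z (p.image (f ≫ g).obj)) (E.tensor.tmap_comp _ _).symm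

/-- The inclusion of `E_i E_j X(x_{ij-1}, x_ij)` into a hom of `Γ(E)(Γ(E)(X))`. -/
noncomputable def inj₂ (X : EnrichedGraph.{v, u, w} V) {a b : X.carrier} (p : Chain a b) {k : ℕ}
    (d : Subdivision p.len k) :
    (E.tensor k).obj (fun i => (E.tensor (d.len i)).obj fun j => X.homs p (d.index i j)) ⟶
      (onObj E (onObj E X)).hom a b :=
  E.tensor.tmap (fun i => inj E X (p.block d i)) ≫ inj E (onObj E X) (p.coarse d)

/-- The general form of `inj₂`, for nested sequences. -/
noncomputable def injNested (X : EnrichedGraph.{v, u, w} V) {a b : X.carrier}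
    (t : Chain.Nested a b) :
    (E.tensor t.1.len).obj (fun i => (E.tensor (t.2 i).len).obj (X.homs (t.2 i))) ⟶
      (onObj E (onObj E X)).hom a b :=
  E.tensor.tmap (fun i => inj E X (t.2 i)) ≫ inj E (onObj E X) t.1

variable {E}

theorem isCoprod_inj₂ (hE : Multitensor.IsDistributive.{v, u, w} E) (X : EnrichedGraph.{v, u, w} V)
    (a b : X.carrier) : IsCoprod fun t : Chain.Divided a b => inj₂ E X t.1 t.2.2 := by
  have h := (isCoprod_inj E (onObj E X) a b).trans fun y : Chain a b =>
    isCoprod_multi (E.tensor y.len) (preservesInEach_of_slot _ (hE y.len))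
      (fun i (z : Chain (y.pt i.castSucc) (y.pt i.succ)) => inj E X z)
      fun i => isCoprod_inj E X _ _
  refine h.reindex Chain.Divided.nested ⟨Chain.nested_injective, Chain.nested_surjective⟩
    (fun t => Iso.refl _) (Iso.refl _) _ fun t => ?_
  exact ((Category.id_comp _).trans (Category.comp_id _)).symm

/-- The hom maps of the multiplication of `Γ(E)`, determined by `inj₂_mul`. -/
noncomputable def mulHom (hE : Multitensor.IsDistributive.{v, u, w} E)
    (X : EnrichedGraph.{v, u, w} V) (a b : X.carrier) :
    (onObj E (onObj E X)).hom a b ⟶ (onObj E X).hom a b :=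
  (isCoprod_inj₂ hE X a b _ fun t => E.str.sub t.2.2 (X.homs t.1) ≫ inj E X t.1).choose

theorem inj₂_mul (hE : Multitensor.IsDistributive.{v, u, w} E) (X : EnrichedGraph.{v, u, w} V)
    {a b : X.carrier} (p : Chain a b) {k : ℕ} (d : Subdivision p.len k) :
    inj₂ E X p d ≫ mulHom hE X a b = E.str.sub d (X.homs p) ≫ inj E X p :=
  (isCoprod_inj₂ hE X a b _ fun t =>
    E.str.sub t.2.2 (X.homs t.1) ≫ inj E X t.1).choose_spec.1 ⟨p, k, d⟩

variable (E)

/-- The hom maps of the unit of `Γ(E)`. -/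
noncomputable def unitHom (X : EnrichedGraph.{v, u, w} V) (a b : X.carrier) :
    X.hom a b ⟶ (onObj E X).hom a b :=
  E.str.unit (X.homs (Chain.pair a b)) ≫ inj E X (Chain.pair a b)

variable {E}

theorem inj₂_onMap {X Y : EnrichedGraph.{v, u, w} V} (f : X ⟶ Y) {a b : X.carrier}
    (p : Chain a b) {k : ℕ} (d : Subdivision p.len k) :
    inj₂ E X p d ≫ (onMap E (onMap E f)).map a b =
      E.tensor.tmap (fun i => E.tensor.tmap fun j =>
        f.map (p.pt (d.index i j).castSucc) (p.pt (d.index i j).succ)) ≫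
          inj₂ E Y (p.image f.obj) d := by
  refine (Category.assoc _ _ _).trans ?_
  refine (congrArg (E.tensor.tmap _ ≫ ·) (inj_onMap E (onMap E f) (p.coarse d))).trans ?_
  refine (Category.assoc _ _ _).symm.trans ?_
  refine Eq.trans ?_ (Category.assoc _ _ _)
  refine congrArg (· ≫ inj E (onObj E Y) ((p.image f.obj).coarse d)) ?_
  refine (E.tensor.tmap_comp _ _).trans (Eq.trans ?_ (E.tensor.tmap_comp _ _).symm)
  exact congrArg E.tensor.tmap (funext fun i => inj_onMap E f (p.block d i))

theorem unit_inj_congr (X : EnrichedGraph.{v, u, w} V) {a b : X.carrier}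
    {f g : Fin 2 → X.carrier} (h : f = g) (hf : f 0 = a) (hf' : f (Fin.last 1) = b) (hg : g 0 = a)
    (hg' : g (Fin.last 1) = b) :
    HEq (E.str.unit (X.homs (⟨1, f, hf, hf'⟩ : Chain a b)) ≫ inj E X ⟨1, f, hf, hf'⟩)
      (E.str.unit (X.homs (⟨1, g, hg, hg'⟩ : Chain a b)) ≫ inj E X ⟨1, g, hg, hg'⟩) := by
  subst h
  rfl

theorem inj_congr (X : EnrichedGraph.{v, u, w} V) {a b : X.carrier} {n : ℕ}
    {f g : Fin (n + 1) → X.carrier} (h : f = g) (hf : f 0 = a) (hf' : f (Fin.last n) = b)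
    (hg : g 0 = a) (hg' : g (Fin.last n) = b)
    (e : ∀ j : Fin n, X.hom (f j.castSucc) (f j.succ) = X.hom (g j.castSucc) (g j.succ)) :
    E.tensor.tmap (fun j => eqToHom (e j)) ≫ inj E X (⟨n, g, hg, hg'⟩ : Chain a b) =
      inj E X ⟨n, f, hf, hf'⟩ := by
  subst h
  simp only [eqToHom_refl]
  exact (congrArg (· ≫ inj E X (⟨n, f, hf, hf'⟩ : Chain a b)) (E.tensor.tmap_id
    (fun j => X.hom (f j.castSucc) (f j.succ)))).trans (Category.id_comp _)

theorem injNested_congr (X : EnrichedGraph.{v, u, w} V) {a b : X.carrier} {n : ℕ} {m : Fin n → ℕ}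
    {f g : Fin (n + 1) → X.carrier} (h : f = g) (hf : f 0 = a) (hf' : f (Fin.last n) = b)
    (hg : g 0 = a) (hg' : g (Fin.last n) = b) {F G : ∀ j : Fin n, Fin (m j + 1) → X.carrier}
    (H : F = G) (hF : ∀ j, F j 0 = f j.castSucc) (hF' : ∀ j, F j (Fin.last _) = f j.succ)
    (hG : ∀ j, G j 0 = g j.castSucc) (hG' : ∀ j, G j (Fin.last _) = g j.succ)
    (e : ∀ (j : Fin n) (l : Fin (m j)), X.hom (F j l.castSucc) (F j l.succ) =
      X.hom (G j l.castSucc) (G j l.succ)) :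
    E.tensor.tmap (fun j => E.tensor.tmap fun l => eqToHom (e j l)) ≫
        injNested E X ⟨(⟨n, g, hg, hg'⟩ : Chain a b), fun j => ⟨m j, G j, hG j, hG' j⟩⟩ =
      injNested E X ⟨(⟨n, f, hf, hf'⟩ : Chain a b), fun j => ⟨m j, F j, hF j, hF' j⟩⟩ := by
  subst h
  subst H
  simp only [eqToHom_refl, TensorFamily.tmap_id]
  exact Category.id_comp _

/-- The unit of `Γ(E)`. -/
noncomputable def unit : 𝟭 (EnrichedGraph.{v, u, w} V) ⟶ functor E where
  app X := EnrichedGraph.Hom.ofHoms (unitHom E X)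
  naturality X Y f := by
    refine EnrichedGraph.Hom.ext rfl (heq_of_eq ?_)
    funext a b
    change f.map a b ≫ E.str.unit (Y.homs (Chain.pair (f.obj a) (f.obj b))) ≫
        inj E Y (Chain.pair (f.obj a) (f.obj b)) =
      (E.str.unit (X.homs (Chain.pair a b)) ≫ inj E X (Chain.pair a b)) ≫ (onMap E f).map a b
    have e : (Chain.pair (f.obj a) (f.obj b)).pt = ((Chain.pair a b).image f.obj).pt := by
      funext i
      exact Fin.cases rfl (fun _ => rfl) i
    have h1 := eq_of_heq (unit_inj_congr (E := E) Y e (Chain.pair _ _).pt_zero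
      (Chain.pair _ _).pt_last ((Chain.pair a b).image f.obj).pt_zero
      ((Chain.pair a b).image f.obj).pt_last)
    refine (congrArg (f.map a b ≫ ·) h1).trans ?_
    refine Eq.trans ?_ (Category.assoc _ _ _).symm
    refine Eq.trans ?_ (congrArg (E.str.unit _ ≫ ·) (inj_onMap E f (Chain.pair a b))).symm
    refine (Category.assoc _ _ _).symm.trans (Eq.trans ?_ (Category.assoc _ _ _))
    exact congrArg (· ≫ inj E Y ((Chain.pair a b).image f.obj))
      (E.str.unit_naturality fun i : Fin 1 =>
        f.map ((Chain.pair a b).pt i.castSucc) ((Chain.pair a b).pt i.succ))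

/-- The multiplication of `Γ(E)`. -/
noncomputable def mul (hE : Multitensor.IsDistributive.{v, u, w} E) :
    functor E ⋙ functor E ⟶ (functor E : EnrichedGraph.{v, u, w} V ⥤ EnrichedGraph.{v, u, w} V)
    where
  app X := EnrichedGraph.Hom.ofHoms (mulHom hE X)
  naturality X Y f := by
    refine EnrichedGraph.Hom.ext rfl (heq_of_eq ?_)
    funext a b
    change (onMap E (onMap E f)).map a b ≫ mulHom hE Y (f.obj a) (f.obj b) =
      mulHom hE X a b ≫ (onMap E f).map a b
    refine (isCoprod_inj₂ hE X a b).hom_ext fun ⟨p, k, d⟩ => ?_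
    refine (Category.assoc _ _ _).symm.trans (Eq.trans ?_ (Category.assoc _ _ _))
    refine (congrArg (· ≫ mulHom hE Y (f.obj a) (f.obj b)) (inj₂_onMap f p d)).trans ?_
    refine Eq.trans ?_ (congrArg (· ≫ (onMap E f).map a b) (inj₂_mul hE X p d)).symm
    refine (Category.assoc _ _ _).trans (Eq.trans ?_ (Category.assoc _ _ _).symm)
    refine (congrArg (E.tensor.tmap _ ≫ ·) (inj₂_mul hE Y (p.image f.obj) d)).trans ?_
    refine Eq.trans ?_ (congrArg (E.str.sub d _ ≫ ·) (inj_onMap E f p)).symm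
    refine (Category.assoc _ _ _).symm.trans (Eq.trans ?_ (Category.assoc _ _ _))
    exact congrArg (· ≫ inj E Y (p.image f.obj)) (E.str.sub_naturality d fun s =>
      f.map (p.pt s.castSucc) (p.pt s.succ))

theorem unit_mul (hE : Multitensor.IsDistributive.{v, u, w} E) (X : EnrichedGraph.{v, u, w} V)
    (a b : X.carrier) : unitHom E (onObj E X) a b ≫ mulHom hE X a b = 𝟙 _ := by
  refine (isCoprod_inj E X a b).hom_ext fun p => ?_
  obtain ⟨n, pt, rfl, rfl⟩ := p
  let p : Chain (pt 0) (pt (Fin.last n)) := ⟨n, pt, rfl, rfl⟩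
  let d := Subdivision.whole n
  have e : (Chain.pair (pt 0) (pt (Fin.last n))).pt = (p.coarse d).pt := by
    funext i
    exact Fin.cases rfl (fun _ => rfl) i
  have h1 : unitHom E (onObj E X) (pt 0) (pt (Fin.last n)) =
      E.str.unit ((onObj E X).homs (p.coarse d)) ≫ inj E (onObj E X) (p.coarse d) :=
    eq_of_heq (unit_inj_congr (E := E) (onObj E X) e (Chain.pair _ _).pt_zero
      (Chain.pair _ _).pt_last (p.coarse d).pt_zero (p.coarse d).pt_last)
  have e2 : ((p.block d 0).pt : Fin (n + 1) → X.carrier) = pt := by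
    funext j
    refine congrArg pt (Fin.ext ?_)
    exact Nat.zero_add _
  have h2 := inj_congr (E := E) X e2 (p.block d 0).pt_zero (p.block d 0).pt_last rfl rfl fun j =>
    congrArg (X.homs p) (Subdivision.index_whole n 0 j)
  have h3 := E.str.unit_naturality (fun i : Fin 1 => inj E X (p.block d i))
  have h4 := E.str.unit_sub (X.homs p)
  have h5 := inj₂_mul hE X p d
  refine Eq.trans ?_ (Category.comp_id _).symm
  refine (congrArg (fun q => inj E X p ≫ q ≫ mulHom hE X _ _) h1).trans ?_
  -- replace `inj p` by the inclusion at the only block of `p`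
  have iso : IsIso (E.tensor.tmap fun j => eqToHom
      (congrArg (X.homs p) (Subdivision.index_whole n 0 j))) :=
    ((E.tensor n).mapIso (Pi.isoMk fun j =>
      eqToIso (congrArg (X.homs p) (Subdivision.index_whole n 0 j)))).isIso_hom
  refine (cancel_epi (E.tensor.tmap fun j => eqToHom
      (congrArg (X.homs p) (Subdivision.index_whole n 0 j)))).1 ?_
  refine (Category.assoc _ _ _).symm.trans ?_
  refine (congrArg (· ≫ (E.str.unit ((onObj E X).homs (p.coarse d)) ≫
    inj E (onObj E X) (p.coarse d)) ≫ mulHom hE X _ _) h2).trans ?_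
  refine (congrArg (inj E X (p.block d 0) ≫ ·) (Category.assoc _ _ _)).trans ?_
  refine (Category.assoc _ _ _).symm.trans ?_
  refine (congrArg (· ≫ inj E (onObj E X) (p.coarse d) ≫ mulHom hE X _ _) h3).trans ?_
  refine (Category.assoc _ _ _).trans ?_
  refine (congrArg (E.str.unit _ ≫ ·) (Category.assoc _ _ _).symm).trans ?_
  refine (congrArg (E.str.unit _ ≫ ·) h5).trans ?_
  refine (Category.assoc _ _ _).symm.trans ?_
  exact congrArg (· ≫ inj E X p) h4

theorem map_unit_mul (hE : Multitensor.IsDistributive.{v, u, w} E)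
    (X : EnrichedGraph.{v, u, w} V) (a b : X.carrier) :
    (onMap E (unit.app X)).map a b ≫ mulHom hE X a b = 𝟙 _ := by
  refine (isCoprod_inj E X a b).hom_ext fun p => ?_
  let d := Subdivision.singles p.len
  refine Eq.trans ?_ (Category.comp_id _).symm
  refine (Category.assoc _ _ _).symm.trans ?_
  refine (congrArg (· ≫ mulHom hE X a b) (inj_onMap E (unit.app X) p)).trans ?_
  have h1 : ∀ i : Fin p.len, unitHom E X (p.pt i.castSucc) (p.pt i.succ) =
      E.str.unit (X.homs (p.block d i)) ≫ inj E X (p.block d i) := by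
    intro i
    have e : (Chain.pair (p.pt i.castSucc) (p.pt i.succ)).pt = (p.block d i).pt := by
      funext j
      exact Fin.cases rfl (fun j => Fin.cases rfl (fun j => j.elim0) j) j
    exact eq_of_heq (unit_inj_congr (E := E) X e (Chain.pair _ _).pt_zero
      (Chain.pair _ _).pt_last (p.block d i).pt_zero (p.block d i).pt_last)
  have h2 := inj₂_mul hE X p d
  have h3 := E.str.sub_unit (X.homs p)
  refine (congrArg (fun q => (E.tensor.tmap q ≫ inj E (onObj E X) (p.coarse d)) ≫
    mulHom hE X a b) (funext h1)).trans ?_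
  refine (congrArg (fun q => (q ≫ inj E (onObj E X) (p.coarse d)) ≫
    mulHom hE X a b) (E.tensor.tmap_comp _ _).symm).trans ?_
  refine (congrArg (· ≫ mulHom hE X a b) (Category.assoc _ _ _)).trans ?_
  refine (Category.assoc _ _ _).trans ?_
  refine (congrArg (E.tensor.tmap _ ≫ ·) h2).trans ?_
  refine (Category.assoc _ _ _).symm.trans ?_
  exact (congrArg (· ≫ inj E X p) h3).trans (Category.id_comp _)

/-- The inclusion of `E_i E_j E_l X(x_{ijl-1}, x_ijl)` into a hom of `Γ(E)(Γ(E)(Γ(E)(X)))`. -/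
noncomputable def inj₃ (E : Multitensor V) (X : EnrichedGraph.{v, u, w} V) {a b : X.carrier}
    (p : Chain a b) {M k : ℕ} (d : Subdivision p.len M) (c : Subdivision M k) :
    (E.tensor k).obj (fun i => (E.tensor (c.len i)).obj fun j =>
        (E.tensor (d.len (c.index i j))).obj fun l => X.homs p (d.index (c.index i j) l)) ⟶
      (onObj E (onObj E (onObj E X))).hom a b :=
  E.tensor.tmap (fun i => E.tensor.tmap fun j => inj E X (p.block d (c.index i j))) ≫
    inj₂ E (onObj E X) (p.coarse d) c

theorem inj₃_hom_ext (hE : Multitensor.IsDistributive.{v, u, w} E)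
    (X : EnrichedGraph.{v, u, w} V) {a b : X.carrier} {Q : V}
    {f g : (onObj E (onObj E (onObj E X))).hom a b ⟶ Q}
    (h : ∀ (p : Chain a b) (M k : ℕ) (d : Subdivision p.len M) (c : Subdivision M k),
      inj₃ E X p d c ≫ f = inj₃ E X p d c ≫ g) : f = g := by
  refine (isCoprod_inj₂ hE (onObj E X) a b).hom_ext fun ⟨y, k, c⟩ => ?_
  have h1 := isCoprod_multi (E.tensor k) (preservesInEach_of_slot _ (hE k))
    (J := fun i => ∀ j : Fin (c.len i),
      Chain (y.pt (c.index i j).castSucc) (y.pt (c.index i j).succ))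
    (A := fun i z => (E.tensor (c.len i)).obj fun j => (E.tensor (z j).len).obj (X.homs (z j)))
    (C := fun i => (E.tensor (c.len i)).obj fun j =>
      (onObj E X).hom (y.pt (c.index i j).castSucc) (y.pt (c.index i j).succ))
    (fun i (z : ∀ j : Fin (c.len i), Chain (y.pt (c.index i j).castSucc) (y.pt (c.index i j).succ)) =>
      E.tensor.tmap fun j => inj E X (z j))
    fun i => isCoprod_multi (E.tensor (c.len i)) (preservesInEach_of_slot _ (hE _))
      (fun (j : Fin (c.len i)) (z : Chain (y.pt (c.index i j).castSucc) (y.pt (c.index i j).succ)) =>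
        inj E X z) fun j => isCoprod_inj E X _ _
  refine h1.hom_ext fun z => ?_
  obtain ⟨z', hz⟩ := c.exists_extend
    (P := fun s => Chain (y.pt s.castSucc) (y.pt s.succ)) z
  obtain rfl : (fun i j => z' (c.index i j)) = z := funext fun i => funext fun j => hz i j
  obtain ⟨⟨p, M, d⟩, hp⟩ := Chain.nested_surjective (⟨y, z'⟩ : Chain.Nested a b)
  cases hp
  exact (Category.assoc _ _ _).symm.trans ((h p M k d c).trans (Category.assoc _ _ _))

theorem inj_block_block (X : EnrichedGraph.{v, u, w} V) {a b : X.carrier} (p : Chain a b)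
    {M k : ℕ} (d : Subdivision p.len M) (c : Subdivision M k) (i : Fin k) :
    E.tensor.tmap (fun j => inj E X (p.block d (c.index i j))) ≫
        inj E (onObj E X) ((p.coarse d).block c i) =
      E.tensor.tmap (fun j => E.tensor.tmap fun l => eqToHom
        (congrArg (X.homs p) (Subdivision.index_comp d c i j l).symm)) ≫
          inj₂ E X (p.block (d.comp c) i) (d.restrict c i) := by
  have h1 : ∀ j : Fin (c.len i + 1), (d.cut (c.cut i.castSucc) : ℕ) ≤
      d.cut ⟨(c.cut i.castSucc : ℕ) + j, c.cut_bound i j⟩ := by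
    intro j
    have : d.cut (c.cut i.castSucc) ≤ d.cut ⟨(c.cut i.castSucc : ℕ) + j, c.cut_bound i j⟩ := by
      apply d.cut_mono
      rw [Fin.le_def]
      simp
    exact this
  refine (injNested_congr (E := E) X (a := p.pt (d.cut (c.cut i.castSucc)))
    (b := p.pt (d.cut (c.cut i.succ))) (n := c.len i) (m := fun j => d.len (c.index i j))
    (f := ((p.coarse d).block c i).pt)
    (g := ((p.block (d.comp c) i).coarse (d.restrict c i)).pt) ?_
    ((p.coarse d).block c i).pt_zero ((p.coarse d).block c i).pt_last
    ((p.block (d.comp c) i).coarse (d.restrict c i)).pt_zero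
    ((p.block (d.comp c) i).coarse (d.restrict c i)).pt_last
    (F := fun j => (p.block d (c.index i j)).pt)
    (G := fun j => ((p.block (d.comp c) i).block (d.restrict c i) j).pt) ?_
    (fun j => (p.block d (c.index i j)).pt_zero) (fun j => (p.block d (c.index i j)).pt_last)
    (fun j => ((p.block (d.comp c) i).block (d.restrict c i) j).pt_zero)
    (fun j => ((p.block (d.comp c) i).block (d.restrict c i) j).pt_last)
    fun j l => congrArg (X.homs p) (Subdivision.index_comp d c i j l).symm).symm
  · funext j
    refine congrArg p.pt (Fin.ext ?_)
    exact (Nat.add_sub_cancel' (h1 j)).symm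
  · funext j l
    refine congrArg p.pt (Fin.ext ?_)
    have h2 := h1 j.castSucc
    change (d.cut (c.index i j).castSucc : ℕ) + l = (d.cut (c.cut i.castSucc) : ℕ) +
      (((d.cut (c.index i j).castSucc : ℕ) - (d.cut (c.cut i.castSucc) : ℕ)) + l)
    change (d.cut (c.cut i.castSucc) : ℕ) ≤ (d.cut (c.index i j).castSucc : ℕ) at h2
    omega

theorem mul_mul (hE : Multitensor.IsDistributive.{v, u, w} E)
    (X : EnrichedGraph.{v, u, w} V) (a b : X.carrier) :
    (onMap E ((mul hE).app X)).map a b ≫ mulHom hE X a b =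
      mulHom hE (onObj E X) a b ≫ mulHom hE X a b := by
  refine inj₃_hom_ext hE X fun p M k d c => ?_
  have hR : inj₃ E X p d c ≫ mulHom hE (onObj E X) a b ≫ mulHom hE X a b =
      (E.str.sub c (fun s => (E.tensor (d.len s)).obj fun l => X.homs p (d.index s l)) ≫
        E.str.sub d (X.homs p)) ≫ inj E X p := by
    refine (Category.assoc _ _ _).trans ?_
    refine (congrArg (E.tensor.tmap _ ≫ ·) (Category.assoc _ _ _).symm).trans ?_
    refine (congrArg (fun q => E.tensor.tmap _ ≫ q ≫ mulHom hE X a b)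
      (inj₂_mul hE (onObj E X) (p.coarse d) c)).trans ?_
    refine (congrArg (E.tensor.tmap _ ≫ ·) (Category.assoc _ _ _)).trans ?_
    refine (Category.assoc _ _ _).symm.trans ?_
    refine (congrArg (· ≫ inj E (onObj E X) (p.coarse d) ≫ mulHom hE X a b)
      (E.str.sub_naturality c fun s => inj E X (p.block d s))).trans ?_
    refine (Category.assoc _ _ _).trans ?_
    refine (congrArg (E.str.sub c _ ≫ ·) (Category.assoc _ _ _).symm).trans ?_
    refine (congrArg (E.str.sub c _ ≫ ·) (inj₂_mul hE X p d)).trans ?_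
    exact (Category.assoc _ _ _).symm
  have hL : inj₃ E X p d c ≫ (onMap E ((mul hE).app X)).map a b =
      E.tensor.tmap (fun i =>
          E.tensor.tmap (fun j => E.tensor.tmap fun l =>
            eqToHom (congrArg (X.homs p) (Subdivision.index_comp d c i j l).symm)) ≫
          E.str.sub (d.restrict c i) fun l => X.homs p ((d.comp c).index i l)) ≫
        inj₂ E X p (d.comp c) := by
    refine (Category.assoc _ _ _).trans ?_
    refine (congrArg (E.tensor.tmap _ ≫ ·) (Category.assoc _ _ _)).trans ?_
    refine (congrArg (fun q => E.tensor.tmap _ ≫ E.tensor.tmap _ ≫ q)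
      (inj_onMap E ((mul hE).app X) ((p.coarse d).coarse c))).trans ?_
    refine (congrArg (E.tensor.tmap _ ≫ ·) (Category.assoc _ _ _).symm).trans ?_
    refine (Category.assoc _ _ _).symm.trans (Eq.trans ?_ (Category.assoc _ _ _))
    refine congrArg (· ≫ inj E (onObj E X) ((p.coarse d).coarse c)) ?_
    refine (congrArg (E.tensor.tmap _ ≫ ·) (E.tensor.tmap_comp _ _)).trans ?_
    refine (E.tensor.tmap_comp _ _).trans (Eq.trans ?_ (E.tensor.tmap_comp _ _).symm)
    refine congrArg E.tensor.tmap (funext fun i => ?_)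
    refine (Category.assoc _ _ _).symm.trans ?_
    refine (congrArg (· ≫ mulHom hE X _ _) (inj_block_block X p d c i)).trans ?_
    refine (Category.assoc _ _ _).trans (Eq.trans ?_ (Category.assoc _ _ _).symm)
    exact congrArg (E.tensor.tmap _ ≫ ·)
      (inj₂_mul hE X (p.block (d.comp c) i) (d.restrict c i))
  refine Eq.trans ?_ hR.symm
  refine (Category.assoc _ _ _).symm.trans ?_
  refine (congrArg (· ≫ mulHom hE X a b) hL).trans ?_
  refine (Category.assoc _ _ _).trans ?_
  refine (congrArg (E.tensor.tmap _ ≫ ·) (inj₂_mul hE X p (d.comp c))).trans ?_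
  refine (Category.assoc _ _ _).symm.trans ?_
  exact congrArg (· ≫ inj E X p) (E.str.assoc d c (X.homs p)).symm

/-- The monad `Γ(E)` on graphs associated to a distributive multitensor `E`. -/
noncomputable def monad (hE : Multitensor.IsDistributive.{v, u, w} E) :
    Monad (EnrichedGraph.{v, u, w} V) where
  toFunctor := functor E
  η := unit
  μ := mul hE
  assoc X := by
    refine EnrichedGraph.Hom.ext rfl (heq_of_eq ?_)
    funext a b
    exact mul_mul hE X a b
  left_unit X := by
    refine EnrichedGraph.Hom.ext rfl (heq_of_eq ?_)
    funext a b
    exact unit_mul hE X a b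
  right_unit X := by
    refine EnrichedGraph.Hom.ext rfl (heq_of_eq ?_)
    funext a b
    exact map_unit_mul hE X a b

end Gamma

/-! ### The four kinds of data -/

section

variable {V : Type u} [Category.{v} V]

/-- Coherence maps making a monad `T` into an opmonoidal monad on `(V, E)`, that is, a monad in the
2-category of lax monoidal categories, oplax monoidal functors and monoidal transformations. The
fields `unit_τ` and `sub_τ` say that `(T, τ)` is an oplax monoidal functor, and the fields `η_τ` and
`μ_τ` say that the unit and the multiplication of `T` are monoidal transformations. -/
@[ext]
structure OpmonoidalCoherence (E : Multitensor V) (T : Monad V) where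
  τ : ∀ {n : ℕ} (X : Fin n → V),
    T.obj ((E.tensor n).obj X) ⟶ (E.tensor n).obj fun i => T.obj (X i)
  naturality : ∀ {n : ℕ} {X Y : Fin n → V} (f : ∀ i, X i ⟶ Y i),
    T.map (E.tensor.tmap f) ≫ τ Y = τ X ≫ E.tensor.tmap fun i => T.map (f i)
  unit_τ : ∀ X : Fin 1 → V, T.map (E.str.unit X) ≫ τ X = E.str.unit fun i => T.obj (X i)
  sub_τ : ∀ {N k : ℕ} (d : Subdivision N k) (X : Fin N → V),
    T.map (E.str.sub d X) ≫ τ X =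
      τ (fun i => (E.tensor (d.len i)).obj fun j => X (d.index i j)) ≫
        E.tensor.tmap (fun i => τ fun j => X (d.index i j)) ≫
          E.str.sub d fun s => T.obj (X s)
  η_τ : ∀ {n : ℕ} (X : Fin n → V),
    T.η.app ((E.tensor n).obj X) ≫ τ X = E.tensor.tmap fun i => T.η.app (X i)
  μ_τ : ∀ {n : ℕ} (X : Fin n → V),
    T.μ.app ((E.tensor n).obj X) ≫ τ X =
      T.map (τ X) ≫ τ (fun i => T.obj (X i)) ≫ E.tensor.tmap fun i => T.μ.app (X i)

/-- The functor `EM(T)`, which sends `(X₁, …, Xₙ)` to `E_i T X_i`. -/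
def TensorFamily.precomp (E : TensorFamily V) (T : V ⥤ V) : TensorFamily V :=
  fun n => Functor.pi (fun _ : Fin n => T) ⋙ E n

/-- A multitensor map: a natural transformation compatible with units and substitutions. -/
structure IsMultitensorMap (E F : Multitensor V) (φ : ∀ n, E.tensor n ⟶ F.tensor n) : Prop where
  unit : ∀ X : Fin 1 → V, E.str.unit X ≫ (φ 1).app X = F.str.unit X
  sub : ∀ {N k : ℕ} (d : Subdivision N k) (X : Fin N → V),
    E.str.sub d X ≫ (φ N).app X =
      E.tensor.tmap (fun i => (φ (d.len i)).app fun j => X (d.index i j)) ≫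
        (φ k).app (fun i => (F.tensor (d.len i)).obj fun j => X (d.index i j)) ≫ F.str.sub d X

/-- The transformation `Eη : E ⟶ EM(T)`. -/
def TensorFamily.precompUnit (E : TensorFamily V) (T : Monad V) (n : ℕ) :
    E n ⟶ E.precomp T.toFunctor n where
  app X := E.tmap fun i => T.η.app (X i)
  naturality X Y f := by
    refine (E.tmap_comp _ _).trans (Eq.trans ?_ (E.tmap_comp _ _).symm)
    exact congrArg E.tmap (funext fun i => T.η.naturality (f i))

/-- A multitensor structure on `EM(T)` which is compatible with the multitensor `E` and the monad
`T`. Since the unit is prescribed, this amounts to substitution maps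
`E_i T E_j T X_ij ⟶ E_ij T X_ij`. -/
structure CompositeMultitensor (E : Multitensor V) (T : Monad V) where
  str : MultitensorStruct (E.tensor.precomp T.toFunctor)
  /-- The unit at `X` is `u_{TX} ∘ η_X`. -/
  unit_eq : ∀ X : Fin 1 → V, str.unit X = T.η.app (X 0) ≫ E.str.unit fun i => T.obj (X i)
  /-- `Eη` is a multitensor map. -/
  isMultitensorMap : IsMultitensorMap E ⟨E.tensor.precomp T.toFunctor, str⟩ (E.tensor.precompUnit T)
  /-- `uT : T ⟶ E₁T` is a monad map. -/
  isMonadMap : ∃ φ : T ⟶ Multitensor.unaryMonad ⟨E.tensor.precomp T.toFunctor, str⟩,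
    ∀ X : V, φ.app X = E.str.unit fun _ : Fin 1 => T.obj X
  /-- The composite `E_i T X_i ⟶ E_i T E₁ T X_i ⟶ E_i T X_i` is the identity. -/
  middle_unit : ∀ {n : ℕ} (X : Fin n → V),
    E.tensor.tmap (fun i : Fin n =>
        E.str.unit (fun j => T.obj (X ((Subdivision.singles n).index i j))) ≫
          T.η.app ((E.tensor 1).obj fun j => T.obj (X ((Subdivision.singles n).index i j)))) ≫
      str.sub (Subdivision.singles n) X =
    𝟙 ((E.tensor n).obj fun i => T.obj (X i))

/-- The multitensor given by a `CompositeMultitensor`. -/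
def CompositeMultitensor.multitensor {E : Multitensor V} {T : Monad V}
    (S : CompositeMultitensor E T) : Multitensor V :=
  ⟨E.tensor.precomp T.toFunctor, S.str⟩

/-- A lifting of a multitensor `E` to the category of algebras of `T`. -/
structure Lifting (E : Multitensor V) (T : Monad V) where
  lift : Multitensor T.Algebra
  tensor_forget : ∀ n : ℕ,
    lift.tensor n ⋙ T.forget = Functor.pi (fun _ : Fin n => T.forget) ⋙ E.tensor n
  unit_forget : ∀ X : Fin 1 → T.Algebra,
    HEq (lift.str.unit X).f (E.str.unit fun i => (X i).A)
  sub_forget : ∀ {N k : ℕ} (d : Subdivision N k) (X : Fin N → T.Algebra),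
    HEq (lift.str.sub d X).f (E.str.sub d fun s => (X s).A)

end

/-- A distributive law of a monad `S` over a monad `T`: a transformation `TS ⟶ ST` compatible with
the units and multiplications. -/
@[ext]
structure DistributiveLaw {C : Type u₁} [Category.{v₁} C] (S T : Monad C) where
  law : S.toFunctor ⋙ T.toFunctor ⟶ T.toFunctor ⋙ S.toFunctor
  map_η_law : ∀ X : C, T.map (S.η.app X) ≫ law.app X = S.η.app (T.obj X)
  η_law : ∀ X : C, T.η.app (S.obj X) ≫ law.app X = S.map (T.η.app X)
  map_μ_law : ∀ X : C, T.map (S.μ.app X) ≫ law.app X =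
    law.app (S.obj X) ≫ S.map (law.app X) ≫ S.μ.app (T.obj X)
  μ_law : ∀ X : C, T.μ.app (S.obj X) ≫ law.app X =
    T.map (law.app X) ≫ law.app (T.obj X) ≫ S.map (T.μ.app X)

/-- The distributive laws of `Γ(E)` over `G(T)` whose components are identities on objects. -/
def GraphDistributiveLaw {V : Type u} [Category.{v} V] [HasCoproducts.{w} V] {E : Multitensor V}
    (hE : Multitensor.IsDistributive.{v, u, w} E) (T : Monad V) :=
  { L : DistributiveLaw (Gamma.monad hE) (EnrichedGraph.mapMonad.{v, u, w} T) //
    ∀ (X : EnrichedGraph.{v, u, w} V) (a : X.carrier),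
      EnrichedGraph.Hom.obj (L.law.app X) a = a }

end MultitensorLaw

open MultitensorLaw

/-! The opmonoidal coherences `τ` are the hub: each other kind of data is put in bijection with
them.

Composite multitensors. Given `τ`, the substitution of `EM(T)` moves `T` past `E`, substitutes, and
multiplies, as one composes two monads along a distributive law. Its associativity,
`compSub_compSub`, holds because both composites can be rewritten so that all copies of `T` move
inwards before anything is substituted. Conversely, `τ` is recovered from `σ'` as `T E X ⟶ T E T X ⟶
E₁ T E T X ⟶ E T X`, using `η`, `u` and `σ'`. That this works rests on two formulas: `tmap_mulAt`
expresses `E μ` as `T u` followed by `σ'`, and `sub_eq` expresses `σ` at `TX` as `η` followed by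
`σ'`. The first is where the middle unit law and the monad map `uT` enter. The rest follows from the
cases of associativity in which one of the three layers is unary.

Liftings. A structure map `x : T X ⟶ X` is an algebra morphism from the free algebra, and `η` splits
it in `V`. So the actions on tensor products of free algebras determine all the others (`act_eq`),
and `τ` is the action on `E_i T X_i` restricted along `E η`.

Enriched categories. An `EM(T)`-category has a `T`-action on each hom, given by compositions along
sequences of length one, and an `E`-composition obtained by restriction along `η`. By `homAct_comp`
the original composition is the action followed by the `E`-composition, and by `map_innerComp` the
latter consists of algebra morphisms. This decomposition is an enrichment in the lifted multitensor.

Distributive laws. From `τ` one obtains `λ` summand by summand, since `T` preserves the coproducts.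
Conversely, a sequence `X` gives a graph on the positions `0, …, n` whose homs between consecutive
positions are the `X_i` and whose other homs are initial. By distributivity, the hom of `Γ(E)` of
this graph from `0` to `n` is `E_i X_i`, and the same is true after applying `T` to the homs. The
component of `λ` there is `τ`. A sequence of maps into consecutive homs of any graph is a morphism
of graphs out of this one, so naturality of `λ` forces it to be `τ` on every summand
(`map_tmap_inj_homMap`). -/

namespace MultitensorLaw

/-! ### Trivial subdivisions -/

namespace Subdivision

variable {N M k : ℕ}

theorem index_singles (N : ℕ) (i : Fin N) (j : Fin 1) : (singles N).index i j = i := by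
  obtain rfl : j = 0 := Subsingleton.elim _ _
  rfl

/-- A subdivision is determined by its block lengths, so this and the next two equations reduce to
arithmetic. They are not definitional, which is why associativity is restated below for subdivisions
known only up to equality. -/
theorem singles_comp (d : Subdivision N k) : d = (singles N).comp d :=
  eq_of_len <| funext fun i => by
    have h := d.cut_succ i
    simp only [comp, singles]
    omega

theorem comp_singles (d : Subdivision N k) : d = d.comp (singles k) :=
  eq_of_len <| funext fun i => by
    have h := d.cut_succ i
    simp only [comp, singles]
    omega

theorem comp_whole (d : Subdivision N k) : whole N = d.comp (whole k) :=
  eq_of_len <| funext fun i => by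
    obtain rfl : i = 0 := Subsingleton.elim _ _
    change N = (d.cut (Fin.last k) : ℕ) - (d.cut 0 : ℕ)
    rw [d.cut_last, d.cut_zero]
    simp

end Subdivision

/-! ### Substitution with transports, and associativity with a unary layer -/

section

variable {V : Type u} [Category.{v} V]

theorem TensorFamily.tmap_eqToHom (E : TensorFamily V) {n : ℕ} {X Y : Fin n → V}
    (h : ∀ i, X i = Y i) :
    E.tmap (fun i => eqToHom (h i)) = eqToHom (congrArg (E n).obj (funext h)) := by
  obtain rfl : X = Y := funext h
  simp [TensorFamily.tmap_id]

namespace MultitensorStruct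

variable {E : TensorFamily V} (S : MultitensorStruct E) {N M k : ℕ}

/-- Substitution along a subdivision, for a doubly nested sequence which is only propositionally
equal to the one given by the subdivision. -/
def subOfEq (d : Subdivision N k) {X : Fin N → V} {Y : ∀ i, Fin (d.len i) → V}
    (h : ∀ i j, Y i j = X (d.index i j)) :
    (E k).obj (fun i => (E (d.len i)).obj (Y i)) ⟶ (E N).obj X :=
  E.tmap (fun i => E.tmap fun j => eqToHom (h i j)) ≫ S.sub d X

theorem subOfEq_rfl (d : Subdivision N k) (X : Fin N → V) :
    S.subOfEq d (X := X) (fun _ _ => rfl) = S.sub d X := by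
  simp only [subOfEq, eqToHom_refl, TensorFamily.tmap_id]
  exact Category.id_comp _

theorem subOfEq_naturality (d : Subdivision N k) {X X' : Fin N → V}
    {Y Y' : ∀ i, Fin (d.len i) → V} (h : ∀ i j, Y i j = X (d.index i j))
    (h' : ∀ i j, Y' i j = X' (d.index i j)) (f : ∀ i j, Y i j ⟶ Y' i j) (g : ∀ s, X s ⟶ X' s)
    (w : ∀ i j, f i j ≫ eqToHom (h' i j) = eqToHom (h i j) ≫ g (d.index i j)) :
    E.tmap (fun i => E.tmap (f i)) ≫ S.subOfEq d h' = S.subOfEq d h ≫ E.tmap g := by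
  rw [subOfEq, subOfEq, Category.assoc, ← S.sub_naturality]
  simp only [← Category.assoc, TensorFamily.tmap_comp, w]

/-- Associativity freed from the way in which `comp`, `restrict` and `index` compute: the composite
subdivision, its restrictions and the nested sequences need only be propositionally equal to the
canonical ones. Once these equalities are substituted, the only transports left are the one in
`assoc` and its inverse, which cancel. -/
theorem subOfEq_assoc (d : Subdivision N M) (c : Subdivision M k) (e : Subdivision N k)
    (r : ∀ i, Subdivision (e.len i) (c.len i)) (he : e = d.comp c)
    (hr : ∀ i j, (r i).len j = d.len (c.index i j)) {X : Fin N → V}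
    {Z : ∀ a, Fin (d.len a) → V} (h : ∀ a l, Z a l = X (d.index a l))
    {Y : ∀ i, Fin (e.len i) → V} (hY : ∀ i l, Y i l = X (e.index i l))
    {W : ∀ i j, Fin ((r i).len j) → V} (hW : ∀ i j l, W i j l = Y i ((r i).index j l))
    (hZ : ∀ i j, (E ((r i).len j)).obj (W i j) =
      (E (d.len (c.index i j))).obj (Z (c.index i j))) :
    S.subOfEq c (X := fun a => (E (d.len a)).obj (Z a)) hZ ≫ S.subOfEq d h =
      E.tmap (fun i => S.subOfEq (r i) (hW i)) ≫ S.subOfEq e hY := by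
  subst he
  -- Block lengths determine a subdivision, so `hr` alone identifies `r i`.
  obtain rfl : r = d.restrict c := funext fun i => Subdivision.eq_of_len (funext fun j => hr i j)
  obtain rfl : Z = fun a l => X (d.index a l) := funext fun a => funext fun l => h a l
  obtain rfl : Y = fun i l => X ((d.comp c).index i l) := funext fun i => funext fun l => hY i l
  obtain rfl : W = fun i j l => X ((d.comp c).index i ((d.restrict c i).index j l)) :=
    funext fun i => funext fun j => funext fun l => hW i j l
  rw [subOfEq_rfl, subOfEq_rfl, subOfEq, Category.assoc, S.assoc d c X, ← Category.assoc,
    TensorFamily.tmap_comp]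
  refine congrArg (fun q => E.tmap q ≫ S.sub (d.comp c) X) (funext fun i => ?_)
  rw [subOfEq_rfl]
  refine (Category.assoc _ _ _).symm.trans ?_
  refine (congrArg (· ≫ S.sub (d.restrict c i) fun l => X ((d.comp c).index i l)) ?_).trans
    (Category.id_comp _)
  simp only [TensorFamily.tmap_eqToHom]
  exact eqToHom_trans _ _

/-- The substitution `E₁ E_i X_i ⟶ E_i X_i`. -/
def sub₁ (X : Fin N → V) : (E 1).obj (fun _ => (E N).obj X) ⟶ (E N).obj X :=
  S.subOfEq (Subdivision.whole N) fun i j => congrArg X (Subdivision.index_whole N i j).symm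

/-- The substitution `E_i E₁ X_i ⟶ E_i X_i`. -/
def subₛ (X : Fin N → V) : (E N).obj (fun i => (E 1).obj fun _ => X i) ⟶ (E N).obj X :=
  S.subOfEq (Subdivision.singles N) fun i j => congrArg X (Subdivision.index_singles N i j).symm

theorem sub₁_naturality {X Y : Fin N → V} (f : ∀ i, X i ⟶ Y i) :
    E.tmap (fun _ => E.tmap f) ≫ S.sub₁ Y = S.sub₁ X ≫ E.tmap f :=
  S.subOfEq_naturality (Subdivision.whole N) _ _ (fun _ => f) f fun i j =>
    eqToHom_naturality f (Subdivision.index_whole N i j).symm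

theorem unit_sub₁ (X : Fin N → V) : S.unit (fun _ => (E N).obj X) ≫ S.sub₁ X = 𝟙 _ := by
  refine (Category.assoc _ _ _).symm.trans ?_
  refine (congrArg (· ≫ S.sub (Subdivision.whole N) X) (S.unit_naturality fun i => E.tmap fun j =>
    eqToHom (congrArg X (Subdivision.index_whole N i j).symm)).symm).trans ?_
  refine (Category.assoc _ _ _).trans ?_
  refine (congrArg (E.tmap _ ≫ ·) (S.unit_sub X)).trans ?_
  refine (E.tmap_comp _ _).trans ?_
  simp [TensorFamily.tmap_id]

theorem unit_subₛ (X : Fin N → V) :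
    E.tmap (fun i => S.unit fun _ => X i) ≫ S.subₛ X = 𝟙 _ := by
  refine (Category.assoc _ _ _).symm.trans ?_
  refine Eq.trans (congrArg (· ≫ S.sub (Subdivision.singles N) X) ?_) (S.sub_unit X)
  refine (E.tmap_comp _ _).trans (congrArg E.tmap (funext fun i => ?_))
  exact (S.unit_naturality _).symm.trans (Category.id_comp _)

/-- Associativity for the three layers `E_i E_j E₁`. The lemmas after it treat `E_i E₁ E_j`, `E₁ E_i
E_j`, `E₁ E_i E₁`, `E₁ E₁ E_i` and `E_i E₁ E₁`. These six cases are all the associativity that the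
recovery of `τ` from `σ'` uses. -/
theorem sub_subₛ (d : Subdivision N k) (X : Fin N → V) :
    S.sub d (fun s => (E 1).obj fun _ => X s) ≫ S.subₛ X =
      E.tmap (fun i => S.subₛ fun j => X (d.index i j)) ≫ S.sub d X := by
  rw [← subOfEq_rfl, ← subOfEq_rfl]
  exact S.subOfEq_assoc (Subdivision.singles N) d d (fun i => Subdivision.singles _)
    d.singles_comp (fun _ _ => rfl) (X := X)
    (Z := fun s _ => X s) (fun a l => congrArg X (Subdivision.index_singles N a l).symm)
    (Y := fun i j => X (d.index i j)) (fun _ _ => rfl) (W := fun i j _ => X (d.index i j))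
    (fun i j l => congrArg (fun s => X (d.index i s)) (Subdivision.index_singles _ j l).symm)
    fun _ _ => rfl

theorem subₛ_sub (d : Subdivision N k) (X : Fin N → V) :
    S.subₛ (fun i => (E (d.len i)).obj fun j => X (d.index i j)) ≫ S.sub d X =
      E.tmap (fun i => S.sub₁ fun j => X (d.index i j)) ≫ S.sub d X := by
  rw [← subOfEq_rfl]
  exact S.subOfEq_assoc d (Subdivision.singles k) d (fun i => Subdivision.whole _)
    d.comp_singles (fun i j => congrArg d.len (Subdivision.index_singles k i j).symm)
    (X := X) (Z := fun i j => X (d.index i j)) (fun _ _ => rfl)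
    (Y := fun i j => X (d.index i j)) (fun _ _ => rfl) (W := fun i _ l => X (d.index i l))
    (fun i j l => congrArg (fun s => X (d.index i s)) (Subdivision.index_whole _ j l).symm)
    fun i j => congrArg (fun s => (E (d.len s)).obj fun l => X (d.index s l))
      (Subdivision.index_singles k i j).symm

theorem sub₁_sub (d : Subdivision N k) (X : Fin N → V) :
    S.sub₁ (fun i => (E (d.len i)).obj fun j => X (d.index i j)) ≫ S.sub d X =
      E.tmap (fun _ => S.sub d X) ≫ S.sub₁ X := by
  simp only [← subOfEq_rfl]
  exact S.subOfEq_assoc d (Subdivision.whole k) (Subdivision.whole N) (fun i => d)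
    d.comp_whole (fun i j => congrArg d.len (Subdivision.index_whole k i j).symm)
    (X := X) (Z := fun i j => X (d.index i j)) (fun _ _ => rfl)
    (Y := fun _ => X) (fun i j => congrArg X (Subdivision.index_whole N i j).symm)
    (W := fun _ i l => X (d.index i l)) (fun _ _ _ => rfl)
    fun i j => congrArg (fun s => (E (d.len s)).obj fun l => X (d.index s l))
      (Subdivision.index_whole k i j).symm

theorem sub₁_subₛ (X : Fin N → V) :
    S.sub₁ (fun i => (E 1).obj fun _ => X i) ≫ S.subₛ X =
      E.tmap (fun _ => S.subₛ X) ≫ S.sub₁ X :=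
  S.subOfEq_assoc (Subdivision.singles N) (Subdivision.whole N) (Subdivision.whole N)
    (fun _ => Subdivision.singles N) (Subdivision.comp_whole _) (fun _ _ => rfl)
    (X := X) (Z := fun i _ => X i) (fun i l => congrArg X (Subdivision.index_singles N i l).symm)
    (Y := fun _ => X) (fun i j => congrArg X (Subdivision.index_whole N i j).symm)
    (W := fun _ i _ => X i) (fun _ i l => congrArg X (Subdivision.index_singles N i l).symm)
    fun i j => congrArg (fun s => (E 1).obj fun _ => X s) (Subdivision.index_whole N i j).symm

theorem sub₁_sub₁ (X : Fin N → V) :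
    S.sub₁ (fun _ : Fin 1 => (E N).obj X) ≫ S.sub₁ X = E.tmap (fun _ => S.sub₁ X) ≫ S.sub₁ X :=
  S.subOfEq_assoc (Subdivision.whole N) (Subdivision.whole 1) (Subdivision.whole N)
    (fun _ => Subdivision.whole N) (Subdivision.comp_whole _) (fun _ _ => rfl)
    (X := X) (Z := fun _ => X) (fun i j => congrArg X (Subdivision.index_whole N i j).symm)
    (Y := fun _ => X) (fun i j => congrArg X (Subdivision.index_whole N i j).symm)
    (W := fun _ _ => X) (fun _ i j => congrArg X (Subdivision.index_whole N i j).symm)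
    fun _ _ => rfl

theorem subₛ_subₛ (X : Fin N → V) :
    S.subₛ (fun i => (E 1).obj fun _ => X i) ≫ S.subₛ X =
      E.tmap (fun i => S.sub₁ fun _ : Fin 1 => X i) ≫ S.subₛ X :=
  S.subOfEq_assoc (Subdivision.singles N) (Subdivision.singles N) (Subdivision.singles N)
    (fun _ => Subdivision.whole 1) (Subdivision.comp_singles _) (fun _ _ => rfl)
    (X := X) (Z := fun i _ => X i) (fun i l => congrArg X (Subdivision.index_singles N i l).symm)
    (Y := fun i _ => X i) (fun i l => congrArg X (Subdivision.index_singles N i l).symm)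
    (W := fun i _ _ => X i) (fun _ _ _ => rfl)
    fun i j => congrArg (fun s => (E 1).obj fun _ => X s) (Subdivision.index_singles N i j).symm

end MultitensorStruct

end

end MultitensorLaw

/-! ### Units and multiplications of monads, with plainly stated domains and codomains -/

namespace CategoryTheory.Monad

variable {C : Type u} [Category.{v} C] (T : Monad C)

/-- The unit of a monad at an object. -/
def unitAt (X : C) : X ⟶ T.obj X := T.η.app X

/-- The multiplication of a monad at an object. -/
def mulAt (X : C) : T.obj (T.obj X) ⟶ T.obj X := T.μ.app X

theorem unitAt_naturality {X Y : C} (f : X ⟶ Y) : f ≫ T.unitAt Y = T.unitAt X ≫ T.map f :=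
  T.η.naturality f

theorem mulAt_naturality {X Y : C} (f : X ⟶ Y) :
    T.map (T.map f) ≫ T.mulAt Y = T.mulAt X ≫ T.map f :=
  T.μ.naturality f

theorem unitAt_mulAt (X : C) : T.unitAt (T.obj X) ≫ T.mulAt X = 𝟙 (T.obj X) := T.left_unit X

theorem map_unitAt_mulAt (X : C) : T.map (T.unitAt X) ≫ T.mulAt X = 𝟙 (T.obj X) :=
  T.right_unit X

theorem mulAt_mulAt (X : C) :
    T.map (T.mulAt X) ≫ T.mulAt X = T.mulAt (T.obj X) ≫ T.mulAt X :=
  T.assoc X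

end CategoryTheory.Monad

/-! ### From coherence maps to composite multitensors -/

namespace MultitensorLaw

section

variable {V : Type u} [Category.{v} V]

theorem TensorFamily.tmap_comp_assoc (E : TensorFamily V) {n : ℕ} {X Y Z : Fin n → V}
    (f : ∀ i, X i ⟶ Y i) (g : ∀ i, Y i ⟶ Z i) {Q : V} (h : (E n).obj Z ⟶ Q) :
    E.tmap f ≫ E.tmap g ≫ h = E.tmap (fun i => f i ≫ g i) ≫ h := by
  rw [← Category.assoc, E.tmap_comp]

theorem TensorFamily.tmap_congr (E : TensorFamily V) {n : ℕ} {X Y : Fin n → V}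
    {f g : ∀ i, X i ⟶ Y i} (h : ∀ i, f i = g i) : E.tmap f = E.tmap g :=
  congrArg E.tmap (funext h)

theorem MultitensorStruct.sub_naturality_assoc {E : TensorFamily V} (S : MultitensorStruct E)
    {N k : ℕ} (d : Subdivision N k) {X Y : Fin N → V} (f : ∀ i, X i ⟶ Y i) {Q : V}
    (h : (E N).obj Y ⟶ Q) :
    E.tmap (fun i => E.tmap fun j => f (d.index i j)) ≫ S.sub d Y ≫ h =
      S.sub d X ≫ E.tmap f ≫ h := by
  rw [← Category.assoc, S.sub_naturality, Category.assoc]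

theorem comp_congr_middle {A B C D : V} (a : A ⟶ B) {f g : B ⟶ C} (h : f = g) (b : C ⟶ D) :
    a ≫ f ≫ b = a ≫ g ≫ b := by
  rw [h]

namespace OpmonoidalCoherence

variable {E : Multitensor V} {T : Monad V} (c : OpmonoidalCoherence E T)

theorem unitAt_τ {n : ℕ} (X : Fin n → V) :
    T.unitAt ((E.tensor n).obj X) ≫ c.τ X = E.tensor.tmap fun i => T.unitAt (X i) :=
  c.η_τ X

theorem mulAt_τ {n : ℕ} (X : Fin n → V) :
    T.mulAt ((E.tensor n).obj X) ≫ c.τ X =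
      T.map (c.τ X) ≫ c.τ (fun i => T.obj (X i)) ≫ E.tensor.tmap fun i => T.mulAt (X i) :=
  c.μ_τ X

/-- The substitution `E_i T E_j T X_ij ⟶ E_ij T X_ij` of the composite multitensor. -/
def compSub {N k : ℕ} (d : Subdivision N k) (X : Fin N → V) :
    (E.tensor k).obj (fun i => T.obj ((E.tensor (d.len i)).obj fun j => T.obj (X (d.index i j)))) ⟶
      (E.tensor N).obj fun s => T.obj (X s) :=
  E.tensor.tmap (fun i => c.τ fun j => T.obj (X (d.index i j))) ≫
    E.str.sub d (fun s => T.obj (T.obj (X s))) ≫ E.tensor.tmap fun s => T.mulAt (X s)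

theorem compSub_naturality {N k : ℕ} (d : Subdivision N k) {X Y : Fin N → V}
    (f : ∀ i, X i ⟶ Y i) :
    E.tensor.tmap (fun i => T.map (E.tensor.tmap fun j => T.map (f (d.index i j)))) ≫
      c.compSub d Y = c.compSub d X ≫ E.tensor.tmap fun s => T.map (f s) := by
  simp only [compSub, Category.assoc, TensorFamily.tmap_comp, TensorFamily.tmap_comp_assoc,
    c.naturality]
  rw [← E.tensor.tmap_comp_assoc]
  refine congrArg (E.tensor.tmap _ ≫ ·) ?_
  rw [← Category.assoc, E.str.sub_naturality d fun s => T.map (T.map (f s)), Category.assoc,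
    E.tensor.tmap_comp]
  exact congrArg (E.str.sub d _ ≫ ·) (E.tensor.tmap_congr fun s => T.mulAt_naturality (f s))

/-- Naturality of `u` lets `τ` come before it, where `η_τ` turns `η` and `τ` into `E η`. The unit
law of `E` removes `u` and `σ`, and `η` at `TX` cancels against the final `μ`. -/
theorem unit_compSub {N : ℕ} (X : Fin N → V) :
    (T.unitAt ((E.tensor N).obj fun j => T.obj (X ((Subdivision.whole N).index 0 j))) ≫
      E.str.unit fun i : Fin 1 => T.obj ((E.tensor N).obj fun j =>
        T.obj (X ((Subdivision.whole N).index i j)))) ≫ c.compSub (Subdivision.whole N) X =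
    E.tensor.tmap fun j => T.map (eqToHom (congrArg X (Subdivision.index_whole N 0 j))) := by
  refine (Category.assoc _ _ _).trans ?_
  refine (congrArg (T.unitAt _ ≫ ·) (Category.assoc _ _ _).symm).trans ?_
  refine (comp_congr_middle _ (E.str.unit_naturality fun i : Fin 1 =>
    c.τ fun j => T.obj (X ((Subdivision.whole N).index i j))).symm _).trans ?_
  refine (congrArg (T.unitAt _ ≫ ·) (Category.assoc _ _ _)).trans ?_
  refine (Category.assoc _ _ _).symm.trans ?_
  refine (congrArg (· ≫ _) (c.unitAt_τ _)).trans ?_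
  refine (congrArg (E.tensor.tmap _ ≫ ·) (Category.assoc _ _ _).symm).trans ?_
  refine (comp_congr_middle _ (E.str.unit_sub fun s => T.obj (T.obj (X s))) _).trans ?_
  refine (E.tensor.tmap_comp_assoc _ _ _).trans ((E.tensor.tmap_comp _ _).trans ?_)
  refine E.tensor.tmap_congr fun j => ?_
  -- The two positions are replaced by variables so that their equality can be substituted, leaving
  -- a unit law of `T`.
  have key : ∀ {a b : Fin N} (h : a = b), (T.unitAt (T.obj (X a)) ≫
      eqToHom (congrArg (fun s => T.obj (T.obj (X s))) h)) ≫ T.mulAt (X b) =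
      T.map (eqToHom (congrArg X h)) := by
    rintro a b rfl
    simp [T.unitAt_mulAt]
  exact key (Subdivision.index_whole N 0 j)

/-- Here `unit_τ` absorbs `τ` into `T u`, so that only `T η` and `u` precede `σ`. The second unit
law of `E` and that of `T` finish the argument. -/
theorem compSub_unit {N : ℕ} (X : Fin N → V) :
    E.tensor.tmap (fun i => T.map (T.unitAt (X ((Subdivision.singles N).index i (0 : Fin 1))) ≫
      E.str.unit fun j => T.obj (X ((Subdivision.singles N).index i j)))) ≫
        c.compSub (Subdivision.singles N) X = 𝟙 _ := by
  refine (E.tensor.tmap_comp_assoc _ _ _).trans ?_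
  have h : ∀ i : Fin N, T.map (T.unitAt (X ((Subdivision.singles N).index i (0 : Fin 1))) ≫
      E.str.unit fun j : Fin 1 => T.obj (X ((Subdivision.singles N).index i j))) ≫
        c.τ (fun j : Fin 1 => T.obj (X ((Subdivision.singles N).index i j))) =
      T.map (T.unitAt (X i)) ≫
        E.str.unit fun j : Fin 1 => T.obj (T.obj (X ((Subdivision.singles N).index i j))) := by
    intro i
    rw [T.map_comp, Category.assoc, c.unit_τ]
    rfl
  refine (congrArg (· ≫ _) (E.tensor.tmap_congr h)).trans ?_
  refine (congrArg (· ≫ _) (E.tensor.tmap_comp _ _).symm).trans ((Category.assoc _ _ _).trans ?_)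
  refine (congrArg (E.tensor.tmap _ ≫ ·) (Category.assoc _ _ _).symm).trans ?_
  refine (comp_congr_middle _ (E.str.sub_unit fun s => T.obj (T.obj (X s))) _).trans ?_
  refine (congrArg (E.tensor.tmap _ ≫ ·) (Category.id_comp _)).trans ?_
  refine (E.tensor.tmap_comp _ _).trans (Eq.trans ?_ (E.tensor.tmap_id _))
  exact E.tensor.tmap_congr fun i => T.map_unitAt_mulAt (X i)

/-- One half of associativity. By `sub_τ`, an outer `T` passes through a composite substitution,
with all coherence maps collected at the front and `T μ` at the end. The maps `f` make room for the
reindexing of triply nested sequences. -/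
theorem map_compSub_τ {P m : ℕ} (r : Subdivision P m) {Z : ∀ j, Fin (r.len j) → V}
    {Y : Fin P → V} (f : ∀ j l, Z j l ⟶ Y (r.index j l)) :
    T.map (E.tensor.tmap (fun j => T.map (E.tensor.tmap fun l => T.map (f j l))) ≫
        c.compSub r Y) ≫ c.τ (fun l => T.obj (Y l)) =
      (c.τ (fun j => T.obj ((E.tensor (r.len j)).obj fun l => T.obj (Z j l))) ≫
        E.tensor.tmap fun j => T.map (c.τ fun l => T.obj (Z j l)) ≫
          c.τ fun l => T.obj (T.obj (Z j l))) ≫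
      E.tensor.tmap (fun j => E.tensor.tmap fun l => T.map (T.map (T.map (f j l)))) ≫
        E.str.sub r (fun l => T.obj (T.obj (T.obj (Y l)))) ≫
          E.tensor.tmap fun l => T.map (T.mulAt (Y l)) := by
  simp only [compSub, T.map_comp, Category.assoc]
  rw [c.naturality fun l => T.mulAt (Y l), ← Category.assoc (T.map (E.str.sub r _)), c.sub_τ]
  simp only [Category.assoc]
  rw [← Category.assoc (T.map _) (c.τ _), c.naturality]
  simp only [Category.assoc]
  rw [← Category.assoc (T.map _) (c.τ _), c.naturality]
  simp only [Category.assoc, TensorFamily.tmap_comp_assoc]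
  refine congrArg (c.τ _ ≫ ·) (congrArg (· ≫ _) (E.tensor.tmap_congr fun j => ?_))
  rw [← c.naturality, ← Category.assoc, ← T.map_comp, c.naturality, T.map_comp, Category.assoc]

/-- Naturality of `σ` carries both `T μ` and `μ T` to the other side of the substitution, where they
meet the last `μ` and agree by associativity of `T`. -/
theorem map_mulAt_sub_mulAt {N k : ℕ} (e : Subdivision N k) (X : Fin N → V) {A : Fin k → V}
    (Q : ∀ i, A i ⟶ (E.tensor (e.len i)).obj fun l => T.obj (T.obj (T.obj (X (e.index i l))))) :
    E.tensor.tmap (fun i => Q i ≫ E.tensor.tmap fun l => T.map (T.mulAt (X (e.index i l)))) ≫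
        E.str.sub e (fun s => T.obj (T.obj (X s))) ≫ E.tensor.tmap (fun s => T.mulAt (X s)) =
      E.tensor.tmap (fun i => Q i ≫ E.tensor.tmap fun l => T.mulAt (T.obj (X (e.index i l)))) ≫
        E.str.sub e (fun s => T.obj (T.obj (X s))) ≫ E.tensor.tmap fun s => T.mulAt (X s) := by
  rw [← E.tensor.tmap_comp_assoc, ← E.tensor.tmap_comp_assoc, E.str.sub_naturality_assoc e fun s =>
    T.map (T.mulAt (X s)), E.str.sub_naturality_assoc e fun s => T.mulAt (T.obj (X s))]
  simp only [TensorFamily.tmap_comp, T.mulAt_mulAt]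

/-- Exchanges the `T μ` produced by `map_compSub_τ` for `μ T`, and slides the latter past the inner
substitution and the reindexing. This is where `μ_τ` puts it on the other side of associativity. -/
theorem sub_sub_μ {N k : ℕ} (e : Subdivision N k) {m : Fin k → ℕ}
    (r : ∀ i, Subdivision (e.len i) (m i)) (X : Fin N → V) {Z : ∀ i j, Fin ((r i).len j) → V}
    (f : ∀ i j l, Z i j l ⟶ X (e.index i ((r i).index j l))) {A : Fin k → V}
    (P : ∀ i, A i ⟶ (E.tensor (m i)).obj fun j => (E.tensor ((r i).len j)).obj fun l =>
      T.obj (T.obj (T.obj (Z i j l)))) :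
    E.tensor.tmap (fun i => P i ≫
        E.tensor.tmap (fun j => E.tensor.tmap fun l => T.map (T.map (T.map (f i j l)))) ≫
          E.str.sub (r i) (fun l => T.obj (T.obj (T.obj (X (e.index i l))))) ≫
            E.tensor.tmap fun l => T.map (T.mulAt (X (e.index i l)))) ≫
        E.str.sub e (fun s => T.obj (T.obj (X s))) ≫ E.tensor.tmap (fun s => T.mulAt (X s)) =
      E.tensor.tmap (fun i => P i ≫
        E.tensor.tmap (fun j => E.tensor.tmap fun l => T.mulAt (T.obj (Z i j l))) ≫
          E.tensor.tmap (fun j => E.tensor.tmap fun l => T.map (T.map (f i j l))) ≫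
            E.str.sub (r i) fun l => T.obj (T.obj (X (e.index i l)))) ≫
        E.str.sub e (fun s => T.obj (T.obj (X s))) ≫ E.tensor.tmap fun s => T.mulAt (X s) := by
  have h : ∀ i, P i ≫
        E.tensor.tmap (fun j => E.tensor.tmap fun l => T.mulAt (T.obj (Z i j l))) ≫
          E.tensor.tmap (fun j => E.tensor.tmap fun l => T.map (T.map (f i j l))) ≫
            E.str.sub (r i) (fun l => T.obj (T.obj (X (e.index i l)))) =
      (P i ≫ E.tensor.tmap (fun j => E.tensor.tmap fun l => T.map (T.map (T.map (f i j l)))) ≫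
          E.str.sub (r i) (fun l => T.obj (T.obj (T.obj (X (e.index i l)))))) ≫
            E.tensor.tmap fun l => T.mulAt (T.obj (X (e.index i l))) := by
    intro i
    simp only [Category.assoc]
    rw [← E.str.sub_naturality (r i) fun l => T.mulAt (T.obj (X (e.index i l)))]
    simp only [TensorFamily.tmap_comp_assoc, TensorFamily.tmap_comp]
    refine congrArg (P i ≫ ·) (congrArg (· ≫ E.str.sub (r i) fun l =>
      T.obj (T.obj (X (e.index i l))))
      (E.tensor.tmap_congr fun j => E.tensor.tmap_congr fun l => ?_))
    exact (T.mulAt_naturality (T.map (f i j l))).symm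
  simp only [h]
  rw [← map_mulAt_sub_mulAt e X]
  simp only [Category.assoc]

theorem tmap_comp_tmap_sub {P m : ℕ} (r : Subdivision P m) (Y : Fin P → V)
    {Z Z' : ∀ j, Fin (r.len j) → V} {A : V} {B C : Fin m → V} (p : A ⟶ (E.tensor m).obj B)
    (q : ∀ j, B j ⟶ C j) (q' : ∀ j, C j ⟶ (E.tensor (r.len j)).obj (Z j))
    (f : ∀ j l, Z j l ⟶ Z' j l) {g g' : ∀ j l, Z' j l ⟶ Y (r.index j l)}
    (hg : ∀ j l, g j l = g' j l) :
    (p ≫ E.tensor.tmap fun j => q j ≫ q' j ≫ E.tensor.tmap (f j)) ≫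
        E.tensor.tmap (fun j => E.tensor.tmap (g j)) ≫ E.str.sub r Y =
      (p ≫ E.tensor.tmap fun j => q j ≫ q' j) ≫ E.tensor.tmap (fun j => E.tensor.tmap (f j)) ≫
        E.tensor.tmap (fun j => E.tensor.tmap (g' j)) ≫ E.str.sub r Y := by
  obtain rfl : g = g' := funext fun j => funext fun l => hg j l
  simp only [Category.assoc, TensorFamily.tmap_comp_assoc]

/-- Both sides become the composite which moves the copies of `T` inwards by `τ`, `T τ` and `τ`,
multiplies, substitutes twice in `E`, and multiplies again. On the left this takes `μ_τ` and
naturality of `σ`. On the right it takes `sub_τ` and associativity of `μ`. What remains is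
associativity of `E` at the sequence `T T X`. -/
theorem compSub_compSub {N M k : ℕ} (d : Subdivision N M) (e : Subdivision M k) (X : Fin N → V) :
    c.compSub e (fun a => (E.tensor (d.len a)).obj fun l => T.obj (X (d.index a l))) ≫
        c.compSub d X =
      E.tensor.tmap (fun i =>
          T.map (E.tensor.tmap (fun j => T.map (E.tensor.tmap fun l => T.map
            (eqToHom (congrArg X (Subdivision.index_comp d e i j l).symm)))) ≫
          c.compSub (d.restrict e i) fun l => X ((d.comp e).index i l))) ≫
        c.compSub (d.comp e) X := by
  have hL : c.compSub e (fun a => (E.tensor (d.len a)).obj fun l => T.obj (X (d.index a l))) ≫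
        c.compSub d X = E.tensor.tmap (fun i => c.τ (fun j =>
          T.obj ((E.tensor (d.len (e.index i j))).obj fun l => T.obj (X (d.index (e.index i j) l)))) ≫
        E.tensor.tmap fun j => T.map (c.τ fun l => T.obj (X (d.index (e.index i j) l))) ≫
          c.τ (fun l => T.obj (T.obj (X (d.index (e.index i j) l)))) ≫
          E.tensor.tmap fun l => T.mulAt (T.obj (X (d.index (e.index i j) l)))) ≫
      E.str.sub e (fun a => (E.tensor (d.len a)).obj fun l => T.obj (T.obj (X (d.index a l)))) ≫
        E.str.sub d (fun s => T.obj (T.obj (X s))) ≫ E.tensor.tmap fun s => T.mulAt (X s) := by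
    rw [← E.tensor.tmap_comp_assoc]
    simp only [compSub, Category.assoc]
    refine congrArg (E.tensor.tmap _ ≫ ·) ?_
    rw [E.tensor.tmap_comp_assoc]
    simp only [c.mulAt_τ, ← Category.assoc]
    rw [← E.str.sub_naturality e fun a => (T.map (c.τ fun l => T.obj (X (d.index a l))) ≫
          c.τ (fun l => T.obj (T.obj (X (d.index a l))))) ≫
          E.tensor.tmap fun l => T.mulAt (T.obj (X (d.index a l)))]
  rw [hL]
  refine Eq.trans ?_ (Category.assoc _ _ _)
  refine Eq.trans ?_ (congrArg (· ≫ E.str.sub (d.comp e) (fun s => T.obj (T.obj (X s))) ≫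
    E.tensor.tmap fun s => T.mulAt (X s)) ((E.tensor.tmap_comp _ _).trans
      (E.tensor.tmap_congr fun i => c.map_compSub_τ (d.restrict e i) _)).symm)
  refine Eq.trans ?_ (sub_sub_μ (d.comp e) (fun i => d.restrict e i) X _ _).symm
  have hc := E.str.assoc d e fun s => T.obj (T.obj (X s))
  refine (congrArg (E.tensor.tmap _ ≫ ·) (Category.assoc _ _ _).symm).trans ?_
  refine (comp_congr_middle _ hc _).trans ?_
  refine (congrArg (E.tensor.tmap _ ≫ ·) (Category.assoc _ _ _)).trans ?_
  refine (E.tensor.tmap_comp_assoc _ _ _).trans ?_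
  refine congrArg (· ≫ E.str.sub (d.comp e) (fun s => T.obj (T.obj (X s))) ≫
    E.tensor.tmap fun s => T.mulAt (X s)) (E.tensor.tmap_congr fun i => ?_)
  have key : ∀ {a b : Fin N} (h : a = b), eqToHom (congrArg (fun s => T.obj (T.obj (X s))) h) =
      T.map (T.map (eqToHom (congrArg X h))) := by
    rintro a b rfl
    simp
  exact tmap_comp_tmap_sub (E := E) (d.restrict e i)
    (fun l => T.obj (T.obj (X ((d.comp e).index i l))))
    (c.τ (fun j =>
      T.obj ((E.tensor (d.len (e.index i j))).obj fun l => T.obj (X (d.index (e.index i j) l)))))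
    (fun j => T.map (c.τ fun l => T.obj (X (d.index (e.index i j) l))))
    (fun j => c.τ fun l => T.obj (T.obj (X (d.index (e.index i j) l))))
    (fun j l => T.mulAt (T.obj (X (d.index (e.index i j) l))))
    (fun j l => key (Subdivision.index_comp d e i j l).symm)

end OpmonoidalCoherence

end

end MultitensorLaw

namespace MultitensorLaw

section

variable {V : Type u} [Category.{v} V]

theorem unitAt_unit_naturality {E : Multitensor V} {T : Monad V} {X Y : Fin 1 → V}
    (f : ∀ i, X i ⟶ Y i) :
    f 0 ≫ T.unitAt (Y 0) ≫ E.str.unit (fun i => T.obj (Y i)) =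
      (T.unitAt (X 0) ≫ E.str.unit fun i => T.obj (X i)) ≫ E.tensor.tmap fun i => T.map (f i) := by
  rw [← Category.assoc, T.unitAt_naturality, Category.assoc,
    E.str.unit_naturality fun i => T.map (f i), Category.assoc]

namespace MultitensorStruct

variable {E : TensorFamily V} {T : Monad V} (S : MultitensorStruct (E.precomp T.toFunctor))

/-- The substitution `E_i T E_j T X_ij ⟶ E_ij T X_ij` of a multitensor structure on `EM(T)`. -/
def σ {N k : ℕ} (d : Subdivision N k) (X : Fin N → V) :
    (E k).obj (fun i => T.obj ((E (d.len i)).obj fun j => T.obj (X (d.index i j)))) ⟶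
      (E N).obj fun s => T.obj (X s) :=
  S.sub d X

/-- The substitution `E₁ T E_i T X_i ⟶ E_i T X_i` of a multitensor structure on `EM(T)`. -/
def σ₁ {N : ℕ} (X : Fin N → V) :
    (E 1).obj (fun _ => T.obj ((E N).obj fun j => T.obj (X j))) ⟶ (E N).obj fun s => T.obj (X s) :=
  S.sub₁ X

/-- The substitution `E_i T E₁ T X_i ⟶ E_i T X_i` of a multitensor structure on `EM(T)`. -/
def σₛ {N : ℕ} (X : Fin N → V) :
    (E N).obj (fun i => T.obj ((E 1).obj fun _ => T.obj (X i))) ⟶ (E N).obj fun s => T.obj (X s) :=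
  S.subₛ X

end MultitensorStruct

/-- The law `middle_unit`, in terms of `subₛ`. -/
theorem middle_unit_iff {E : Multitensor V} {T : Monad V}
    (S : MultitensorStruct (E.tensor.precomp T.toFunctor)) {n : ℕ} (X : Fin n → V) :
    E.tensor.tmap (fun i : Fin n =>
        E.str.unit (fun j => T.obj (X ((Subdivision.singles n).index i j))) ≫
          T.η.app ((E.tensor 1).obj fun j => T.obj (X ((Subdivision.singles n).index i j)))) ≫
      S.sub (Subdivision.singles n) X =
    E.tensor.tmap (fun i : Fin n => E.str.unit (fun _ => T.obj (X i)) ≫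
        T.unitAt ((E.tensor 1).obj fun _ => T.obj (X i))) ≫ S.σₛ X := by
  refine Eq.trans ?_ (Category.assoc _ _ _)
  refine congrArg (· ≫ S.sub (Subdivision.singles n) X) ?_
  refine Eq.trans ?_ (E.tensor.tmap_comp _ _).symm
  refine E.tensor.tmap_congr fun i => ?_
  -- This transport between the two ways of addressing `X i` slides past `u` and `η` by naturality.
  -- At the only position `0` it is the identity by computation, which is what `h3` uses.
  let e (j : Fin 1) : X i ⟶ X ((Subdivision.singles n).index i j) :=
    eqToHom (congrArg X (Subdivision.index_singles n i j).symm)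
  have h1 := E.str.unit_naturality fun j => T.map (e j)
  have h2 := T.unitAt_naturality (E.tensor.tmap fun j => T.map (e j))
  have h3 : T.map (e 0) = 𝟙 _ := T.map_id _
  rw [h3] at h1
  refine Eq.trans ?_ (Category.assoc _ _ _).symm
  refine Eq.trans ?_ (congrArg (E.str.unit _ ≫ ·) h2)
  refine Eq.trans ?_ (Category.assoc _ _ _)
  exact congrArg (· ≫ T.unitAt _) ((Category.id_comp _).symm.trans h1)

namespace OpmonoidalCoherence

variable {E : Multitensor V} {T : Monad V} (c : OpmonoidalCoherence E T)

/-- The multitensor structure on `EM(T)` determined by an opmonoidal monad. -/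
def compStr : MultitensorStruct (E.tensor.precomp T.toFunctor) where
  unit X := T.unitAt (X 0) ≫ E.str.unit fun i => T.obj (X i)
  sub d X := c.compSub d X
  unit_naturality f := unitAt_unit_naturality f
  sub_naturality {_ _} d {_ _} f := c.compSub_naturality d f
  unit_sub X := c.unit_compSub X
  sub_unit X := c.compSub_unit X
  assoc {_ _ _} d e X := c.compSub_compSub d e X

theorem compStr_subOfEq {N k : ℕ} (d : Subdivision N k) {X : Fin N → V}
    {Y : ∀ i, Fin (d.len i) → V} (h : ∀ i j, Y i j = X (d.index i j)) :
    c.compStr.subOfEq d h = E.tensor.tmap (fun i => c.τ fun j => T.obj (Y i j)) ≫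
      E.str.subOfEq d (X := fun s => T.obj (T.obj (X s)))
        (fun i j => congrArg (fun Z => T.obj (T.obj Z)) (h i j)) ≫
        E.tensor.tmap fun s => T.mulAt (X s) := by
  obtain rfl : Y = fun i j => X (d.index i j) := funext fun i => funext fun j => h i j
  rw [MultitensorStruct.subOfEq_rfl, MultitensorStruct.subOfEq_rfl]
  rfl

theorem compStr_σ₁ {n : ℕ} (X : Fin n → V) :
    c.compStr.σ₁ X = E.tensor.tmap (fun _ : Fin 1 => c.τ fun j => T.obj (X j)) ≫
      E.str.sub₁ (fun s => T.obj (T.obj (X s))) ≫ E.tensor.tmap fun s => T.mulAt (X s) :=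
  c.compStr_subOfEq (Subdivision.whole n) _

/-- Why `τ` can be read off from the composite substitution: an outer unary layer created by `u` is
removed again by `σ`, and only `τ` is left. -/
theorem unit_τ_sub₁ {n : ℕ} (X : Fin n → V) :
    E.str.unit (fun _ => T.obj ((E.tensor n).obj X)) ≫
        E.tensor.tmap (fun _ : Fin 1 => c.τ X) ≫ E.str.sub₁ (fun i => T.obj (X i)) = c.τ X := by
  rw [← Category.assoc, ← E.str.unit_naturality fun _ : Fin 1 => c.τ X, Category.assoc,
    E.str.unit_sub₁, Category.comp_id]

/-- By `η_τ`, the coherence map in `σ'` turns the outer `η` into `E η`. The two units at each entry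
then slide past `σ`, and the final `μ` removes one of them. -/
theorem sub_unitAt_eq {N k : ℕ} (d : Subdivision N k) (X : Fin N → V) :
    E.str.sub d X ≫ E.tensor.tmap (fun s => T.unitAt (X s)) =
      E.tensor.tmap (fun i => E.tensor.tmap fun j => T.unitAt (X (d.index i j))) ≫
        E.tensor.tmap (fun i => T.unitAt ((E.tensor (d.len i)).obj fun j =>
          T.obj (X (d.index i j)))) ≫ c.compSub d X := by
  simp only [compSub, E.tensor.tmap_comp_assoc, c.unitAt_τ, E.tensor.tmap_comp]
  rw [E.str.sub_naturality_assoc d fun s => T.unitAt (X s) ≫ T.unitAt (T.obj (X s)),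
    E.tensor.tmap_comp]
  simp only [Category.assoc, T.unitAt_mulAt, Category.comp_id]

/-- After `unit_τ_sub₁` and `unit_τ` this is naturality of `u` at `μ`. -/
theorem mulAt_unit_eq (X : V) : T.mulAt X ≫ E.str.unit (fun _ => T.obj X) =
    T.map (E.str.unit fun _ => T.obj X) ≫
      E.str.unit (fun _ => T.obj ((E.tensor 1).obj fun _ => T.obj X)) ≫
        c.compStr.σ₁ fun _ : Fin 1 => X := by
  rw [compStr_σ₁, ← Category.assoc (E.tensor.tmap _),
    ← Category.assoc (E.str.unit fun _ => T.obj ((E.tensor 1).obj fun _ => T.obj X)),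
    c.unit_τ_sub₁ fun _ => T.obj X, ← Category.assoc, c.unit_τ]
  exact E.str.unit_naturality fun _ => T.mulAt X

/-- The `η` between `u` and `τ` becomes `E₁ η` by `η_τ` and moves in front of `u`. Then `u` cancels
against `σ`, and `η` against `μ`. -/
theorem middle_unit_eq {n : ℕ} (X : Fin n → V) :
    E.tensor.tmap (fun i : Fin n => E.str.unit (fun _ => T.obj (X i)) ≫
        T.unitAt ((E.tensor 1).obj fun _ => T.obj (X i))) ≫ c.compStr.σₛ X =
      𝟙 ((E.tensor n).obj fun i => T.obj (X i)) := by
  have h : c.compStr.σₛ X = E.tensor.tmap (fun i => c.τ fun _ => T.obj (X i)) ≫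
      E.str.subₛ (fun s => T.obj (T.obj (X s))) ≫ E.tensor.tmap fun s => T.mulAt (X s) :=
    c.compStr_subOfEq (Subdivision.singles n) _
  have h1 : ∀ i, (E.str.unit (fun _ => T.obj (X i)) ≫
        T.unitAt ((E.tensor 1).obj fun _ => T.obj (X i))) ≫ c.τ (fun _ => T.obj (X i)) =
      T.unitAt (T.obj (X i)) ≫ E.str.unit fun _ => T.obj (T.obj (X i)) := by
    intro i
    rw [Category.assoc, c.unitAt_τ]
    exact (E.str.unit_naturality fun _ => T.unitAt (T.obj (X i))).symm
  rw [h, E.tensor.tmap_comp_assoc]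
  simp only [h1]
  rw [← E.tensor.tmap_comp_assoc, ← Category.assoc (E.tensor.tmap _) (E.str.subₛ _),
    E.str.unit_subₛ, Category.id_comp, E.tensor.tmap_comp]
  simp only [T.unitAt_mulAt, E.tensor.tmap_id]

/-- In a constant sequence of length one no transport is needed, so `sub₁` is here the
multiplication of the monad `F₁`. -/
theorem sub₁_const (F : TensorFamily V) (S : MultitensorStruct F) (X : V) :
    S.sub₁ (fun _ : Fin 1 => X) = S.sub (Subdivision.whole 1) fun _ => X :=
  S.subOfEq_rfl (Subdivision.whole 1) fun _ => X

/-- The multitensor structure on `EM(T)` determined by an opmonoidal monad, together with its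
compatibility with `E` and `T`. -/
def composite : CompositeMultitensor E T where
  str := c.compStr
  unit_eq _ := rfl
  isMultitensorMap :=
    { unit := fun X => (E.str.unit_naturality fun i => T.unitAt (X i)).symm
      sub := fun d X => c.sub_unitAt_eq d X }
  isMonadMap := by
    refine ⟨{ app := fun X => E.str.unit fun _ : Fin 1 => T.obj X
              naturality := fun X Y f => E.str.unit_naturality fun _ => T.map f
              app_η := fun X => rfl
              app_μ := fun X => ?_ }, fun X => rfl⟩
    have h := c.mulAt_unit_eq X
    rw [MultitensorStruct.σ₁, sub₁_const] at h
    exact h.trans (Category.assoc _ _ _).symm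
  middle_unit X := (middle_unit_iff c.compStr X).trans (c.middle_unit_eq X)

end OpmonoidalCoherence

end

end MultitensorLaw

/-! ### From composite multitensors to coherence maps -/

namespace MultitensorLaw

section

variable {V : Type u} [Category.{v} V]

namespace MultitensorStruct

variable {E : TensorFamily V} {T : Monad V} (S : MultitensorStruct (E.precomp T.toFunctor))
  {N k : ℕ}

theorem σ_naturality (d : Subdivision N k) {X Y : Fin N → V} (f : ∀ i, X i ⟶ Y i) :
    E.tmap (fun i => T.map (E.tmap fun j => T.map (f (d.index i j)))) ≫ S.σ d Y =
      S.σ d X ≫ E.tmap fun s => T.map (f s) :=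
  S.sub_naturality d f

theorem σ₁_naturality {X Y : Fin N → V} (f : ∀ i, X i ⟶ Y i) :
    E.tmap (fun _ : Fin 1 => T.map (E.tmap fun j => T.map (f j))) ≫ S.σ₁ Y =
      S.σ₁ X ≫ E.tmap fun s => T.map (f s) :=
  S.sub₁_naturality f

theorem σ_σₛ (d : Subdivision N k) (X : Fin N → V) :
    S.σ d (fun s => (E 1).obj fun _ => T.obj (X s)) ≫ S.σₛ X =
      E.tmap (fun i => T.map (S.σₛ fun j => X (d.index i j))) ≫ S.σ d X :=
  S.sub_subₛ d X

theorem σₛ_σ (d : Subdivision N k) (X : Fin N → V) :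
    S.σₛ (fun i => (E (d.len i)).obj fun j => T.obj (X (d.index i j))) ≫ S.σ d X =
      E.tmap (fun i => T.map (S.σ₁ fun j => X (d.index i j))) ≫ S.σ d X :=
  S.subₛ_sub d X

theorem σ₁_σ (d : Subdivision N k) (X : Fin N → V) :
    S.σ₁ (fun i => (E (d.len i)).obj fun j => T.obj (X (d.index i j))) ≫ S.σ d X =
      E.tmap (fun _ : Fin 1 => T.map (S.σ d X)) ≫ S.σ₁ X :=
  S.sub₁_sub d X

theorem σ₁_σₛ (X : Fin N → V) :
    S.σ₁ (fun i => (E 1).obj fun _ => T.obj (X i)) ≫ S.σₛ X =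
      E.tmap (fun _ : Fin 1 => T.map (S.σₛ X)) ≫ S.σ₁ X :=
  S.sub₁_subₛ X

theorem σ₁_σ₁ (X : Fin N → V) :
    S.σ₁ (fun _ : Fin 1 => (E N).obj fun j => T.obj (X j)) ≫ S.σ₁ X =
      E.tmap (fun _ : Fin 1 => T.map (S.σ₁ X)) ≫ S.σ₁ X :=
  S.sub₁_sub₁ X

theorem σₛ_σₛ (X : Fin N → V) :
    S.σₛ (fun i => (E 1).obj fun _ => T.obj (X i)) ≫ S.σₛ X =
      E.tmap (fun i => T.map (S.σ₁ fun _ : Fin 1 => X i)) ≫ S.σₛ X :=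
  S.subₛ_subₛ X

end MultitensorStruct

namespace CompositeMultitensor

variable {E : Multitensor V} {T : Monad V} (S : CompositeMultitensor E T) {N k : ℕ}

theorem unitAt_unit_σ₁ (X : Fin N → V) :
    T.unitAt ((E.tensor N).obj fun j => T.obj (X j)) ≫
      E.str.unit (fun _ => T.obj ((E.tensor N).obj fun j => T.obj (X j))) ≫ S.str.σ₁ X = 𝟙 _ := by
  have h := S.str.unit_sub₁ X
  rw [S.unit_eq] at h
  exact (Category.assoc _ _ _).symm.trans h

theorem unit_unitAt_σₛ (X : Fin N → V) :
    E.tensor.tmap (fun i => E.str.unit (fun _ => T.obj (X i)) ≫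
        T.unitAt ((E.tensor 1).obj fun _ => T.obj (X i))) ≫ S.str.σₛ X = 𝟙 _ :=
  (middle_unit_iff S.str X).symm.trans (S.middle_unit X)

theorem sub_unitAt (d : Subdivision N k) (X : Fin N → V) :
    E.str.sub d X ≫ E.tensor.tmap (fun s => T.unitAt (X s)) =
      E.tensor.tmap (fun i => E.tensor.tmap fun j => T.unitAt (X (d.index i j))) ≫
        E.tensor.tmap (fun i => T.unitAt ((E.tensor (d.len i)).obj fun j =>
          T.obj (X (d.index i j)))) ≫ S.str.σ d X :=
  S.isMultitensorMap.sub d X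

theorem mulAt_unit (X : V) : T.mulAt X ≫ E.str.unit (fun _ => T.obj X) =
    T.map (E.str.unit fun _ => T.obj X) ≫
      E.str.unit (fun _ => T.obj ((E.tensor 1).obj fun _ => T.obj X)) ≫
        S.str.σ₁ fun _ : Fin 1 => X := by
  obtain ⟨φ, hφ⟩ := S.isMonadMap
  have h := φ.app_μ X
  rw [hφ, hφ] at h
  rw [MultitensorStruct.σ₁, OpmonoidalCoherence.sub₁_const]
  exact h.trans (Category.assoc _ _ _)

/-- The multiplication of `T` expressed by the substitution of the composite multitensor. -/
theorem tmap_mulAt (X : Fin N → V) :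
    E.tensor.tmap (fun i => T.mulAt (X i)) =
      E.tensor.tmap (fun i => T.map (E.str.unit fun _ => T.obj (X i))) ≫ S.str.σₛ X := by
  -- The middle unit law inserts `u` and `η` behind `μ`. Since `uT` is a monad map, `μ` and `u`
  -- become `T u`, `u` and a substitution of unary layers, past which `η` slides. Associativity for
  -- `E_i E₁ E₁` then exposes a second instance of the middle unit law, which removes the extra
  -- layer.
  have h1 : ∀ i, T.mulAt (X i) ≫ E.str.unit (fun _ => T.obj (X i)) ≫
        T.unitAt ((E.tensor 1).obj fun _ => T.obj (X i)) =
      T.map (E.str.unit fun _ => T.obj (X i)) ≫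
        (E.str.unit (fun _ => T.obj ((E.tensor 1).obj fun _ => T.obj (X i))) ≫
        T.unitAt ((E.tensor 1).obj fun _ => T.obj ((E.tensor 1).obj fun _ => T.obj (X i)))) ≫
          T.map (S.str.σ₁ fun _ : Fin 1 => X i) := by
    intro i
    rw [← Category.assoc, S.mulAt_unit]
    simp only [Category.assoc, ← T.unitAt_naturality]
  rw [← Category.comp_id (E.tensor.tmap fun i => T.mulAt (X i)), ← S.unit_unitAt_σₛ,
    E.tensor.tmap_comp_assoc]
  simp only [h1]
  rw [← E.tensor.tmap_comp_assoc, ← E.tensor.tmap_comp_assoc, ← S.str.σₛ_σₛ,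
    ← Category.assoc (E.tensor.tmap _) (S.str.σₛ _), S.unit_unitAt_σₛ, Category.id_comp]

/-- Since `E μ` is given by a substitution, by `tmap_mulAt`, this is naturality of `σ'` combined
with associativity for an innermost unary layer. The lemma after it is the same with an outer unary
layer. -/
theorem σ_tmap_mulAt (d : Subdivision N k) (X : Fin N → V) :
    S.str.σ d (fun s => T.obj (X s)) ≫ E.tensor.tmap (fun s => T.mulAt (X s)) =
      E.tensor.tmap (fun i => T.map (E.tensor.tmap fun j => T.mulAt (X (d.index i j)))) ≫
        S.str.σ d X := by
  rw [S.tmap_mulAt X, ← Category.assoc, ← S.str.σ_naturality, Category.assoc, S.str.σ_σₛ,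
    E.tensor.tmap_comp_assoc]
  simp only [← T.map_comp, ← S.tmap_mulAt]

theorem σ₁_tmap_mulAt (X : Fin N → V) :
    S.str.σ₁ (fun s => T.obj (X s)) ≫ E.tensor.tmap (fun s => T.mulAt (X s)) =
      E.tensor.tmap (fun _ : Fin 1 => T.map (E.tensor.tmap fun j => T.mulAt (X j))) ≫
        S.str.σ₁ X := by
  rw [S.tmap_mulAt X, ← Category.assoc, ← S.str.σ₁_naturality, Category.assoc, S.str.σ₁_σₛ,
    E.tensor.tmap_comp_assoc]
  simp only [← T.map_comp, ← S.tmap_mulAt]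

theorem tmap_unitAt_mulAt (E : TensorFamily V) (T : Monad V) (X : Fin N → V) :
    E.tmap (fun i => T.unitAt (T.obj (X i))) ≫ E.tmap (fun i => T.mulAt (X i)) = 𝟙 _ := by
  simp only [E.tmap_comp, T.unitAt_mulAt, E.tmap_id]

/-- The substitution of `E` expressed by the substitution of the composite multitensor. -/
theorem sub_eq (d : Subdivision N k) (X : Fin N → V) :
    E.str.sub d (fun s => T.obj (X s)) =
      E.tensor.tmap (fun i => T.unitAt ((E.tensor (d.len i)).obj fun j =>
        T.obj (X (d.index i j)))) ≫ S.str.σ d X := by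
  -- Writing the identity as `η` followed by `μ` makes the multitensor map `E η` applicable.
  -- Afterwards `μ` moves back through `σ'` and cancels the innermost `η`.
  rw [← Category.comp_id (E.str.sub d _), ← tmap_unitAt_mulAt, ← Category.assoc, S.sub_unitAt]
  simp only [Category.assoc]
  rw [S.σ_tmap_mulAt]
  simp only [E.tensor.tmap_comp_assoc, ← T.unitAt_naturality, T.unitAt_mulAt,
    E.tensor.tmap_id, Category.id_comp]

/-- The opmonoidal coherences determined by a composite multitensor. -/
def coherenceMap {n : ℕ} (X : Fin n → V) :
    T.obj ((E.tensor n).obj X) ⟶ (E.tensor n).obj fun i => T.obj (X i) :=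
  E.str.unit (fun _ => T.obj ((E.tensor n).obj X)) ≫
    E.tensor.tmap (fun _ : Fin 1 => T.map (E.tensor.tmap fun i => T.unitAt (X i))) ≫ S.str.σ₁ X

theorem map_unit_σ₁ {n : ℕ} {X : V} {Y : Fin n → V} (f : X ⟶ (E.tensor n).obj fun i => T.obj (Y i)) :
    E.str.unit (fun _ => T.obj X) ≫ E.tensor.tmap (fun _ : Fin 1 => T.map f) ≫ S.str.σ₁ Y =
      T.map f ≫ E.str.unit (fun _ => T.obj ((E.tensor n).obj fun i => T.obj (Y i))) ≫
        S.str.σ₁ Y := by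
  rw [← Category.assoc, ← Category.assoc]
  exact congrArg (· ≫ S.str.σ₁ Y) (E.str.unit_naturality fun _ : Fin 1 => T.map f).symm

theorem coherenceMap_eq {n : ℕ} (X : Fin n → V) : S.coherenceMap X =
    T.map (E.tensor.tmap fun i => T.unitAt (X i)) ≫
      E.str.unit (fun _ => T.obj ((E.tensor n).obj fun i => T.obj (X i))) ≫ S.str.σ₁ X :=
  S.map_unit_σ₁ _

/-- The unary layer through which the inner coherence maps pass is redundant in front of `σ'`:
associativity for `E_i E₁ E_j` brings it to a place where the middle unit law removes it, so that
only `T E η` is left of `τ`. -/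
theorem coherenceMap_σ (d : Subdivision N k) (X : Fin N → V) :
    E.tensor.tmap (fun i => S.coherenceMap (fun j => X (d.index i j)) ≫
        T.unitAt ((E.tensor (d.len i)).obj fun j => T.obj (X (d.index i j)))) ≫ S.str.σ d X =
      E.tensor.tmap (fun i => T.map (E.tensor.tmap fun j => T.unitAt (X (d.index i j)))) ≫
        S.str.σ d X := by
  have h : ∀ i, S.coherenceMap (fun j => X (d.index i j)) ≫
        T.unitAt ((E.tensor (d.len i)).obj fun j => T.obj (X (d.index i j))) =
      T.map (E.tensor.tmap fun j => T.unitAt (X (d.index i j))) ≫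
        (E.str.unit (fun _ => T.obj ((E.tensor (d.len i)).obj fun j => T.obj (X (d.index i j)))) ≫
        T.unitAt ((E.tensor 1).obj fun _ => T.obj ((E.tensor (d.len i)).obj fun j =>
          T.obj (X (d.index i j))))) ≫ T.map (S.str.σ₁ fun j => X (d.index i j)) := by
    intro i
    simp only [coherenceMap_eq, Category.assoc, ← T.unitAt_naturality]
  simp only [h]
  rw [← E.tensor.tmap_comp_assoc, ← E.tensor.tmap_comp_assoc, ← S.str.σₛ_σ,
    ← Category.assoc (E.tensor.tmap _) (S.str.σₛ _), S.unit_unitAt_σₛ, Category.id_comp]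

/-- The opmonoidal monad determined by a composite multitensor. -/
def coherence : OpmonoidalCoherence E T where
  τ X := S.coherenceMap X
  naturality {n X Y} f := by
    rw [coherenceMap_eq, coherenceMap_eq, ← Category.assoc, ← T.map_comp, E.tensor.tmap_comp]
    simp only [T.unitAt_naturality, Category.assoc]
    rw [← S.str.σ₁_naturality, ← E.tensor.tmap_comp, T.map_comp, Category.assoc]
    refine congrArg (T.map _ ≫ ·) ?_
    exact (S.map_unit_σ₁ _).symm
  unit_τ X := by
    -- A sequence of length one is constant, the form in which `mulAt_unit` is available.
    obtain ⟨x, rfl⟩ : ∃ x, X = fun _ => x := ⟨X 0, funext fun i => congrArg X (Subsingleton.elim _ _)⟩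
    rw [coherenceMap_eq, ← Category.assoc, ← T.map_comp, ← E.str.unit_naturality, T.map_comp,
      Category.assoc, ← S.mulAt_unit, ← Category.assoc, T.map_unitAt_mulAt, Category.id_comp]
  sub_τ {N k} d X := by
    -- Associativity for `E₁ E_i E_j`, with the outer unary layer created by `u`.
    have h : T.map (S.str.σ d X) ≫ E.str.unit (fun _ => T.obj ((E.tensor N).obj fun i =>
          T.obj (X i))) ≫ S.str.σ₁ X =
        E.str.unit (fun _ => T.obj ((E.tensor k).obj fun i => T.obj ((E.tensor (d.len i)).obj
          fun j => T.obj (X (d.index i j))))) ≫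
        S.str.σ₁ (fun i => (E.tensor (d.len i)).obj fun j => T.obj (X (d.index i j))) ≫
          S.str.σ d X := by
      rw [S.str.σ₁_σ, S.map_unit_σ₁]
    have h' : S.coherenceMap (fun i => (E.tensor (d.len i)).obj fun j => X (d.index i j)) ≫
          E.tensor.tmap (fun i => T.map (E.tensor.tmap fun j => T.unitAt (X (d.index i j)))) =
        T.map (E.tensor.tmap fun i => T.unitAt ((E.tensor (d.len i)).obj fun j => X (d.index i j)) ≫
          T.map (E.tensor.tmap fun j => T.unitAt (X (d.index i j)))) ≫
        E.str.unit (fun _ => T.obj ((E.tensor k).obj fun i => T.obj ((E.tensor (d.len i)).obj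
          fun j => T.obj (X (d.index i j))))) ≫
        S.str.σ₁ (fun i => (E.tensor (d.len i)).obj fun j => T.obj (X (d.index i j))) := by
      rw [coherenceMap_eq, Category.assoc, Category.assoc, ← S.str.σ₁_naturality,
        ← Category.assoc (E.str.unit _), ← E.str.unit_naturality fun _ => T.map
          (E.tensor.tmap fun i => T.map (E.tensor.tmap fun j => T.unitAt (X (d.index i j)))),
        Category.assoc, ← Category.assoc, ← T.map_comp, E.tensor.tmap_comp]
    -- `sub_eq` expresses `σ` through `σ'`, after which `coherenceMap_σ` reduces the inner coherence
    -- maps to units of `T`. Then `h'` expands the outer one, and the two sides differ by `h` and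
    -- naturality of `η`.
    rw [S.sub_eq, E.tensor.tmap_comp_assoc, S.coherenceMap_σ, S.coherenceMap_eq X,
      ← Category.assoc, ← T.map_comp, S.sub_unitAt, ← Category.assoc (S.coherenceMap _), h',
      E.tensor.tmap_comp_assoc]
    simp only [T.map_comp, Category.assoc, h, T.unitAt_naturality]
  η_τ X := by
    refine (congrArg (T.unitAt _ ≫ ·) (S.coherenceMap_eq X)).trans ?_
    rw [← Category.assoc, ← T.unitAt_naturality, Category.assoc, S.unitAt_unit_σ₁,
      Category.comp_id]
    rfl
  μ_τ {n} X := by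
    change T.mulAt _ ≫ S.coherenceMap X = T.map (S.coherenceMap X) ≫
      S.coherenceMap (fun i => T.obj (X i)) ≫ E.tensor.tmap fun i => T.mulAt (X i)
    -- On the right, `E μ` moves through `σ'` and cancels the `η` in the second coherence map,
    -- leaving `T τ`, `u` and `σ'`. The left side takes the same form by `mulAt_unit` and
    -- associativity for `E₁ E₁ E_i`.
    rw [S.coherenceMap_eq (fun i => T.obj (X i)), Category.assoc, Category.assoc, S.σ₁_tmap_mulAt,
      S.map_unit_σ₁, ← Category.assoc (T.map (E.tensor.tmap _)), ← T.map_comp, tmap_unitAt_mulAt,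
      T.map_id, Category.id_comp, coherenceMap_eq, ← Category.assoc, ← T.mulAt_naturality,
      Category.assoc, ← Category.assoc (T.mulAt _), S.mulAt_unit, Category.assoc, Category.assoc,
      S.str.σ₁_σ₁, S.map_unit_σ₁]
    simp only [T.map_comp, Category.assoc]

/-- With `σ` written through `σ'`, `coherenceMap_σ` leaves only `T E η` of the coherence maps, and
the final `μ`, moved through `σ'`, cancels this `η`. -/
theorem compSub_coherence (d : Subdivision N k) (X : Fin N → V) :
    S.coherence.compSub d X = S.str.σ d X := by
  have h : S.coherence.compSub d X = E.tensor.tmap (fun i => S.coherenceMap fun j =>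
      T.obj (X (d.index i j))) ≫ E.str.sub d (fun s => T.obj (T.obj (X s))) ≫
        E.tensor.tmap fun s => T.mulAt (X s) := rfl
  rw [h, S.sub_eq d fun s => T.obj (X s), Category.assoc, E.tensor.tmap_comp_assoc,
    ← Category.assoc, S.coherenceMap_σ d fun s => T.obj (X s), Category.assoc, S.σ_tmap_mulAt, E.tensor.tmap_comp_assoc]
  simp only [← T.map_comp, tmap_unitAt_mulAt, T.map_id, E.tensor.tmap_id, Category.id_comp]

/-- The unit is prescribed by `unit_eq`, so the substitution is the only free datum. -/
theorem ext {S S' : CompositeMultitensor E T}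
    (h : ∀ {N k : ℕ} (d : Subdivision N k) (X : Fin N → V), S.str.sub d X = S'.str.sub d X) :
    S = S' := by
  obtain ⟨str, h1, h2, h3, h4⟩ := S
  obtain ⟨str', h1', h2', h3', h4'⟩ := S'
  obtain rfl : str = str' := by
    refine MultitensorStruct.ext ?_ ?_
    · funext X
      exact (h1 X).trans (h1' X).symm
    · funext N k d X
      exact h d X
  rfl

end CompositeMultitensor

/-- By `unit_τ_sub₁`, the unary layer in the recovered map contributes `τ` at `TX` followed by `E
μ`. By naturality of `τ`, the initial `T E η` comes after `τ` and cancels this `μ`. -/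
theorem OpmonoidalCoherence.coherence_composite {E : Multitensor V} {T : Monad V}
    (c : OpmonoidalCoherence E T) : c.composite.coherence = c := by
  refine OpmonoidalCoherence.ext ?_
  funext n X
  change c.composite.coherenceMap X = c.τ X
  rw [CompositeMultitensor.coherenceMap_eq]
  change T.map (E.tensor.tmap fun i => T.unitAt (X i)) ≫
    E.str.unit (fun _ => T.obj ((E.tensor n).obj fun i => T.obj (X i))) ≫ c.compStr.σ₁ X = c.τ X
  rw [c.compStr_σ₁, ← Category.assoc (E.tensor.tmap _), ← Category.assoc (E.str.unit _),
    c.unit_τ_sub₁ fun i => T.obj (X i), ← Category.assoc, c.naturality, Category.assoc,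
    E.tensor.tmap_comp]
  simp only [T.map_unitAt_mulAt, E.tensor.tmap_id, Category.comp_id]

/-- Opmonoidal coherences correspond to composite multitensors. -/
def compositeEquiv (E : Multitensor V) (T : Monad V) :
    OpmonoidalCoherence E T ≃ CompositeMultitensor E T where
  toFun c := c.composite
  invFun S := S.coherence
  left_inv c := c.coherence_composite
  right_inv S := CompositeMultitensor.ext fun d X => S.compSub_coherence d X

end

end MultitensorLaw

/-! ### Liftings to algebras -/

namespace CategoryTheory.Monad

variable {C : Type u} [Category.{v} C] (T : Monad C)

/-- The free algebra on an object. -/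
abbrev freeAt (X : C) : T.Algebra where
  A := T.obj X
  a := T.mulAt X
  unit := T.unitAt_mulAt X
  assoc := (T.mulAt_mulAt X).symm

variable {T}

theorem Algebra.unitAt_a (A : T.Algebra) : T.unitAt A.A ≫ A.a = 𝟙 A.A := A.unit

theorem Algebra.mulAt_a (A : T.Algebra) : T.mulAt A.A ≫ A.a = T.map A.a ≫ A.a := A.assoc

theorem Algebra.eqToHom_f {A B : T.Algebra} (h : A = B) :
    (eqToHom h).f = eqToHom (congrArg Monad.Algebra.A h) := by
  subst h
  rfl

/-- The structure map of an algebra, as a morphism from the free algebra. -/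
def Algebra.counit (A : T.Algebra) : T.freeAt A.A ⟶ A where
  f := A.a
  h := A.assoc.symm

/-- A lifting of a functor through the forgetful functor from algebras. -/
def liftFunctor {D : Type u₁} [Category.{v₁} D] (H : D ⥤ C)
    (α : ∀ X, T.obj (H.obj X) ⟶ H.obj X) (h₁ : ∀ X, T.unitAt (H.obj X) ≫ α X = 𝟙 _)
    (h₂ : ∀ X, T.mulAt (H.obj X) ≫ α X = T.map (α X) ≫ α X)
    (h₃ : ∀ {X Y} (f : X ⟶ Y), T.map (H.map f) ≫ α Y = α X ≫ H.map f) : D ⥤ T.Algebra where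
  obj X := ⟨H.obj X, α X, h₁ X, h₂ X⟩
  map f := ⟨H.map f, h₃ f⟩
  map_id X := Monad.Algebra.Hom.ext (H.map_id X)
  map_comp f g := Monad.Algebra.Hom.ext (H.map_comp f g)

/-- The hypothesis is a strict equality of functors, so `H` may be taken to be `G ⋙ T.forget`, and
the actions are then the structure maps of the algebras `G.obj X`. -/
theorem exists_eq_liftFunctor {D : Type u₁} [Category.{v₁} D] (H : D ⥤ C) (G : D ⥤ T.Algebra)
    (h : G ⋙ T.forget = H) : ∃ (α : ∀ X, T.obj (H.obj X) ⟶ H.obj X)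
      (h₁ : ∀ X, T.unitAt (H.obj X) ≫ α X = 𝟙 _)
      (h₂ : ∀ X, T.mulAt (H.obj X) ≫ α X = T.map (α X) ≫ α X)
      (h₃ : ∀ {X Y} (f : X ⟶ Y), T.map (H.map f) ≫ α Y = α X ≫ H.map f),
      G = liftFunctor H α h₁ h₂ h₃ := by
  subst h
  exact ⟨fun X => (G.obj X).a, fun X => (G.obj X).unit, fun X => (G.obj X).assoc,
    fun f => (G.map f).h, rfl⟩

end CategoryTheory.Monad

namespace MultitensorLaw

section

variable {V : Type u} [Category.{v} V]

/-- Actions of `T` on the tensor products of underlying objects of algebras, making `E` lift to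
algebras. -/
@[ext]
structure LiftedActions (E : Multitensor V) (T : Monad V) where
  act : ∀ {n : ℕ} (X : Fin n → T.Algebra),
    T.obj ((E.tensor n).obj fun i => (X i).A) ⟶ (E.tensor n).obj fun i => (X i).A
  unit_act : ∀ {n : ℕ} (X : Fin n → T.Algebra), T.unitAt _ ≫ act X = 𝟙 _
  mul_act : ∀ {n : ℕ} (X : Fin n → T.Algebra), T.mulAt _ ≫ act X = T.map (act X) ≫ act X
  act_naturality : ∀ {n : ℕ} {X Y : Fin n → T.Algebra} (f : ∀ i, X i ⟶ Y i),
    T.map (E.tensor.tmap fun i => (f i).f) ≫ act Y = act X ≫ E.tensor.tmap fun i => (f i).f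
  unit_hom : ∀ X : Fin 1 → T.Algebra, T.map (E.str.unit fun i => (X i).A) ≫ act X =
    (X 0).a ≫ E.str.unit fun i => (X i).A
  sub_hom : ∀ {N k : ℕ} (d : Subdivision N k) (X : Fin N → T.Algebra),
    T.map (E.str.sub d fun s => (X s).A) ≫ act X =
      act (fun i => ⟨(E.tensor (d.len i)).obj fun j => (X (d.index i j)).A,
        act fun j => X (d.index i j), unit_act _, mul_act _⟩) ≫ E.str.sub d fun s => (X s).A

theorem Lifting.ext_lift {E : Multitensor V} {T : Monad V} {L L' : Lifting E T}
    (h : L.lift = L'.lift) : L = L' := by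
  obtain ⟨l, _, _, _⟩ := L
  obtain ⟨l', _, _, _⟩ := L'
  obtain rfl : l = l' := h
  rfl

namespace LiftedActions

variable {E : Multitensor V} {T : Monad V} (L : LiftedActions E T)

/-- The lifted tensor products. -/
def functor (n : ℕ) : (Fin n → T.Algebra) ⥤ T.Algebra :=
  Monad.liftFunctor (Functor.pi (fun _ : Fin n => T.forget) ⋙ E.tensor n) (fun X => L.act X)
    (fun X => L.unit_act X) (fun X => L.mul_act X) (fun f => L.act_naturality f)

/-- The lifted multitensor structure. -/
def liftStr : MultitensorStruct L.functor where
  unit X := ⟨E.str.unit fun i => (X i).A, L.unit_hom X⟩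
  sub d X := ⟨E.str.sub d fun s => (X s).A, L.sub_hom d X⟩
  unit_naturality f := Monad.Algebra.Hom.ext (E.str.unit_naturality fun i => (f i).f)
  sub_naturality {_ _} d {_ _} f :=
    Monad.Algebra.Hom.ext (E.str.sub_naturality d fun i => (f i).f)
  unit_sub X := Monad.Algebra.Hom.ext <| (E.str.unit_sub fun s => (X s).A).trans <|
    E.tensor.tmap_congr fun _ => (Monad.Algebra.eqToHom_f _).symm
  sub_unit X := Monad.Algebra.Hom.ext (E.str.sub_unit fun s => (X s).A)
  assoc {_ _ _} d c X := Monad.Algebra.Hom.ext <| (E.str.assoc d c fun s => (X s).A).trans <|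
    congrArg (· ≫ E.str.sub (d.comp c) fun s => (X s).A) <| E.tensor.tmap_congr fun i =>
      congrArg (· ≫ E.str.sub (d.restrict c i) fun l => (X ((d.comp c).index i l)).A) <|
        E.tensor.tmap_congr fun _ => E.tensor.tmap_congr fun _ =>
          (Monad.Algebra.eqToHom_f _).symm

/-- The lifting of a multitensor determined by actions. -/
def lifting : Lifting E T where
  lift := ⟨L.functor, L.liftStr⟩
  tensor_forget _ := rfl
  unit_forget _ := HEq.rfl
  sub_forget _ _ := HEq.rfl

theorem lifting_injective : Function.Injective (lifting : LiftedActions E T → Lifting E T) := by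
  intro L L' h
  refine LiftedActions.ext ?_
  funext n X
  have h1 : ∀ M M' : Lifting E T, M = M' →
      HEq ((M.lift.tensor n).obj X).a ((M'.lift.tensor n).obj X).a := by
    rintro M _ rfl
    rfl
  exact eq_of_heq (h1 _ _ h)

theorem lifting_surjective : Function.Surjective (lifting : LiftedActions E T → Lifting E T) := by
  rintro ⟨⟨G, S⟩, hG, hu, hs⟩
  choose α h₁ h₂ h₃ h using fun n => Monad.exists_eq_liftFunctor _ (G n) (hG n)
  -- Once the lifted tensor products are literally given by actions on the `E_i X_i`, the
  -- heterogeneous equations for units and substitutions become ordinary ones, and say that the maps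
  -- of `E` are algebra morphisms.
  have hG' : G = fun n => Monad.liftFunctor _ (α n) (h₁ n) (h₂ n) (h₃ n) := funext h
  clear h
  subst hG'
  have hu' : ∀ X : Fin 1 → T.Algebra, (S.unit X).f = E.str.unit fun i => (X i).A :=
    fun X => eq_of_heq (hu X)
  have hs' : ∀ {N k : ℕ} (d : Subdivision N k) (X : Fin N → T.Algebra),
      (S.sub d X).f = E.str.sub d fun s => (X s).A := fun d X => eq_of_heq (hs d X)
  let L : LiftedActions E T :=
    { act := fun {n} X => α n X
      unit_act := fun {n} X => h₁ n X
      mul_act := fun {n} X => h₂ n X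
      act_naturality := fun {n _ _} f => h₃ n f
      unit_hom := fun X => by
        rw [← hu']
        exact (S.unit X).h
      sub_hom := fun d X => by
        rw [← hs']
        exact (S.sub d X).h }
  refine ⟨L, ?_⟩
  have : L.liftStr = S := by
    refine MultitensorStruct.ext ?_ ?_
    · funext X
      exact Monad.Algebra.Hom.ext (hu' X).symm
    · funext N k d X
      exact Monad.Algebra.Hom.ext (hs' d X).symm
  exact Lifting.ext_lift (congrArg (Multitensor.mk _) this)

end LiftedActions

/-- The actions determined by an opmonoidal monad. -/
def OpmonoidalCoherence.actions {E : Multitensor V} {T : Monad V} (c : OpmonoidalCoherence E T) :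
    LiftedActions E T where
  act X := c.τ (fun i => (X i).A) ≫ E.tensor.tmap fun i => (X i).a
  unit_act X := by
    rw [← Category.assoc, c.unitAt_τ, E.tensor.tmap_comp]
    simp only [Monad.Algebra.unitAt_a, E.tensor.tmap_id]
  mul_act X := by
    rw [← Category.assoc, c.mulAt_τ, T.map_comp, Category.assoc, Category.assoc, Category.assoc,
      ← Category.assoc (T.map (E.tensor.tmap _)), c.naturality, Category.assoc, E.tensor.tmap_comp,
      E.tensor.tmap_comp]
    simp only [Monad.Algebra.mulAt_a]
  act_naturality f := by
    rw [← Category.assoc, c.naturality, Category.assoc, Category.assoc, E.tensor.tmap_comp,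
      E.tensor.tmap_comp]
    simp only [Monad.Algebra.Hom.h]
  unit_hom X := by
    rw [← Category.assoc, c.unit_τ]
    exact (E.str.unit_naturality fun i => (X i).a).symm
  sub_hom d X := by
    rw [← Category.assoc, c.sub_τ]
    simp only [Category.assoc]
    rw [← E.str.sub_naturality, E.tensor.tmap_comp_assoc]

namespace LiftedActions

variable {E : Multitensor V} {T : Monad V} (L : LiftedActions E T)

/-- The opmonoidal coherence maps determined by actions. -/
def coherenceMap {n : ℕ} (X : Fin n → V) :
    T.obj ((E.tensor n).obj X) ⟶ (E.tensor n).obj fun i => T.obj (X i) :=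
  T.map (E.tensor.tmap fun i => T.unitAt (X i)) ≫ L.act fun i => T.freeAt (X i)

/-- The structure maps of the `X i` are algebra morphisms from free algebras. Naturality of the
action at them reduces it to the action on free algebras, because they are split in `V` by `η`. -/
theorem act_eq {n : ℕ} (X : Fin n → T.Algebra) :
    L.act X = L.coherenceMap (fun i => (X i).A) ≫ E.tensor.tmap fun i => (X i).a := by
  have h := L.act_naturality fun i => (X i).counit
  rw [coherenceMap, Category.assoc]
  refine Eq.trans ?_ (congrArg (T.map _ ≫ ·) h)
  rw [← Category.assoc, ← T.map_comp, E.tensor.tmap_comp]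
  simp only [Monad.Algebra.counit, Monad.Algebra.unitAt_a, E.tensor.tmap_id, T.map_id,
    Category.id_comp]

theorem coherenceMap_naturality {n : ℕ} {X Y : Fin n → V} (f : ∀ i, X i ⟶ Y i) :
    T.map (E.tensor.tmap f) ≫ L.coherenceMap Y =
      L.coherenceMap X ≫ E.tensor.tmap fun i => T.map (f i) := by
  have h := L.act_naturality (X := fun i => T.freeAt (X i)) (Y := fun i => T.freeAt (Y i))
    fun i => ⟨T.map (f i), T.mulAt_naturality (f i)⟩
  rw [coherenceMap, coherenceMap, Category.assoc]
  refine Eq.trans ?_ (congrArg (T.map _ ≫ ·) h)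
  simp only [← Category.assoc, ← T.map_comp, E.tensor.tmap_comp, T.unitAt_naturality]

/-- The opmonoidal monad determined by actions. -/
def coherence : OpmonoidalCoherence E T where
  τ X := L.coherenceMap X
  naturality f := L.coherenceMap_naturality f
  unit_τ X := by
    have h := L.unit_hom fun i => T.freeAt (X i)
    rw [coherenceMap, ← Category.assoc, ← T.map_comp, ← E.str.unit_naturality, T.map_comp,
      Category.assoc, h, ← Category.assoc]
    exact (congrArg (· ≫ _) (T.map_unitAt_mulAt (X 0))).trans (Category.id_comp _)
  sub_τ {N k} d X := by
    have h := L.sub_hom d fun s => T.freeAt (X s)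
    -- The algebras `E_j T X_ij` need not be free, but `act_eq` still expresses the action on their
    -- tensor product through coherence maps.
    have h1 := L.act_eq fun i => ⟨(E.tensor (d.len i)).obj fun j => T.obj (X (d.index i j)),
      L.act fun j => T.freeAt (X (d.index i j)), L.unit_act fun j => T.freeAt (X (d.index i j)),
      L.mul_act fun j => T.freeAt (X (d.index i j))⟩
    have h2 := L.coherenceMap_naturality fun i =>
      E.tensor.tmap fun j => T.unitAt (X (d.index i j))
    rw [coherenceMap, ← Category.assoc, ← T.map_comp, ← E.str.sub_naturality, T.map_comp,
      Category.assoc, h]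
    refine (congrArg (fun q => T.map _ ≫ q ≫ E.str.sub d fun s => T.obj (X s)) h1).trans ?_
    rw [Category.assoc, ← Category.assoc (T.map _), h2, Category.assoc, E.tensor.tmap_comp_assoc]
    rfl
  η_τ X := by
    refine (Category.assoc _ _ _).symm.trans ?_
    refine (congrArg (· ≫ _) (T.unitAt_naturality _).symm).trans ((Category.assoc _ _ _).trans ?_)
    exact (congrArg ((E.tensor.tmap fun i => T.unitAt (X i)) ≫ ·)
      (L.unit_act fun i => T.freeAt (X i))).trans (Category.comp_id _)
  μ_τ {n} X := by
    have h := L.mul_act fun i => T.freeAt (X i)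
    have h1 := L.act_eq fun i => T.freeAt (X i)
    change T.mulAt _ ≫ L.coherenceMap X = T.map (L.coherenceMap X) ≫
      L.coherenceMap (fun i => T.obj (X i)) ≫ E.tensor.tmap fun i => T.mulAt (X i)
    -- The last two factors on the right form the action on a tensor product of free algebras, so
    -- the claim is the associativity law of that action.
    rw [← h1, coherenceMap, ← Category.assoc, ← T.mulAt_naturality, Category.assoc, h, T.map_comp,
      Category.assoc]

end LiftedActions

/-- Opmonoidal coherences correspond to actions of `T` on tensor products of algebras. -/
def actionsEquiv (E : Multitensor V) (T : Monad V) :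
    OpmonoidalCoherence E T ≃ LiftedActions E T where
  toFun c := c.actions
  invFun L := L.coherence
  left_inv c := by
    refine OpmonoidalCoherence.ext ?_
    funext n X
    change T.map _ ≫ c.τ (fun i => T.obj (X i)) ≫ (E.tensor.tmap fun i => T.mulAt (X i)) = c.τ X
    rw [← Category.assoc, c.naturality, Category.assoc, E.tensor.tmap_comp]
    simp only [T.map_unitAt_mulAt, E.tensor.tmap_id, Category.comp_id]
  right_inv L := LiftedActions.ext <| by
    funext n X
    exact (L.act_eq X).symm

/-- Opmonoidal coherences correspond to liftings of the multitensor. -/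
noncomputable def liftingEquiv (E : Multitensor V) (T : Monad V) :
    OpmonoidalCoherence E T ≃ Lifting E T :=
  (actionsEquiv E T).trans
    (Equiv.ofBijective _ ⟨LiftedActions.lifting_injective, LiftedActions.lifting_surjective⟩)

end

end MultitensorLaw

/-! ### Categories enriched in the composite and in the lifted multitensor -/

theorem CategoryTheory.Functor.eq_of_comp_faithful {A : Type*} [Category A] {B : Type*} [Category B]
    {D : Type*} [Category D] {F G : A ⥤ B} (Φ : B ⥤ D) [Φ.Faithful]
    (hobj : ∀ X, F.obj X = G.obj X) (h : F ⋙ Φ = G ⋙ Φ) : F = G := by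
  refine CategoryTheory.Functor.ext hobj fun X Y f => Φ.map_injective ?_
  have := Functor.congr_hom h f
  simpa [eqToHom_map] using this

namespace CategoryTheory.Monad

variable {C : Type u} [Category.{v} C] {T : Monad C}

theorem Algebra.eq_of_a (A : T.Algebra) {a : T.obj A.A ⟶ A.A} (h₁ : T.unitAt A.A ≫ a = 𝟙 A.A)
    (h₂ : T.mulAt A.A ≫ a = T.map a ≫ a) (h : a = A.a) : (⟨A.A, a, h₁, h₂⟩ : T.Algebra) = A := by
  subst h
  rfl

end CategoryTheory.Monad

namespace MultitensorLaw

section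

variable {V : Type u} [Category.{v} V]

namespace MultitensorCat

/-- The only block of an undivided chain has the points of that chain only propositionally. This
moves compositions along such equalities. -/
theorem κ_congr {M : Multitensor V} (C : MultitensorCat.{v, u, w} M) {a b : C.graph.carrier} {n : ℕ}
    {f g : Fin (n + 1) → C.graph.carrier} (h : f = g) (hf : f 0 = a) (hf' : f (Fin.last n) = b)
    (hg : g 0 = a) (hg' : g (Fin.last n) = b)
    (e : ∀ j : Fin n, C.graph.hom (f j.castSucc) (f j.succ) =
      C.graph.hom (g j.castSucc) (g j.succ)) :
    M.tensor.tmap (fun j => eqToHom (e j)) ≫ C.κ (⟨n, g, hg, hg'⟩ : Chain a b) =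
      C.κ ⟨n, f, hf, hf'⟩ := by
  subst h
  simp only [eqToHom_refl]
  exact (congrArg (· ≫ C.κ (⟨n, f, hf, hf'⟩ : Chain a b)) (M.tensor.tmap_id
    (fun j => C.graph.hom (f j.castSucc) (f j.succ)))).trans (Category.id_comp _)

theorem ext_κ {M : Multitensor V} {C D : MultitensorCat.{v, u, w} M} (h : C.graph = D.graph)
    (hκ : HEq (@C.κ) (@D.κ)) : C = D := by
  obtain ⟨X, κ, _, _⟩ := C
  obtain ⟨Y, κ', _, _⟩ := D
  obtain rfl : X = Y := h
  obtain rfl := eq_of_heq hκ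
  rfl

instance (M : Multitensor V) : (forget.{v, u, w} M).Faithful where
  map_injective h := Hom.ext h

end MultitensorCat

instance {W : Type u₁} [Category.{v₁} W] (F : V ⥤ W) [F.Faithful] :
    (EnrichedGraph.mapFunctor.{v, u, v₁, u₁, w} F).Faithful where
  map_injective {X Y f g} h := by
    obtain ⟨fo, fm⟩ := f
    obtain ⟨go, gm⟩ := g
    obtain rfl : fo = go := congrArg EnrichedGraph.Hom.obj h
    have h1 := eq_of_heq (EnrichedGraph.Hom.mk.inj h).2
    obtain rfl : fm = gm := by
      funext a b
      exact F.map_injective (congrFun (congrFun h1 a) b)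
    rfl

namespace OpmonoidalCoherence

variable {E : Multitensor V} {T : Monad V} (c : OpmonoidalCoherence E T)

theorem mulAt_unit_family (X : Fin 1 → V) : T.mulAt (X 0) ≫ E.str.unit (fun i => T.obj (X i)) =
    T.map (E.str.unit fun i => T.obj (X i)) ≫
      E.str.unit (fun _ => T.obj ((E.tensor 1).obj fun i => T.obj (X i))) ≫ c.compStr.σ₁ X := by
  obtain ⟨x, rfl⟩ : ∃ x, X = fun _ => x :=
    ⟨X 0, funext fun i => congrArg X (Subsingleton.elim _ _)⟩
  exact c.mulAt_unit_eq x

section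

variable (C : MultitensorCat.{v, u, w} c.composite.multitensor)

/-- The compositions of a category enriched in the composite multitensor. -/
def comp {a b : C.graph.carrier} (p : Chain a b) :
    (E.tensor p.len).obj (fun i => T.obj (C.graph.homs p i)) ⟶ C.graph.hom a b :=
  C.κ p

/-- The map `T X(x₀, x₁) ⟶ X(a, b)` given by a sequence of length one from `a` to `b`. -/
def unary {a b : C.graph.carrier} (f : Fin 2 → C.graph.carrier) (h : f 0 = a)
    (h' : f (Fin.last 1) = b) : T.obj (C.graph.hom (f 0) (f 1)) ⟶ C.graph.hom a b :=
  E.str.unit (fun i => T.obj (C.graph.homs (⟨1, f, h, h'⟩ : Chain a b) i)) ≫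
    c.comp C ⟨1, f, h, h'⟩

/-- The action of `T` on the homs of a category enriched in the composite multitensor. -/
def homAct (a b : C.graph.carrier) : T.obj (C.graph.hom a b) ⟶ C.graph.hom a b :=
  E.str.unit (fun i => T.obj (C.graph.homs (Chain.pair a b) i)) ≫ c.comp C (Chain.pair a b)

/-- A sequence of length one is determined by its end points. The equality is heterogeneous because
the domain on the right mentions `f 0` and `f 1` in place of `a` and `b`. -/
theorem homAct_eq_unary {a b : C.graph.carrier} (f : Fin 2 → C.graph.carrier) (h : f 0 = a)
    (h' : f (Fin.last 1) = b) : HEq (c.homAct C a b) (c.unary C f h h') := by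
  have e : f = (Chain.pair a b).pt := by
    funext i
    exact Fin.cases h (fun i => Fin.cases h' (fun i => i.elim0) i) i
  subst e
  rfl

/-- This is `sub_κ` for the subdivision into a single block, preceded by `u`. In the proof, `θ`
identifies the sequence of homs along `p` with that along its only block. -/
theorem map_comp_homAct {a b : C.graph.carrier} (p : Chain a b) :
    T.map (c.comp C p) ≫ c.homAct C a b =
      E.str.unit (fun _ => T.obj ((E.tensor p.len).obj fun i => T.obj (C.graph.homs p i))) ≫
        c.compStr.σ₁ (C.graph.homs p) ≫ c.comp C p := by
  obtain ⟨n, pt, rfl, rfl⟩ := p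
  let p : Chain (pt 0) (pt (Fin.last n)) := ⟨n, pt, rfl, rfl⟩
  let d := Subdivision.whole n
  let θ (i : Fin 1) : T.obj ((E.tensor n).obj fun j => T.obj (C.graph.homs p j)) ⟶
      T.obj ((E.tensor n).obj fun j => T.obj (C.graph.homs p (d.index i j))) :=
    T.map (E.tensor.tmap fun j => T.map (eqToHom
      (congrArg (C.graph.homs p) (Subdivision.index_whole n i j).symm)))
  have e : ((p.block d 0).pt : Fin (n + 1) → C.graph.carrier) = pt := by
    funext j
    exact congrArg pt (Fin.ext (Nat.zero_add _))
  have h1 : θ 0 ≫ T.map (C.κ (p.block d 0)) = T.map (C.κ p) := by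
    refine (T.map_comp _ _).symm.trans (congrArg T.map ?_)
    exact C.κ_congr e.symm rfl rfl (p.block d 0).pt_zero (p.block d 0).pt_last _
  have h2 := E.str.unit_naturality θ
  have h3 := E.str.unit_naturality fun i => T.map (C.κ (p.block d i))
  have h4 : c.compSub d (C.graph.homs p) ≫ c.comp C p =
    E.tensor.tmap (fun i => T.map (C.κ (p.block d i))) ≫ C.κ (p.coarse d) := C.sub_κ p d
  have h5 : c.homAct C (pt 0) (pt (Fin.last n)) = E.str.unit (fun i => T.obj
      (C.graph.homs (p.coarse d) i)) ≫ C.κ (p.coarse d) :=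
    eq_of_heq (c.homAct_eq_unary C _ (p.coarse d).pt_zero (p.coarse d).pt_last)
  refine (congrArg (T.map (C.κ p) ≫ ·) h5).trans ?_
  refine (congrArg (· ≫ _) h1.symm).trans ?_
  refine (Category.assoc _ _ _).trans ?_
  refine (congrArg (θ 0 ≫ ·) ((Category.assoc _ _ _).symm.trans
    ((congrArg (· ≫ C.κ (p.coarse d)) h3).trans (Category.assoc _ _ _)))).trans ?_
  refine (Category.assoc _ _ _).symm.trans ?_
  refine (congrArg (· ≫ _) h2).trans ?_
  refine (Category.assoc _ _ _).trans (congrArg (E.str.unit _ ≫ ·) ?_)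
  exact (congrArg (E.tensor.tmap θ ≫ ·) h4.symm).trans (Category.assoc _ _ _).symm

/-- By `sub_κ` for blocks of length one, the actions and units in front of the composition amount to
`u`, `η` and `σ'`, which cancel by the middle unit law. Hence a composition over `EM(T)` is
determined by the actions on homs and its restriction along `η`. -/
theorem homAct_comp {a b : C.graph.carrier} (p : Chain a b) :
    E.tensor.tmap (fun i : Fin p.len => c.homAct C (p.pt i.castSucc) (p.pt i.succ)) ≫
      E.tensor.tmap (fun i => T.unitAt (C.graph.homs p i)) ≫ c.comp C p = c.comp C p := by
  let d := Subdivision.singles p.len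
  have h1 : ∀ i : Fin p.len, c.homAct C (p.pt i.castSucc) (p.pt i.succ) ≫
        T.unitAt (C.graph.homs p i) =
      (E.str.unit (fun j : Fin 1 => T.obj (C.graph.homs p (d.index i j))) ≫
        T.unitAt ((E.tensor 1).obj fun j : Fin 1 => T.obj (C.graph.homs p (d.index i j)))) ≫
          T.map (C.κ (p.block d i)) := by
    intro i
    have h := eq_of_heq (c.homAct_eq_unary C _ (p.block d i).pt_zero (p.block d i).pt_last)
    refine (congrArg (· ≫ T.unitAt (C.graph.homs p i)) h).trans ?_
    refine (Category.assoc _ _ _).trans (Eq.trans ?_ (Category.assoc _ _ _).symm)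
    exact congrArg (E.str.unit _ ≫ ·) (T.unitAt_naturality _)
  have h4 : c.compSub d (C.graph.homs p) ≫ c.comp C p =
    E.tensor.tmap (fun i => T.map (C.κ (p.block d i))) ≫ c.comp C p := C.sub_κ p d
  rw [E.tensor.tmap_comp_assoc]
  refine (congrArg (· ≫ c.comp C p) (E.tensor.tmap_congr h1)).trans ?_
  refine (congrArg (· ≫ c.comp C p) (E.tensor.tmap_comp _ _).symm).trans ?_
  refine (Category.assoc _ _ _).trans ?_
  refine (congrArg (E.tensor.tmap _ ≫ ·) h4.symm).trans ?_
  refine (Category.assoc _ _ _).symm.trans ?_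
  exact (congrArg (· ≫ c.comp C p) (c.composite.middle_unit (C.graph.homs p))).trans
    (Category.id_comp _)

end

end OpmonoidalCoherence

end

end MultitensorLaw

namespace MultitensorLaw

section

variable {V : Type u} [Category.{v} V]

/-- Compositions in algebras are determined by their underlying maps. These are compared
heterogeneously because the homs are only propositionally equal as algebras. -/
theorem MultitensorCat.mk_eq_of_f {T : Monad V} {M : Multitensor T.Algebra} {S : Type w}
    {h h' : S → S → T.Algebra} (hh : h = h')
    {κ : ∀ {a b : S} (p : Chain a b), (M.tensor p.len).obj
      ((⟨S, h⟩ : EnrichedGraph.{v, max u v, w} T.Algebra).homs p) ⟶ h a b}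
    {κ' : ∀ {a b : S} (p : Chain a b), (M.tensor p.len).obj
      ((⟨S, h'⟩ : EnrichedGraph.{v, max u v, w} T.Algebra).homs p) ⟶ h' a b} (hu hs hu' hs')
    (hκ : ∀ {a b : S} (p : Chain a b), HEq (κ p).f (κ' p).f) :
    (⟨⟨S, h⟩, κ, hu, hs⟩ : MultitensorCat.{v, max u v, w} M) = ⟨⟨S, h'⟩, κ', hu', hs'⟩ := by
  subst hh
  refine MultitensorCat.ext_κ rfl (heq_of_eq ?_)
  funext a b p
  exact Monad.Algebra.Hom.ext (eq_of_heq (hκ p))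

namespace OpmonoidalCoherence

variable {E : Multitensor V} {T : Monad V} (c : OpmonoidalCoherence E T)

section

variable (C : MultitensorCat.{v, u, w} c.composite.multitensor)

theorem unitAt_homAct (a b : C.graph.carrier) :
    T.unitAt (C.graph.hom a b) ≫ c.homAct C a b = 𝟙 _ :=
  (Category.assoc _ _ _).symm.trans (C.unit_κ a b)

/-- The monad map `uT` turns `μ` and `u` into a substitution of unary layers, and `map_comp_homAct`
for the sequence `(a, b)` identifies its effect on compositions with acting twice. -/
theorem mulAt_homAct (a b : C.graph.carrier) :
    T.mulAt (C.graph.hom a b) ≫ c.homAct C a b = T.map (c.homAct C a b) ≫ c.homAct C a b := by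
  have h1 : T.map (c.homAct C a b) ≫ c.homAct C a b =
      T.map (E.str.unit fun i => T.obj (C.graph.homs (Chain.pair a b) i)) ≫
        T.map (c.comp C (Chain.pair a b)) ≫ c.homAct C a b :=
    (congrArg (· ≫ c.homAct C a b) (T.map_comp _ _)).trans (Category.assoc _ _ _)
  rw [h1, c.map_comp_homAct C (Chain.pair a b)]
  have h2 := c.mulAt_unit_family (C.graph.homs (Chain.pair a b))
  refine (Category.assoc _ _ _).symm.trans
    ((congrArg (· ≫ c.comp C (Chain.pair a b)) h2).trans ?_)
  exact (Category.assoc _ _ _).trans (congrArg (T.map _ ≫ ·) (Category.assoc _ _ _))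

/-- The homs of a category enriched in the composite multitensor, as algebras. -/
def homAlg (a b : C.graph.carrier) : T.Algebra :=
  ⟨C.graph.hom a b, c.homAct C a b, c.unitAt_homAct C a b, c.mulAt_homAct C a b⟩

/-- The compositions of the `E`-category underlying a category enriched in the composite
multitensor. -/
def innerComp {a b : C.graph.carrier} (p : Chain a b) :
    (E.tensor p.len).obj (C.graph.homs p) ⟶ C.graph.hom a b :=
  E.tensor.tmap (fun i => T.unitAt (C.graph.homs p i)) ≫ c.comp C p

theorem homAct_innerComp {a b : C.graph.carrier} (p : Chain a b) :
    E.tensor.tmap (fun i : Fin p.len => c.homAct C (p.pt i.castSucc) (p.pt i.succ)) ≫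
      c.innerComp C p = c.comp C p :=
  c.homAct_comp C p

/-- On the right, `homAct_comp` leaves `τ` followed by the composition over `EM(T)`. Expressing this
`τ` through `σ'` yields what `map_comp_homAct` gives on the left. -/
theorem map_innerComp {a b : C.graph.carrier} (p : Chain a b) :
    T.map (c.innerComp C p) ≫ c.homAct C a b =
      (c.τ (C.graph.homs p) ≫
        E.tensor.tmap fun i => c.homAct C (p.pt i.castSucc) (p.pt i.succ)) ≫
          c.innerComp C p := by
  rw [innerComp, T.map_comp, Category.assoc, c.map_comp_homAct, Category.assoc, c.homAct_comp]
  have h := congrArg (fun c => c.τ (C.graph.homs p)) c.coherence_composite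
  change c.composite.coherenceMap _ = _ at h
  rw [CompositeMultitensor.coherenceMap_eq] at h
  rw [← h]
  exact ((Category.assoc _ _ _).trans (congrArg (T.map _ ≫ ·) (Category.assoc _ _ _))).symm

/-- An instance of restricting an enrichment along a multitensor map, here `E η`. -/
theorem sub_innerComp {a b : C.graph.carrier} (p : Chain a b) {k : ℕ}
    (d : Subdivision p.len k) : E.str.sub d (C.graph.homs p) ≫ c.innerComp C p =
      E.tensor.tmap (fun i => c.innerComp C (p.block d i)) ≫ c.innerComp C (p.coarse d) := by
  have h4 : c.compSub d (C.graph.homs p) ≫ c.comp C p =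
    E.tensor.tmap (fun i => T.map (c.comp C (p.block d i))) ≫ c.comp C (p.coarse d) := C.sub_κ p d
  rw [innerComp, ← Category.assoc, c.sub_unitAt_eq, Category.assoc, Category.assoc, h4]
  refine (congrArg (E.tensor.tmap _ ≫ ·) (E.tensor.tmap_comp_assoc _ _ _)).trans ?_
  refine (E.tensor.tmap_comp_assoc _ _ _).trans ?_
  refine Eq.trans ?_ (E.tensor.tmap_comp_assoc _ _ _).symm
  refine congrArg (· ≫ c.comp C (p.coarse d)) (E.tensor.tmap_congr fun i => ?_)
  refine Eq.trans ?_ (Category.assoc _ _ _).symm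
  exact congrArg (E.tensor.tmap _ ≫ ·) (T.unitAt_naturality _).symm

/-- The category enriched in the lifted multitensor determined by one enriched in the composite
multitensor. -/
def toLifted : MultitensorCat.{v, max u v, w} c.actions.lifting.lift where
  graph := ⟨C.graph.carrier, fun a b => c.homAlg C a b⟩
  κ p := ⟨c.innerComp C p, c.map_innerComp C p⟩
  unit_κ a b := Monad.Algebra.Hom.ext <| by
    have h := E.str.unit_naturality fun i => T.unitAt (C.graph.homs (Chain.pair a b) i)
    refine (Category.assoc _ _ _).symm.trans ?_
    refine (congrArg (· ≫ c.comp C (Chain.pair a b)) h.symm).trans ?_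
    exact C.unit_κ a b
  sub_κ p _ d := Monad.Algebra.Hom.ext (c.sub_innerComp C p d)

end

/-- The action consists of `u` and a composition along a sequence of length one, and an
`EM(T)`-functor respects the latter. -/
theorem map_homAct {C D : MultitensorCat.{v, u, w} c.composite.multitensor} (f : C ⟶ D)
    (a b : C.graph.carrier) : T.map (f.toHom.map a b) ≫ c.homAct D (f.toHom.obj a) (f.toHom.obj b) =
      c.homAct C a b ≫ f.toHom.map a b := by
  have h1 := eq_of_heq (c.homAct_eq_unary D _
    ((Chain.pair a b).image f.toHom.obj).pt_zero ((Chain.pair a b).image f.toHom.obj).pt_last)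
  have h2 := f.κ_map (Chain.pair a b)
  have h3 := E.str.unit_naturality fun i : Fin 1 =>
    T.map (f.toHom.map ((Chain.pair a b).pt i.castSucc) ((Chain.pair a b).pt i.succ))
  refine (congrArg (T.map (f.toHom.map a b) ≫ ·) h1).trans ?_
  refine (Category.assoc _ _ _).symm.trans ?_
  refine (congrArg (· ≫ D.κ ((Chain.pair a b).image f.toHom.obj)) h3).trans ?_
  refine (Category.assoc _ _ _).trans (Eq.trans ?_ (Category.assoc _ _ _).symm)
  exact congrArg (E.str.unit _ ≫ ·) h2.symm

/-- Categories enriched in the composite multitensor are categories enriched in the lifted one. -/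
def toLiftedFunctor : MultitensorCat.{v, u, w} c.composite.multitensor ⥤
    MultitensorCat.{v, max u v, w} c.actions.lifting.lift where
  obj C := c.toLifted C
  map {C D} f :=
    { toHom := ⟨f.toHom.obj, fun a b => ⟨f.toHom.map a b, c.map_homAct f a b⟩⟩
      κ_map := fun {a b} p => Monad.Algebra.Hom.ext <| by
        have h : c.comp C p ≫ f.toHom.map a b = E.tensor.tmap (fun i =>
          T.map (f.toHom.map (p.pt i.castSucc) (p.pt i.succ))) ≫
            c.comp D (p.image f.toHom.obj) := f.κ_map p
        change (E.tensor.tmap (fun i => T.unitAt (C.graph.homs p i)) ≫ c.comp C p) ≫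
          f.toHom.map a b = E.tensor.tmap (fun i => f.toHom.map (p.pt i.castSucc) (p.pt i.succ)) ≫
          E.tensor.tmap (fun i => T.unitAt (D.graph.hom (f.toHom.obj (p.pt i.castSucc))
            (f.toHom.obj (p.pt i.succ)))) ≫ c.comp D (p.image f.toHom.obj)
        rw [Category.assoc, h, E.tensor.tmap_comp_assoc, E.tensor.tmap_comp_assoc]
        simp only [T.unitAt_naturality] }

section

variable (D : MultitensorCat.{v, max u v, w} c.actions.lifting.lift)

/-- The compositions of a category enriched in the lifted multitensor, as maps in `V`. -/
def liftedComp {a b : D.graph.carrier} (p : Chain a b) :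
    ((E.tensor p.len).obj fun i => (D.graph.homs p i).A) ⟶ (D.graph.hom a b).A :=
  (D.κ p).f

theorem unit_liftedComp (a b : D.graph.carrier) :
    E.str.unit (fun i => (D.graph.homs (Chain.pair a b) i).A) ≫ c.liftedComp D (Chain.pair a b) =
      𝟙 (D.graph.hom a b).A :=
  congrArg Monad.Algebra.Hom.f (D.unit_κ a b)

theorem sub_liftedComp {a b : D.graph.carrier} (p : Chain a b) {k : ℕ}
    (d : Subdivision p.len k) : E.str.sub d (fun i => (D.graph.homs p i).A) ≫ c.liftedComp D p =
      E.tensor.tmap (fun i => c.liftedComp D (p.block d i)) ≫ c.liftedComp D (p.coarse d) :=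
  congrArg Monad.Algebra.Hom.f (D.sub_κ p d)

theorem map_liftedComp {a b : D.graph.carrier} (p : Chain a b) :
    T.map (c.liftedComp D p) ≫ (D.graph.hom a b).a =
      (c.τ (fun i => (D.graph.homs p i).A) ≫
        E.tensor.tmap fun i => (D.graph.homs p i).a) ≫ c.liftedComp D p :=
  (D.κ p).h

/-- The compositions over the composite multitensor, for a category enriched in the lifted one. -/
def outerComp {a b : D.graph.carrier} (p : Chain a b) :
    (E.tensor p.len).obj (fun i => T.obj (D.graph.homs p i).A) ⟶ (D.graph.hom a b).A :=
  E.tensor.tmap (fun i => (D.graph.homs p i).a) ≫ c.liftedComp D p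

/-- Shows that the action recovered from sequences of length one is the given algebra structure. -/
theorem unit_outerComp (a b : D.graph.carrier) :
    E.str.unit (fun i => T.obj (D.graph.homs (Chain.pair a b) i).A) ≫
      c.outerComp D (Chain.pair a b) = (D.graph.hom a b).a := by
  rw [outerComp, ← Category.assoc, ← E.str.unit_naturality, Category.assoc, unit_liftedComp]
  exact Category.comp_id _

theorem map_outerComp {a b : D.graph.carrier} (p : Chain a b) :
    T.map (c.outerComp D p) ≫ (D.graph.hom a b).a =
      (c.τ (fun i => T.obj (D.graph.homs p i).A) ≫
        E.tensor.tmap fun i => T.map (D.graph.homs p i).a ≫ (D.graph.homs p i).a) ≫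
          c.liftedComp D p := by
  rw [outerComp, T.map_comp, Category.assoc, map_liftedComp, ← Category.assoc, ← Category.assoc,
    c.naturality, Category.assoc (c.τ _), E.tensor.tmap_comp]

/-- The associativity of the algebras trades `μ` for `T` of the structure maps, which naturality of
`σ` moves into the blocks. There the compositions are algebra morphisms, in the form of
`map_outerComp`. -/
theorem sub_outerComp {a b : D.graph.carrier} (p : Chain a b) {k : ℕ} (d : Subdivision p.len k) :
    c.compSub d (fun s => (D.graph.homs p s).A) ≫ c.outerComp D p =
      E.tensor.tmap (fun i => T.map (c.outerComp D (p.block d i))) ≫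
        c.outerComp D (p.coarse d) := by
  rw [outerComp, compSub, Category.assoc, Category.assoc, E.tensor.tmap_comp_assoc]
  simp only [Monad.Algebra.mulAt_a]
  rw [← E.str.sub_naturality_assoc d fun s => T.map (D.graph.homs p s).a ≫ (D.graph.homs p s).a,
    sub_liftedComp]
  refine (congrArg (E.tensor.tmap _ ≫ ·) (E.tensor.tmap_comp_assoc _ _ _)).trans ?_
  refine (E.tensor.tmap_comp_assoc _ _ _).trans ?_
  refine Eq.trans ?_ (E.tensor.tmap_comp_assoc _ _ _).symm
  exact congrArg (· ≫ c.liftedComp D (p.coarse d)) (E.tensor.tmap_congr fun i =>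
    ((c.map_outerComp D (p.block d i)).trans (Category.assoc _ _ _)).symm)

/-- The category enriched in the composite multitensor determined by one enriched in the lifted
multitensor. -/
def ofLifted : MultitensorCat.{v, u, w} c.composite.multitensor where
  graph := ⟨D.graph.carrier, fun a b => (D.graph.hom a b).A⟩
  κ p := c.outerComp D p
  unit_κ a b := (Category.assoc _ _ _).trans
    ((congrArg (T.unitAt _ ≫ ·) (c.unit_outerComp D a b)).trans (D.graph.hom a b).unit)
  sub_κ p _ d := c.sub_outerComp D p d

end

/-- Categories enriched in the lifted multitensor are categories enriched in the composite one. -/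
def ofLiftedFunctor : MultitensorCat.{v, max u v, w} c.actions.lifting.lift ⥤
    MultitensorCat.{v, u, w} c.composite.multitensor where
  obj D := c.ofLifted D
  map {C D} f :=
    { toHom := ⟨f.toHom.obj, fun a b => (f.toHom.map a b).f⟩
      κ_map := fun {a b} p => by
        have h : c.liftedComp C p ≫ (f.toHom.map a b).f = E.tensor.tmap (fun i =>
          (f.toHom.map (p.pt i.castSucc) (p.pt i.succ)).f) ≫
            c.liftedComp D (p.image f.toHom.obj) := congrArg Monad.Algebra.Hom.f (f.κ_map p)
        change (E.tensor.tmap (fun i => (C.graph.homs p i).a) ≫ c.liftedComp C p) ≫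
          (f.toHom.map a b).f = E.tensor.tmap (fun i =>
            T.map (f.toHom.map (p.pt i.castSucc) (p.pt i.succ)).f) ≫
          E.tensor.tmap (fun i => (D.graph.hom (f.toHom.obj (p.pt i.castSucc))
            (f.toHom.obj (p.pt i.succ))).a) ≫ c.liftedComp D (p.image f.toHom.obj)
        rw [Category.assoc, h, E.tensor.tmap_comp_assoc, E.tensor.tmap_comp_assoc]
        simp only [Monad.Algebra.Hom.h] }

theorem toLifted_ofLifted (D : MultitensorCat.{v, max u v, w} c.actions.lifting.lift) :
    c.toLifted (c.ofLifted D) = D := by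
  have h1 : ∀ a b, c.homAct (c.ofLifted D) a b = (D.graph.hom a b).a := c.unit_outerComp D
  have h2 : ∀ {a b : D.graph.carrier} (p : Chain a b),
      c.innerComp (c.ofLifted D) p = c.liftedComp D p := by
    intro a b p
    refine (Category.assoc _ _ _).symm.trans ?_
    refine (congrArg (· ≫ c.liftedComp D p) (E.tensor.tmap_comp _ _)).trans ?_
    refine (congrArg (· ≫ c.liftedComp D p) (E.tensor.tmap_congr fun i =>
      (D.graph.homs p i).unitAt_a)).trans ?_
    exact (congrArg (· ≫ c.liftedComp D p) (E.tensor.tmap_id _)).trans (Category.id_comp _)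
  exact MultitensorCat.mk_eq_of_f (funext fun a => funext fun b =>
    Monad.Algebra.eq_of_a _ _ _ (h1 a b)) _ _ D.unit_κ D.sub_κ fun p => heq_of_eq (h2 p)

theorem ofLifted_toLifted (C : MultitensorCat.{v, u, w} c.composite.multitensor) :
    c.ofLifted (c.toLifted C) = C := by
  refine MultitensorCat.ext_κ rfl (heq_of_eq ?_)
  funext a b p
  exact c.homAct_innerComp C p

theorem toLiftedFunctor_comp_ofLiftedFunctor :
    c.toLiftedFunctor ⋙ c.ofLiftedFunctor = 𝟭 (MultitensorCat.{v, u, w} c.composite.multitensor) :=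
  Functor.eq_of_comp_faithful (MultitensorCat.forget _) (fun C => c.ofLifted_toLifted C) rfl

theorem ofLiftedFunctor_comp_toLiftedFunctor : c.ofLiftedFunctor ⋙ c.toLiftedFunctor =
    𝟭 (MultitensorCat.{v, max u v, w} c.actions.lifting.lift) :=
  -- Both functors leave the underlying maps in `V` unchanged, so after this faithful functor the
  -- equality holds by definition.
  Functor.eq_of_comp_faithful (MultitensorCat.forget _ ⋙ EnrichedGraph.mapFunctor T.forget)
    (fun D => c.toLifted_ofLifted D) rfl

theorem toLiftedFunctor_forget : c.toLiftedFunctor ⋙ MultitensorCat.forget _ ⋙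
    EnrichedGraph.mapFunctor T.forget = MultitensorCat.forget.{v, u, w} c.composite.multitensor :=
  rfl

end OpmonoidalCoherence

end

end MultitensorLaw

/-! ### Sequences as graphs -/

namespace MultitensorLaw

namespace Chain

/-- The sequence of all positions. -/
abbrev standard (n : ℕ) : Chain (S := ULift.{w} (Fin (n + 1))) ⟨0⟩ ⟨Fin.last n⟩ where
  len := n
  pt := ULift.up
  pt_zero := rfl
  pt_last := rfl

/-- The gaps of a sequence of positions which begin at one given position and end at another:
there is at most one of them. -/
abbrev Step {n : ℕ} (i j : ULift.{w} (Fin (n + 1))) : Type w :=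
  ULift.{w} { s : Fin n // s.castSucc = i.down ∧ s.succ = j.down }

/-- The gap after a given position. -/
abbrev step {n : ℕ} (s : Fin n) :
    Step.{w} ((standard n).pt s.castSucc) ((standard n).pt s.succ) :=
  ⟨s, rfl, rfl⟩

/-- Each step raises the position by exactly one, so the `j`-th point is `j`, and the prescribed end
point fixes the length. Hence a single summand of `Γ(E)` of a graph of gaps survives. -/
theorem eq_standard {n : ℕ}
    (y : Σ p : Chain (S := ULift.{w} (Fin (n + 1))) ⟨0⟩ ⟨Fin.last n⟩,
      ∀ i : Fin p.len, Step.{w} (p.pt i.castSucc) (p.pt i.succ)) :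
    y = ⟨standard n, fun s => step s⟩ := by
  obtain ⟨⟨m, f, h0, hl⟩, z⟩ := y
  have h1 : ∀ j : Fin (m + 1), ((f j).down : ℕ) = j := by
    intro j
    induction j using Fin.induction with
    | zero => rw [h0]; rfl
    | succ i ih =>
      have h2 := (z i).down.2
      have h3 := congrArg Fin.val h2.1
      have h4 := congrArg Fin.val h2.2
      simp only [Fin.val_castSucc, Fin.val_succ] at h3 h4 ih ⊢
      omega
  have h2 := h1 (Fin.last m)
  rw [hl] at h2
  obtain rfl : n = m := h2
  obtain rfl : f = ULift.up := funext fun j => ULift.ext _ _ (Fin.ext (h1 j))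
  congr 1
  funext i
  exact ULift.ext _ _ (Subtype.ext (Fin.castSucc_injective _ (z i).down.2.1))

end Chain

section

variable {V : Type u} [Category.{v} V]

theorem IsCoprod.isIso_of_unique {J : Type w} {A : J → V} {C : V} {inj : ∀ j, A j ⟶ C}
    (hc : IsCoprod inj) (j₀ : J) (h : ∀ j, j = j₀) : IsIso (inj j₀) := by
  obtain ⟨r, hr, _⟩ := hc (A j₀) fun j => eqToHom (congrArg A (h j))
  have h1 : inj j₀ ≫ r = 𝟙 _ := hr j₀
  refine ⟨r, h1, hc.hom_ext fun j => ?_⟩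
  obtain rfl := h j
  rw [← Category.assoc, h1, Category.id_comp, Category.comp_id]

variable [HasCoproducts.{w} V] {E : Multitensor V}

/-- Distributivity expands the hom into a coproduct indexed by the chains with a gap chosen over
each of their steps, and `eq_standard` says that there is only one such index. The homs `Y` are
arbitrary coproducts over gaps, so that the result is available after `T` has been applied to them.
-/
theorem Gamma.isIso_tmap_inj (hE : Multitensor.IsDistributive.{v, u, w} E) {n : ℕ} {A : Fin n → V}
    {Y : ULift.{w} (Fin (n + 1)) → ULift.{w} (Fin (n + 1)) → V}
    (q : ∀ i j (x : Chain.Step.{w} i j), A x.down.1 ⟶ Y i j) (hq : ∀ i j, IsCoprod (q i j)) :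
    IsIso (E.tensor.tmap (fun s => q _ _ (Chain.step.{w} s)) ≫
      Gamma.inj E (⟨_, Y⟩ : EnrichedGraph.{v, u, w} V) (Chain.standard n)) :=
  ((Gamma.isCoprod_inj E (⟨_, Y⟩ : EnrichedGraph.{v, u, w} V) ⟨0⟩ ⟨Fin.last n⟩).trans fun p =>
    isCoprod_multi (E.tensor p.len) (preservesInEach_of_slot _ (hE p.len))
      (fun (i : Fin p.len) (x : Chain.Step (p.pt i.castSucc) (p.pt i.succ)) => q _ _ x)
      fun _ => hq _ _).isIso_of_unique ⟨Chain.standard n, fun s => Chain.step s⟩ Chain.eq_standard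

/-- A graph on the positions of a sequence, whose homs between consecutive positions are the entries
of the sequence, and whose other homs are initial. -/
noncomputable def seqGraph {n : ℕ} (X : Fin n → V) : EnrichedGraph.{v, u, w} V where
  carrier := ULift.{w} (Fin (n + 1))
  hom i j := ∐ fun x : Chain.Step.{w} i j => X x.down.1

/-- The inclusion of an entry of a sequence as a hom. -/
noncomputable def seqGraph.incl {n : ℕ} (X : Fin n → V) {i j : ULift.{w} (Fin (n + 1))}
    (x : Chain.Step.{w} i j) : X x.down.1 ⟶ (seqGraph.{v, u, w} X).hom i j :=
  Sigma.ι (fun x : Chain.Step.{w} i j => X x.down.1) x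

theorem seqGraph.isCoprod_incl {n : ℕ} (X : Fin n → V) (i j : ULift.{w} (Fin (n + 1))) :
    IsCoprod fun x : Chain.Step.{w} i j => seqGraph.incl X x :=
  IsCoprod.sigma _

/-- Morphisms of graphs out of `seqGraph X`. -/
noncomputable def seqGraph.desc {n : ℕ} {X : Fin n → V} {Y : EnrichedGraph.{v, u, w} V}
    (pt : Fin (n + 1) → Y.carrier) (f : ∀ s : Fin n, X s ⟶ Y.hom (pt s.castSucc) (pt s.succ)) :
    seqGraph.{v, u, w} X ⟶ Y where
  obj i := pt i.down
  map _ _ := Sigma.desc fun x => f x.down.1 ≫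
    eqToHom (congrArg₂ (fun a b => Y.hom (pt a) (pt b)) x.down.2.1 x.down.2.2)

theorem seqGraph.incl_desc {n : ℕ} {X : Fin n → V} {Y : EnrichedGraph.{v, u, w} V}
    (pt : Fin (n + 1) → Y.carrier) (f : ∀ s : Fin n, X s ⟶ Y.hom (pt s.castSucc) (pt s.succ))
    (s : Fin n) : seqGraph.incl X (Chain.step.{w} s) ≫ (seqGraph.desc pt f).map _ _ = f s :=
  (Sigma.ι_desc _ _).trans (Category.comp_id _)

end

end MultitensorLaw

/-! ### From coherence maps to distributive laws -/

namespace MultitensorLaw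

section

variable {V : Type u} [Category.{v} V]

/-- The graph obtained by applying a monad to all homs. -/
abbrev EnrichedGraph.mapGraph (T : Monad V) (X : EnrichedGraph.{v, u, w} V) :
    EnrichedGraph.{v, u, w} V :=
  ⟨X.carrier, fun a b => T.obj (X.hom a b)⟩

/-- The morphism of graphs obtained by applying a monad to all hom maps. -/
abbrev EnrichedGraph.mapGraphHom (T : Monad V) {X Y : EnrichedGraph.{v, u, w} V} (f : X ⟶ Y) :
    X.mapGraph T ⟶ Y.mapGraph T :=
  ⟨f.obj, fun a b => T.map (f.map a b)⟩

namespace OpmonoidalCoherence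

variable [HasCoproducts.{w} V] {E : Multitensor V} {T : Monad V} (c : OpmonoidalCoherence E T)
  (hT : ∀ J : Type w, PreservesColimitsOfShape (Discrete J) T.toFunctor)

/-- The hom maps of the distributive law determined by coherence maps. -/
noncomputable def lawHom (X : EnrichedGraph.{v, u, w} V) (a b : X.carrier) :
    T.obj ((Gamma.onObj E X).hom a b) ⟶ (Gamma.onObj E (X.mapGraph T)).hom a b :=
  haveI := hT (Chain a b)
  ((Gamma.isCoprod_inj E X a b).map T.toFunctor _ fun p =>
    c.τ (X.homs p) ≫ Gamma.inj E (X.mapGraph T) p).choose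

theorem map_inj_lawHom (X : EnrichedGraph.{v, u, w} V) {a b : X.carrier} (p : Chain a b) :
    T.map (Gamma.inj E X p) ≫ c.lawHom hT X a b =
      c.τ (X.homs p) ≫ Gamma.inj E (X.mapGraph T) p :=
  haveI := hT (Chain a b)
  ((Gamma.isCoprod_inj E X a b).map T.toFunctor _ fun p =>
    c.τ (X.homs p) ≫ Gamma.inj E (X.mapGraph T) p).choose_spec.1 p

theorem map_tmap_inj_lawHom (X : EnrichedGraph.{v, u, w} V) {a b : X.carrier} (p : Chain a b)
    {Z : Fin p.len → V} (f : ∀ i, Z i ⟶ X.homs p i) :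
    T.map (E.tensor.tmap f ≫ Gamma.inj E X p) ≫ c.lawHom hT X a b =
      c.τ Z ≫ E.tensor.tmap (fun i => T.map (f i)) ≫ Gamma.inj E (X.mapGraph T) p := by
  rw [T.map_comp, Category.assoc, c.map_inj_lawHom hT X p, ← Category.assoc, c.naturality,
    Category.assoc]

/-- Since `T` preserves the coproducts in `Γ(E)`, the equation can be tested on `T` of the summands,
where it is naturality of `τ`. -/
theorem lawHom_naturality {X Y : EnrichedGraph.{v, u, w} V} (f : X ⟶ Y) (a b : X.carrier) :
    T.map ((Gamma.onMap E f).map a b) ≫ c.lawHom hT Y (f.obj a) (f.obj b) =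
      c.lawHom hT X a b ≫ (Gamma.onMap E (EnrichedGraph.mapGraphHom T f)).map a b := by
  have := hT (Chain a b)
  refine ((Gamma.isCoprod_inj E X a b).map T.toFunctor).hom_ext fun p => ?_
  refine (Category.assoc _ _ _).symm.trans (Eq.trans ?_ (Category.assoc _ _ _))
  refine (congrArg (· ≫ c.lawHom hT Y (f.obj a) (f.obj b)) ((T.map_comp _ _).symm.trans
    (congrArg T.map (Gamma.inj_onMap E f p)))).trans ?_
  refine (c.map_tmap_inj_lawHom hT Y (p.image f.obj) _).trans ?_
  refine Eq.trans ?_ (congrArg (· ≫ (Gamma.onMap E (EnrichedGraph.mapGraphHom T f)).map a b)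
    (c.map_inj_lawHom hT X p)).symm
  refine Eq.trans ?_ (Category.assoc _ _ _).symm
  exact congrArg (c.τ (X.homs p) ≫ ·)
    (Gamma.inj_onMap E (EnrichedGraph.mapGraphHom T f) p).symm

theorem map_unitHom_lawHom (X : EnrichedGraph.{v, u, w} V) (a b : X.carrier) :
    T.map (Gamma.unitHom E X a b) ≫ c.lawHom hT X a b = Gamma.unitHom E (X.mapGraph T) a b := by
  refine (congrArg (· ≫ c.lawHom hT X a b) (T.map_comp _ _)).trans ?_
  refine (Category.assoc _ _ _).trans ?_
  refine (congrArg (T.map (E.str.unit _) ≫ ·) (c.map_inj_lawHom hT X (Chain.pair a b))).trans ?_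
  exact (Category.assoc _ _ _).symm.trans (congrArg (· ≫ Gamma.inj E (X.mapGraph T)
    (Chain.pair a b)) (c.unit_τ (X.homs (Chain.pair a b))))

theorem unitAt_lawHom (X : EnrichedGraph.{v, u, w} V) (a b : X.carrier) :
    T.unitAt ((Gamma.onObj E X).hom a b) ≫ c.lawHom hT X a b =
      (Gamma.onMap E (Y := X.mapGraph T)
        (EnrichedGraph.Hom.ofHoms fun a b => T.unitAt (X.hom a b))).map a b := by
  refine (Gamma.isCoprod_inj E X a b).hom_ext fun p => ?_
  refine Eq.trans ?_ (Gamma.inj_onMap E (Y := X.mapGraph T)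
        (EnrichedGraph.Hom.ofHoms fun a b => T.unitAt (X.hom a b)) p).symm
  rw [← Category.assoc, T.unitAt_naturality, Category.assoc, c.map_inj_lawHom hT X p,
    ← Category.assoc, c.unitAt_τ]
  rfl

/-- Preservation of coproducts is used twice, to test the equation on `T T` of the summands, where
it becomes `μ_τ`. -/
theorem mulAt_lawHom (X : EnrichedGraph.{v, u, w} V) (a b : X.carrier) :
    T.mulAt ((Gamma.onObj E X).hom a b) ≫ c.lawHom hT X a b =
      T.map (c.lawHom hT X a b) ≫ c.lawHom hT (X.mapGraph T) a b ≫
        (Gamma.onMap E (X := (X.mapGraph T).mapGraph T) (Y := X.mapGraph T)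
          (EnrichedGraph.Hom.ofHoms fun a b => T.mulAt (X.hom a b))).map a b := by
  have := hT (Chain a b)
  refine (((Gamma.isCoprod_inj E X a b).map T.toFunctor).map T.toFunctor).hom_ext fun p => ?_
  have h1 : T.map (T.map (Gamma.inj E X p)) ≫ T.map (c.lawHom hT X a b) ≫
      c.lawHom hT (X.mapGraph T) a b = T.map (c.τ (X.homs p)) ≫
        c.τ (fun i => T.obj (X.homs p i)) ≫ Gamma.inj E ((X.mapGraph T).mapGraph T) p := by
    refine (Category.assoc _ _ _).symm.trans ?_
    refine (congrArg (· ≫ c.lawHom hT (X.mapGraph T) a b) ((T.map_comp _ _).symm.trans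
      ((congrArg T.map (c.map_inj_lawHom hT X p)).trans (T.map_comp _ _)))).trans ?_
    refine (Category.assoc _ _ _).trans ?_
    exact congrArg (T.map _ ≫ ·) (c.map_inj_lawHom hT (X.mapGraph T) p)
  have h2 := Gamma.inj_onMap E (X := (X.mapGraph T).mapGraph T) (Y := X.mapGraph T)
    (EnrichedGraph.Hom.ofHoms fun a b => T.mulAt (X.hom a b)) p
  refine (Category.assoc _ _ _).symm.trans ?_
  refine (congrArg (· ≫ c.lawHom hT X a b) (T.mulAt_naturality (Gamma.inj E X p))).trans ?_
  refine (Category.assoc _ _ _).trans ?_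
  refine (congrArg (T.mulAt _ ≫ ·) (c.map_inj_lawHom hT X p)).trans ?_
  refine (Category.assoc _ _ _).symm.trans ?_
  refine (congrArg (· ≫ Gamma.inj E (X.mapGraph T) p) (c.mulAt_τ (X.homs p))).trans ?_
  refine (Category.assoc _ _ _).trans ?_
  refine (congrArg (T.map (c.τ (X.homs p)) ≫ ·) (Category.assoc _ _ _)).trans ?_
  refine (congrArg (fun q => T.map (c.τ (X.homs p)) ≫ c.τ (fun i => T.obj (X.homs p i)) ≫ q)
    h2.symm).trans ?_
  refine Eq.trans ?_ (congrArg (T.map (T.map (Gamma.inj E X p)) ≫ ·) (Category.assoc _ _ _))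
  refine Eq.trans ?_ (Category.assoc _ _ _)
  refine Eq.trans ?_ (congrArg (· ≫ (Gamma.onMap E (X := (X.mapGraph T).mapGraph T)
    (Y := X.mapGraph T) (EnrichedGraph.Hom.ofHoms fun a b => T.mulAt (X.hom a b))).map a b)
      h1).symm
  refine Eq.trans ?_ (Category.assoc _ _ _).symm
  exact congrArg (T.map (c.τ (X.homs p)) ≫ ·) (Category.assoc _ _ _).symm

/-- A hom of `Γ(E)(Γ(E)(X))` is a coproduct over subdivided sequences, and `T` preserves it. On each
summand the equation is `sub_τ` for the subdivision. -/
theorem map_mulHom_lawHom (hE : Multitensor.IsDistributive.{v, u, w} E)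
    (X : EnrichedGraph.{v, u, w} V) (a b : X.carrier) :
    T.map (Gamma.mulHom hE X a b) ≫ c.lawHom hT X a b =
      c.lawHom hT (Gamma.onObj E X) a b ≫
        (Gamma.onMap E (X := (Gamma.onObj E X).mapGraph T) (Y := Gamma.onObj E (X.mapGraph T))
          (EnrichedGraph.Hom.ofHoms (c.lawHom hT X))).map a b ≫
            Gamma.mulHom hE (X.mapGraph T) a b := by
  have := hT (Chain.Divided a b)
  refine ((Gamma.isCoprod_inj₂ hE X a b).map T.toFunctor).hom_ext fun ⟨p, k, d⟩ => ?_
  have h1 : T.map (Gamma.inj₂ E X p d) ≫ T.map (Gamma.mulHom hE X a b) ≫ c.lawHom hT X a b =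
      T.map (E.str.sub d (X.homs p)) ≫ c.τ (X.homs p) ≫ Gamma.inj E (X.mapGraph T) p := by
    refine (Category.assoc _ _ _).symm.trans ?_
    refine (congrArg (· ≫ c.lawHom hT X a b) ((T.map_comp _ _).symm.trans
      ((congrArg T.map (Gamma.inj₂_mul hE X p d)).trans (T.map_comp _ _)))).trans ?_
    exact (Category.assoc _ _ _).trans (congrArg (T.map _ ≫ ·) (c.map_inj_lawHom hT X p))
  have h2 := c.map_tmap_inj_lawHom hT (Gamma.onObj E X) (p.coarse d)
    fun i => Gamma.inj E X (p.block d i)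
  have h3 := Gamma.inj_onMap E (X := (Gamma.onObj E X).mapGraph T)
    (Y := Gamma.onObj E (X.mapGraph T)) (EnrichedGraph.Hom.ofHoms (c.lawHom hT X)) (p.coarse d)
  have h4 : E.tensor.tmap (fun i => T.map (Gamma.inj E X (p.block d i))) ≫
      E.tensor.tmap (fun i => c.lawHom hT X (p.pt (d.cut i.castSucc)) (p.pt (d.cut i.succ))) =
    E.tensor.tmap (fun i => c.τ (X.homs (p.block d i))) ≫
      E.tensor.tmap fun i => Gamma.inj E (X.mapGraph T) (p.block d i) :=
    (E.tensor.tmap_comp _ _).trans ((E.tensor.tmap_congr fun i =>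
      c.map_inj_lawHom hT X (p.block d i)).trans (E.tensor.tmap_comp _ _).symm)
  have h5 := Gamma.inj₂_mul hE (X.mapGraph T) p d
  have h6 := c.sub_τ d (X.homs p)
  refine h1.trans ?_
  refine (Category.assoc _ _ _).symm.trans ?_
  refine (congrArg (· ≫ Gamma.inj E (X.mapGraph T) p) h6).trans ?_
  refine (Category.assoc _ _ _).trans ?_
  refine (congrArg (c.τ _ ≫ ·) (Category.assoc _ _ _)).trans ?_
  refine (congrArg (fun q => c.τ (fun i => (E.tensor (d.len i)).obj fun j =>
    X.homs p (d.index i j)) ≫ E.tensor.tmap (fun i => c.τ (X.homs (p.block d i))) ≫ q)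
      h5.symm).trans ?_
  refine Eq.trans ?_ (Category.assoc _ _ _)
  refine Eq.trans ?_ (congrArg (· ≫ (Gamma.onMap E (X := (Gamma.onObj E X).mapGraph T)
    (Y := Gamma.onObj E (X.mapGraph T)) (EnrichedGraph.Hom.ofHoms (c.lawHom hT X))).map a b ≫
      Gamma.mulHom hE (X.mapGraph T) a b) h2).symm
  refine Eq.trans ?_ (Category.assoc _ _ _).symm
  refine congrArg (c.τ _ ≫ ·) ?_
  refine Eq.trans ?_ (Category.assoc _ _ _).symm
  refine Eq.trans ?_ (congrArg (E.tensor.tmap _ ≫ ·) (Category.assoc _ _ _))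
  refine Eq.trans ?_ (congrArg (fun q => E.tensor.tmap
    (fun i => T.map (Gamma.inj E X (p.block d i))) ≫ q ≫ Gamma.mulHom hE (X.mapGraph T) a b)
      h3).symm
  refine Eq.trans ?_ (congrArg (E.tensor.tmap _ ≫ ·) (Category.assoc _ _ _).symm)
  refine Eq.trans ?_ (Category.assoc _ _ _)
  refine Eq.trans ?_ (congrArg (· ≫ Gamma.inj E (Gamma.onObj E (X.mapGraph T)) (p.coarse d) ≫
    Gamma.mulHom hE (X.mapGraph T) a b) h4).symm
  refine Eq.trans ?_ (Category.assoc _ _ _).symm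
  exact congrArg (E.tensor.tmap _ ≫ ·) (Category.assoc _ _ _)

/-- The distributive law determined by coherence maps. -/
noncomputable def graphLaw (hE : Multitensor.IsDistributive.{v, u, w} E) :
    GraphDistributiveLaw hE T where
  val :=
    { law :=
        { app := fun X => EnrichedGraph.Hom.ofHoms (c.lawHom hT X)
          naturality := fun _ _ f => EnrichedGraph.Hom.ext rfl (heq_of_eq
            (funext fun a => funext fun b => c.lawHom_naturality hT f a b)) }
      map_η_law := fun X => EnrichedGraph.Hom.ext rfl (heq_of_eq
        (funext fun a => funext fun b => c.map_unitHom_lawHom hT X a b))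
      η_law := fun X => EnrichedGraph.Hom.ext rfl (heq_of_eq
        (funext fun a => funext fun b => c.unitAt_lawHom hT X a b))
      map_μ_law := fun X => EnrichedGraph.Hom.ext rfl (heq_of_eq
        (funext fun a => funext fun b => c.map_mulHom_lawHom hT hE X a b))
      μ_law := fun X => EnrichedGraph.Hom.ext rfl (heq_of_eq
        (funext fun a => funext fun b => c.mulAt_lawHom hT X a b)) }
  property _ _ := rfl

end OpmonoidalCoherence

end

end MultitensorLaw

/-! ### From distributive laws to coherence maps -/

namespace MultitensorLaw

section

variable {V : Type u} [Category.{v} V]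

namespace EnrichedGraph

theorem Hom.eq_ofHoms {S : Type w} {X Y : S → S → V}
    (f : (⟨S, X⟩ : EnrichedGraph.{v, u, w} V) ⟶ ⟨S, Y⟩) (hf : ∀ a, f.obj a = a) :
    ∃ h, f = Hom.ofHoms h := by
  obtain ⟨o, m⟩ := f
  obtain rfl : o = fun a => a := funext hf
  exact ⟨m, rfl⟩

theorem Hom.map_eq {X Y : EnrichedGraph.{v, u, w} V} {o : X.carrier → Y.carrier}
    {m m' : ∀ a b, X.hom a b ⟶ Y.hom (o a) (o b)} (h : (⟨o, m⟩ : Hom X Y) = ⟨o, m'⟩)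
    (a b : X.carrier) : m a b = m' a b := by
  cases h
  rfl

end EnrichedGraph

variable [HasCoproducts.{w} V] {E : Multitensor V} {T : Monad V}

namespace GraphDistributiveLaw

variable {hE : Multitensor.IsDistributive.{v, u, w} E} (L : GraphDistributiveLaw hE T)

/-- The components of the law are identities on objects only propositionally, so maps between the
expected homs are obtained after substituting that equality. -/
theorem exists_homs (X : EnrichedGraph.{v, u, w} V) :
    ∃ h : ∀ a b : X.carrier, T.obj ((Gamma.onObj E X).hom a b) ⟶
      (Gamma.onObj E (X.mapGraph T)).hom a b, L.1.law.app X = EnrichedGraph.Hom.ofHoms h :=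
  EnrichedGraph.Hom.eq_ofHoms (L.1.law.app X) (L.2 X)

/-- The hom maps of the distributive law. -/
noncomputable def homMap (X : EnrichedGraph.{v, u, w} V) (a b : X.carrier) :
    T.obj ((Gamma.onObj E X).hom a b) ⟶ (Gamma.onObj E (X.mapGraph T)).hom a b :=
  (L.exists_homs X).choose a b

theorem app_eq (X : EnrichedGraph.{v, u, w} V) :
    L.1.law.app X = EnrichedGraph.Hom.ofHoms (L.homMap X) :=
  (L.exists_homs X).choose_spec

theorem homMap_eq {X : EnrichedGraph.{v, u, w} V} {h : ∀ a b : X.carrier,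
    T.obj ((Gamma.onObj E X).hom a b) ⟶ (Gamma.onObj E (X.mapGraph T)).hom a b}
    (hh : L.1.law.app X = EnrichedGraph.Hom.ofHoms h) (a b : X.carrier) :
    L.homMap X a b = h a b :=
  EnrichedGraph.Hom.map_eq ((L.app_eq X).symm.trans hh) a b

theorem homMap_naturality {X Y : EnrichedGraph.{v, u, w} V} (f : X ⟶ Y) (a b : X.carrier) :
    T.map ((Gamma.onMap E f).map a b) ≫ L.homMap Y (f.obj a) (f.obj b) =
      L.homMap X a b ≫ (Gamma.onMap E (EnrichedGraph.mapGraphHom T f)).map a b := by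
  have h := L.1.law.naturality f
  rw [app_eq, app_eq] at h
  exact EnrichedGraph.Hom.map_eq h a b

theorem map_unitHom_homMap (X : EnrichedGraph.{v, u, w} V) (a b : X.carrier) :
    T.map (Gamma.unitHom E X a b) ≫ L.homMap X a b = Gamma.unitHom E (X.mapGraph T) a b := by
  have h := L.1.map_η_law X
  rw [app_eq] at h
  exact EnrichedGraph.Hom.map_eq h a b

theorem unitAt_homMap (X : EnrichedGraph.{v, u, w} V) (a b : X.carrier) :
    T.unitAt ((Gamma.onObj E X).hom a b) ≫ L.homMap X a b =
      (Gamma.onMap E (Y := X.mapGraph T)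
        (EnrichedGraph.Hom.ofHoms fun a b => T.unitAt (X.hom a b))).map a b := by
  have h := L.1.η_law X
  rw [app_eq] at h
  exact EnrichedGraph.Hom.map_eq h a b

theorem mulAt_homMap (X : EnrichedGraph.{v, u, w} V) (a b : X.carrier) :
    T.mulAt ((Gamma.onObj E X).hom a b) ≫ L.homMap X a b =
      T.map (L.homMap X a b) ≫ L.homMap (X.mapGraph T) a b ≫
        (Gamma.onMap E (X := (X.mapGraph T).mapGraph T) (Y := X.mapGraph T)
          (EnrichedGraph.Hom.ofHoms fun a b => T.mulAt (X.hom a b))).map a b := by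
  have h := L.1.μ_law X
  rw [app_eq, app_eq] at h
  exact EnrichedGraph.Hom.map_eq h a b

theorem map_mulHom_homMap (X : EnrichedGraph.{v, u, w} V) (a b : X.carrier) :
    T.map (Gamma.mulHom hE X a b) ≫ L.homMap X a b =
      L.homMap (Gamma.onObj E X) a b ≫
        (Gamma.onMap E (X := (Gamma.onObj E X).mapGraph T) (Y := Gamma.onObj E (X.mapGraph T))
          (EnrichedGraph.Hom.ofHoms (L.homMap X))).map a b ≫
            Gamma.mulHom hE (X.mapGraph T) a b := by
  have h := L.1.map_μ_law X
  rw [app_eq, app_eq] at h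
  exact EnrichedGraph.Hom.map_eq h a b

end GraphDistributiveLaw

/-- The inclusion of `E X` as a hom of `Γ(E)` of the graph `seqGraph X`. -/
noncomputable def seqIncl (E : Multitensor V) {n : ℕ} (X : Fin n → V) :
    (E.tensor n).obj X ⟶ (Gamma.onObj E (seqGraph.{v, u, w} X)).hom ⟨0⟩ ⟨Fin.last n⟩ :=
  E.tensor.tmap (fun s => seqGraph.incl X (Chain.step.{w} s)) ≫
    Gamma.inj E (seqGraph.{v, u, w} X) (Chain.standard n)

/-- The inclusion of `E T X` as a hom of `Γ(E)` of the graph obtained by applying `T` to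
`seqGraph X`. -/
noncomputable def seqInclMap (E : Multitensor V) (T : Monad V) {n : ℕ} (X : Fin n → V) :
    (E.tensor n).obj (fun i => T.obj (X i)) ⟶
      (Gamma.onObj E ((seqGraph.{v, u, w} X).mapGraph T)).hom ⟨0⟩ ⟨Fin.last n⟩ :=
  E.tensor.tmap (fun s => T.map (seqGraph.incl X (Chain.step.{w} s))) ≫
    Gamma.inj E ((seqGraph.{v, u, w} X).mapGraph T) (Chain.standard n)

/-- The homs of `seqGraph X` are coproducts over gaps, and remain so under `T`. -/
theorem isIso_seqInclMap (hE : Multitensor.IsDistributive.{v, u, w} E)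
    (hT : ∀ J : Type w, PreservesColimitsOfShape (Discrete J) T.toFunctor) {n : ℕ}
    (X : Fin n → V) : IsIso (seqInclMap.{v, u, w} E T X) :=
  Gamma.isIso_tmap_inj hE (A := fun i => T.obj (X i))
    (Y := fun i j => T.obj ((seqGraph.{v, u, w} X).hom i j))
    (fun _ _ x => T.map (seqGraph.incl X x)) fun i j => by
    have := hT (Chain.Step.{w} i j)
    exact (seqGraph.isCoprod_incl X i j).map T.toFunctor

/-- Every map from `E X` into a summand of `Γ(E)(Y)` induced by maps into the homs factors through
the universal inclusion of `E X`, by way of a morphism of graphs. -/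
theorem seqIncl_desc {n : ℕ} {X : Fin n → V} {Y : EnrichedGraph.{v, u, w} V}
    (pt : Fin (n + 1) → Y.carrier) (f : ∀ s : Fin n, X s ⟶ Y.hom (pt s.castSucc) (pt s.succ)) :
    seqIncl.{v, u, w} E X ≫ (Gamma.onMap E (seqGraph.desc pt f)).map ⟨0⟩ ⟨Fin.last n⟩ =
      E.tensor.tmap f ≫ Gamma.inj E Y ⟨n, pt, rfl, rfl⟩ := by
  refine (Category.assoc _ _ _).trans ?_
  refine (congrArg (E.tensor.tmap _ ≫ ·)
    (Gamma.inj_onMap E (seqGraph.desc pt f) (Chain.standard n))).trans ?_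
  refine (E.tensor.tmap_comp_assoc _ _ _).trans ?_
  exact congrArg (· ≫ Gamma.inj E Y ⟨n, pt, rfl, rfl⟩)
    (E.tensor.tmap_congr fun s => seqGraph.incl_desc pt f s)

theorem seqInclMap_desc {n : ℕ} {X : Fin n → V} {Y : EnrichedGraph.{v, u, w} V}
    (pt : Fin (n + 1) → Y.carrier) (f : ∀ s : Fin n, X s ⟶ Y.hom (pt s.castSucc) (pt s.succ)) :
    seqInclMap.{v, u, w} E T X ≫ (Gamma.onMap E (EnrichedGraph.mapGraphHom T
      (seqGraph.desc pt f))).map ⟨0⟩ ⟨Fin.last n⟩ =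
      E.tensor.tmap (fun s => T.map (f s)) ≫ Gamma.inj E (Y.mapGraph T) ⟨n, pt, rfl, rfl⟩ := by
  refine (Category.assoc _ _ _).trans ?_
  refine (congrArg (E.tensor.tmap _ ≫ ·) (Gamma.inj_onMap E (EnrichedGraph.mapGraphHom T
    (seqGraph.desc pt f)) (Chain.standard n))).trans ?_
  refine (E.tensor.tmap_comp_assoc _ _ _).trans ?_
  exact congrArg (· ≫ Gamma.inj E (Y.mapGraph T) ⟨n, pt, rfl, rfl⟩)
    (E.tensor.tmap_congr fun s => (T.map_comp _ _).symm.trans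
      (congrArg T.map (seqGraph.incl_desc pt f s)))

theorem Gamma.unit_tmap_inj {X : Fin 1 → V}
    {Y : ULift.{w} (Fin 2) → ULift.{w} (Fin 2) → V}
    (f : ∀ s : Fin 1, X s ⟶ Y ⟨s.castSucc⟩ ⟨s.succ⟩) :
    E.str.unit X ≫ E.tensor.tmap f ≫
        Gamma.inj E (⟨_, Y⟩ : EnrichedGraph.{v, u, w} V) (Chain.standard 1) =
      f 0 ≫ Gamma.unitHom E (⟨_, Y⟩ : EnrichedGraph.{v, u, w} V) ⟨0⟩ ⟨Fin.last 1⟩ := by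
  have e : (Chain.pair (⟨0⟩ : ULift.{w} (Fin 2)) ⟨Fin.last 1⟩).pt = (Chain.standard 1).pt := by
    funext i
    exact Fin.cases rfl (fun j => Fin.cases rfl (fun j => j.elim0) j) i
  have h1 := eq_of_heq (Gamma.unit_inj_congr (E := E) (⟨_, Y⟩ : EnrichedGraph.{v, u, w} V) e
    (Chain.pair _ _).pt_zero (Chain.pair _ _).pt_last (Chain.standard 1).pt_zero
    (Chain.standard 1).pt_last)
  refine Eq.trans ?_ (congrArg (f 0 ≫ ·) h1).symm
  refine (Category.assoc _ _ _).symm.trans (Eq.trans ?_ (Category.assoc _ _ _))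
  exact congrArg (· ≫ Gamma.inj E (⟨_, Y⟩ : EnrichedGraph.{v, u, w} V) (Chain.standard 1))
    (E.str.unit_naturality f).symm

namespace GraphDistributiveLaw

variable {hE : Multitensor.IsDistributive.{v, u, w} E} (L : GraphDistributiveLaw hE T)
  (hT : ∀ J : Type w, PreservesColimitsOfShape (Discrete J) T.toFunctor)

/-- The coherence maps determined by a distributive law. -/
noncomputable def coherenceMap {n : ℕ} (X : Fin n → V) :
    T.obj ((E.tensor n).obj X) ⟶ (E.tensor n).obj fun i => T.obj (X i) :=
  haveI := isIso_seqInclMap.{v, u, w} hE hT X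
  T.map (seqIncl.{v, u, w} E X) ≫ L.homMap (seqGraph.{v, u, w} X) ⟨0⟩ ⟨Fin.last n⟩ ≫
    inv (seqInclMap.{v, u, w} E T X)

theorem coherenceMap_seqInclMap {n : ℕ} (X : Fin n → V) :
    L.coherenceMap hT X ≫ seqInclMap.{v, u, w} E T X =
      T.map (seqIncl.{v, u, w} E X) ≫ L.homMap (seqGraph.{v, u, w} X) ⟨0⟩ ⟨Fin.last n⟩ := by
  have := isIso_seqInclMap.{v, u, w} hE hT X
  rw [coherenceMap, Category.assoc, Category.assoc, IsIso.inv_hom_id, Category.comp_id]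

/-- The points of `p` and the maps `f` form a morphism of graphs from `seqGraph X` to `Y`.
Naturality of the law at this morphism, which may well identify or permute objects, transports the
defining equation of the coherence map to `Y`. -/
theorem map_tmap_inj_homMap {Y : EnrichedGraph.{v, u, w} V} {a b : Y.carrier} (p : Chain a b)
    {X : Fin p.len → V} (f : ∀ i, X i ⟶ Y.homs p i) :
    T.map (E.tensor.tmap f ≫ Gamma.inj E Y p) ≫ L.homMap Y a b =
      L.coherenceMap hT X ≫ E.tensor.tmap (fun i => T.map (f i)) ≫
        Gamma.inj E (Y.mapGraph T) p := by
  obtain ⟨n, pt, rfl, rfl⟩ := p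
  have h1 := seqIncl_desc (E := E) pt f
  have h2 := seqInclMap_desc (E := E) (T := T) pt f
  have h3 := L.homMap_naturality (seqGraph.desc pt f) ⟨0⟩ ⟨Fin.last n⟩
  refine (congrArg (fun q => T.map q ≫ L.homMap Y (pt 0) (pt (Fin.last n))) h1.symm).trans ?_
  refine (congrArg (· ≫ L.homMap Y (pt 0) (pt (Fin.last n))) (T.map_comp _ _)).trans ?_
  refine (Category.assoc _ _ _).trans ?_
  refine (congrArg (T.map (seqIncl.{v, u, w} E X) ≫ ·) h3).trans ?_
  refine (Category.assoc _ _ _).symm.trans ?_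
  refine (congrArg (· ≫ (Gamma.onMap E (EnrichedGraph.mapGraphHom T
    (seqGraph.desc pt f))).map ⟨0⟩ ⟨Fin.last n⟩) (L.coherenceMap_seqInclMap hT X).symm).trans ?_
  exact (Category.assoc _ _ _).trans (congrArg (L.coherenceMap hT X ≫ ·) h2)

theorem map_inj_homMap {Y : EnrichedGraph.{v, u, w} V} {a b : Y.carrier} (p : Chain a b) :
    T.map (Gamma.inj E Y p) ≫ L.homMap Y a b =
      L.coherenceMap hT (Y.homs p) ≫ Gamma.inj E (Y.mapGraph T) p := by
  have h := L.map_tmap_inj_homMap hT p fun i => 𝟙 (Y.homs p i)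
  simp only [T.map_id] at h
  refine Eq.trans ?_ (h.trans ?_)
  · exact congrArg (fun q => T.map q ≫ L.homMap Y a b) ((congrArg (· ≫ Gamma.inj E Y p)
      (E.tensor.tmap_id _)).trans (Category.id_comp _)).symm
  · exact congrArg (L.coherenceMap hT (Y.homs p) ≫ ·) ((congrArg
      (· ≫ Gamma.inj E (Y.mapGraph T) p) (E.tensor.tmap_id _)).trans (Category.id_comp _))

/-- Each axiom for the coherence maps is verified after this monomorphism, where the corresponding
property of the law at `seqGraph X` applies. -/
theorem eq_of_comp_seqInclMap (hE : Multitensor.IsDistributive.{v, u, w} E)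
    (hT : ∀ J : Type w, PreservesColimitsOfShape (Discrete J) T.toFunctor) {n : ℕ} {X : Fin n → V} {Z : V}
    {f g : Z ⟶ (E.tensor n).obj fun i => T.obj (X i)}
    (h : f ≫ seqInclMap.{v, u, w} E T X = g ≫ seqInclMap.{v, u, w} E T X) : f = g := by
  have := isIso_seqInclMap.{v, u, w} hE hT X
  exact (cancel_mono _).1 h

theorem coherenceMap_naturality {n : ℕ} {X Y : Fin n → V} (f : ∀ i, X i ⟶ Y i) :
    T.map (E.tensor.tmap f) ≫ L.coherenceMap hT Y =
      L.coherenceMap hT X ≫ E.tensor.tmap fun i => T.map (f i) := by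
  refine eq_of_comp_seqInclMap hE hT ?_
  have h := L.map_tmap_inj_homMap hT (Y := seqGraph.{v, u, w} Y) (Chain.standard n) (X := X)
    fun s => f s ≫ seqGraph.incl Y (Chain.step.{w} s)
  simp only [T.map_comp] at h
  rw [Category.assoc, L.coherenceMap_seqInclMap]
  refine (Category.assoc _ _ _).symm.trans ?_
  refine Eq.trans (congrArg (· ≫ L.homMap (seqGraph.{v, u, w} Y) ⟨0⟩ ⟨Fin.last n⟩) ?_)
    (h.trans ?_)
  · refine (T.map_comp _ _).symm.trans (Eq.trans ?_ (T.map_comp _ _))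
    exact congrArg T.map (E.tensor.tmap_comp_assoc _ _ _)
  · refine Eq.trans ?_ (Category.assoc _ _ _).symm
    exact congrArg (L.coherenceMap hT X ≫ ·) (E.tensor.tmap_comp_assoc _ _ _).symm

theorem unit_coherenceMap (X : Fin 1 → V) :
    T.map (E.str.unit X) ≫ L.coherenceMap hT X = E.str.unit fun i => T.obj (X i) := by
  refine eq_of_comp_seqInclMap hE hT ?_
  have h1 := Gamma.unit_tmap_inj (E := E) (Y := (seqGraph.{v, u, w} X).hom)
    fun s => seqGraph.incl X (Chain.step.{w} s)
  have h2 := Gamma.unit_tmap_inj (E := E) (X := fun i => T.obj (X i))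
    (Y := fun i j => T.obj ((seqGraph.{v, u, w} X).hom i j))
    fun s => T.map (seqGraph.incl X (Chain.step.{w} s))
  have h3 := L.map_unitHom_homMap (seqGraph.{v, u, w} X) ⟨0⟩ ⟨Fin.last 1⟩
  rw [Category.assoc, L.coherenceMap_seqInclMap]
  refine (Category.assoc _ _ _).symm.trans ?_
  refine (congrArg (· ≫ L.homMap (seqGraph.{v, u, w} X) ⟨0⟩ ⟨Fin.last 1⟩)
    ((T.map_comp _ _).symm.trans ((congrArg T.map h1).trans (T.map_comp _ _)))).trans ?_
  refine (Category.assoc _ _ _).trans ?_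
  exact (congrArg (T.map (seqGraph.incl X (Chain.step.{w} 0)) ≫ ·) h3).trans h2.symm

theorem unitAt_coherenceMap {n : ℕ} (X : Fin n → V) :
    T.unitAt ((E.tensor n).obj X) ≫ L.coherenceMap hT X =
      E.tensor.tmap fun i => T.unitAt (X i) := by
  refine eq_of_comp_seqInclMap hE hT ?_
  have h1 := L.unitAt_homMap (seqGraph.{v, u, w} X) ⟨0⟩ ⟨Fin.last n⟩
  have h2 := Gamma.inj_onMap E (Y := (seqGraph.{v, u, w} X).mapGraph T)
    (EnrichedGraph.Hom.ofHoms fun a b => T.unitAt ((seqGraph.{v, u, w} X).hom a b))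
    (Chain.standard n)
  rw [Category.assoc, L.coherenceMap_seqInclMap]
  refine (Category.assoc _ _ _).symm.trans ?_
  refine (congrArg (· ≫ L.homMap (seqGraph.{v, u, w} X) ⟨0⟩ ⟨Fin.last n⟩)
    (T.unitAt_naturality (seqIncl.{v, u, w} E X)).symm).trans ?_
  refine (Category.assoc _ _ _).trans ?_
  refine (congrArg (seqIncl.{v, u, w} E X ≫ ·) h1).trans ?_
  refine (Category.assoc _ _ _).trans ?_
  refine (congrArg (E.tensor.tmap _ ≫ ·) h2).trans ?_
  refine (E.tensor.tmap_comp_assoc _ _ _).trans (Eq.trans ?_ (E.tensor.tmap_comp_assoc _ _ _).symm)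
  exact congrArg (· ≫ Gamma.inj E ((seqGraph.{v, u, w} X).mapGraph T) (Chain.standard n))
    (E.tensor.tmap_congr fun s => T.unitAt_naturality _)

theorem mulAt_coherenceMap {n : ℕ} (X : Fin n → V) :
    T.mulAt ((E.tensor n).obj X) ≫ L.coherenceMap hT X =
      T.map (L.coherenceMap hT X) ≫ L.coherenceMap hT (fun i => T.obj (X i)) ≫
        E.tensor.tmap fun i => T.mulAt (X i) := by
  refine eq_of_comp_seqInclMap hE hT ?_
  have h1 := L.mulAt_homMap (seqGraph.{v, u, w} X) ⟨0⟩ ⟨Fin.last n⟩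
  have h2 := Gamma.inj_onMap E (X := ((seqGraph.{v, u, w} X).mapGraph T).mapGraph T)
    (Y := (seqGraph.{v, u, w} X).mapGraph T)
    (EnrichedGraph.Hom.ofHoms fun a b => T.mulAt ((seqGraph.{v, u, w} X).hom a b))
    (Chain.standard n)
  -- The second component of the law is taken at the graph obtained by applying `T` to `seqGraph X`,
  -- not at a graph of a sequence, so it is computed by `map_tmap_inj_homMap`.
  have h3 : T.map (seqInclMap.{v, u, w} E T X) ≫
      L.homMap ((seqGraph.{v, u, w} X).mapGraph T) ⟨0⟩ ⟨Fin.last n⟩ = _ :=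
    L.map_tmap_inj_homMap hT (Y := (seqGraph.{v, u, w} X).mapGraph T) (Chain.standard n)
      fun s => T.map (seqGraph.incl X (Chain.step.{w} s))
  rw [Category.assoc, L.coherenceMap_seqInclMap]
  refine (Category.assoc _ _ _).symm.trans ?_
  refine (congrArg (· ≫ L.homMap (seqGraph.{v, u, w} X) ⟨0⟩ ⟨Fin.last n⟩)
    (T.mulAt_naturality (seqIncl.{v, u, w} E X)).symm).trans ?_
  refine (Category.assoc _ _ _).trans ?_
  refine (congrArg (T.map (T.map (seqIncl.{v, u, w} E X)) ≫ ·) h1).trans ?_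
  refine (Category.assoc _ _ _).symm.trans ?_
  refine (congrArg (· ≫ L.homMap ((seqGraph.{v, u, w} X).mapGraph T) ⟨0⟩ ⟨Fin.last n⟩ ≫
    (Gamma.onMap E (X := ((seqGraph.{v, u, w} X).mapGraph T).mapGraph T)
      (Y := (seqGraph.{v, u, w} X).mapGraph T) (EnrichedGraph.Hom.ofHoms fun a b =>
        T.mulAt ((seqGraph.{v, u, w} X).hom a b))).map ⟨0⟩ ⟨Fin.last n⟩)
    ((T.map_comp _ _).symm.trans
      ((congrArg T.map (L.coherenceMap_seqInclMap hT X).symm).trans (T.map_comp _ _)))).trans ?_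
  refine (Category.assoc _ _ _).trans (Eq.trans ?_ (Category.assoc _ _ _).symm)
  refine congrArg (T.map (L.coherenceMap hT X) ≫ ·) ?_
  refine (Category.assoc _ _ _).symm.trans ?_
  refine (congrArg (· ≫ (Gamma.onMap E (X := ((seqGraph.{v, u, w} X).mapGraph T).mapGraph T)
      (Y := (seqGraph.{v, u, w} X).mapGraph T) (EnrichedGraph.Hom.ofHoms fun a b =>
        T.mulAt ((seqGraph.{v, u, w} X).hom a b))).map ⟨0⟩ ⟨Fin.last n⟩) h3).trans ?_
  refine (Category.assoc _ _ _).trans (Eq.trans ?_ (Category.assoc _ _ _).symm)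
  refine congrArg (L.coherenceMap hT _ ≫ ·) ?_
  refine (Category.assoc _ _ _).trans ?_
  refine (congrArg (E.tensor.tmap _ ≫ ·) h2).trans ?_
  refine (E.tensor.tmap_comp_assoc _ _ _).trans (Eq.trans ?_ (E.tensor.tmap_comp_assoc _ _ _).symm)
  exact congrArg (· ≫ Gamma.inj E ((seqGraph.{v, u, w} X).mapGraph T) (Chain.standard n))
    (E.tensor.tmap_congr fun s => T.mulAt_naturality _)

end GraphDistributiveLaw

end

end MultitensorLaw

/-! ### Substitutions, and the bijection with distributive laws -/

namespace MultitensorLaw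

section

variable {V : Type u} [Category.{v} V] [HasCoproducts.{w} V] {E : Multitensor V} {T : Monad V}

/-- The inclusion of `E_i E_j X_ij` into `Γ(E)(Γ(E)(Y))` along a family of maps into the homs of a
graph `Y`. -/
noncomputable def Gamma.familyInj₂ {Y : EnrichedGraph.{v, u, w} V} {a b : Y.carrier}
    (p : Chain a b) {k : ℕ} (d : Subdivision p.len k) {X : Fin p.len → V}
    (f : ∀ s, X s ⟶ Y.homs p s) :
    (E.tensor k).obj (fun i => (E.tensor (d.len i)).obj fun j => X (d.index i j)) ⟶
      (Gamma.onObj E (Gamma.onObj E Y)).hom a b :=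
  E.tensor.tmap (fun i => E.tensor.tmap (fun j => f (d.index i j)) ≫
    Gamma.inj E Y (p.block d i)) ≫ Gamma.inj E (Gamma.onObj E Y) (p.coarse d)

theorem Gamma.familyInj₂_mul (hE : Multitensor.IsDistributive.{v, u, w} E)
    {Y : EnrichedGraph.{v, u, w} V} {a b : Y.carrier}
    (p : Chain a b) {k : ℕ} (d : Subdivision p.len k) {X : Fin p.len → V}
    (f : ∀ s, X s ⟶ Y.homs p s) : Gamma.familyInj₂ p d f ≫ Gamma.mulHom hE Y a b =
      E.str.sub d X ≫ E.tensor.tmap f ≫ Gamma.inj E Y p := by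
  have h1 : Gamma.familyInj₂ p d f =
      E.tensor.tmap (fun i => E.tensor.tmap fun j => f (d.index i j)) ≫ Gamma.inj₂ E Y p d :=
    (E.tensor.tmap_comp_assoc _ _ _).symm
  refine (congrArg (· ≫ Gamma.mulHom hE Y a b) h1).trans ?_
  refine (Category.assoc _ _ _).trans ?_
  refine (congrArg (E.tensor.tmap _ ≫ ·) (Gamma.inj₂_mul hE Y p d)).trans ?_
  exact E.str.sub_naturality_assoc d f _

namespace GraphDistributiveLaw

variable {hE : Multitensor.IsDistributive.{v, u, w} E} (L : GraphDistributiveLaw hE T)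
  (hT : ∀ J : Type w, PreservesColimitsOfShape (Discrete J) T.toFunctor)

/-- Uses `map_tmap_inj_homMap` at two levels: in `Γ(E)(Y)` along the end points of the blocks, and
in `Y` along each block. -/
theorem map_familyInj₂_homMap {Y : EnrichedGraph.{v, u, w} V} {a b : Y.carrier}
    (p : Chain a b) {k : ℕ} (d : Subdivision p.len k) {X : Fin p.len → V}
    (f : ∀ s, X s ⟶ Y.homs p s) :
    T.map (Gamma.familyInj₂ p d f) ≫ L.homMap (Gamma.onObj E Y) a b ≫
        (Gamma.onMap E (X := (Gamma.onObj E Y).mapGraph T) (Y := Gamma.onObj E (Y.mapGraph T))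
          (EnrichedGraph.Hom.ofHoms (L.homMap Y))).map a b =
      (L.coherenceMap hT (fun i => (E.tensor (d.len i)).obj fun j => X (d.index i j)) ≫
        E.tensor.tmap fun i => L.coherenceMap hT fun j => X (d.index i j)) ≫
          Gamma.familyInj₂ (Y := Y.mapGraph T) p d fun s => T.map (f s) := by
  have h1 := L.map_tmap_inj_homMap hT (Y := Gamma.onObj E Y) (p.coarse d) fun i =>
    E.tensor.tmap (fun j => f (d.index i j)) ≫ Gamma.inj E Y (p.block d i)
  have h2 := Gamma.inj_onMap E (X := (Gamma.onObj E Y).mapGraph T)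
    (Y := Gamma.onObj E (Y.mapGraph T)) (EnrichedGraph.Hom.ofHoms (L.homMap Y)) (p.coarse d)
  refine (Category.assoc _ _ _).symm.trans ?_
  refine (congrArg (· ≫ (Gamma.onMap E (X := (Gamma.onObj E Y).mapGraph T)
    (Y := Gamma.onObj E (Y.mapGraph T)) (EnrichedGraph.Hom.ofHoms (L.homMap Y))).map a b)
      h1).trans ?_
  refine (Category.assoc _ _ _).trans (Eq.trans ?_ (Category.assoc _ _ _).symm)
  refine congrArg (L.coherenceMap hT _ ≫ ·) ?_
  refine (Category.assoc _ _ _).trans ?_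
  refine (congrArg (E.tensor.tmap _ ≫ ·) h2).trans ?_
  refine (E.tensor.tmap_comp_assoc _ _ _).trans (Eq.trans ?_ (E.tensor.tmap_comp_assoc _ _ _).symm)
  exact congrArg (· ≫ Gamma.inj E (Gamma.onObj E (Y.mapGraph T)) (p.coarse d))
    (E.tensor.tmap_congr fun i => L.map_tmap_inj_homMap hT (p.block d i) fun j => f (d.index i j))

/-- This is compatibility of the law with the multiplication of `Γ(E)`, read on the part of the hom
of `Γ(E)(Γ(E)(seqGraph X))` given by the standard sequence, subdivided by `d`. There the
multiplication is the substitution of `E`. -/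
theorem sub_coherenceMap {N k : ℕ} (d : Subdivision N k) (X : Fin N → V) :
    T.map (E.str.sub d X) ≫ L.coherenceMap hT X =
      L.coherenceMap hT (fun i => (E.tensor (d.len i)).obj fun j => X (d.index i j)) ≫
        E.tensor.tmap (fun i => L.coherenceMap hT fun j => X (d.index i j)) ≫
          E.str.sub d fun s => T.obj (X s) := by
  refine eq_of_comp_seqInclMap hE hT ?_
  let Y := seqGraph.{v, u, w} X
  have h1 : Gamma.familyInj₂ (E := E) (Y := Y) (Chain.standard N) d
      (fun s => seqGraph.incl X (Chain.step.{w} s)) ≫ Gamma.mulHom hE Y ⟨0⟩ ⟨Fin.last N⟩ =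
        E.str.sub d X ≫ seqIncl.{v, u, w} E X :=
    Gamma.familyInj₂_mul hE (Y := Y) (Chain.standard N) d
      fun s => seqGraph.incl X (Chain.step.{w} s)
  have h2 : Gamma.familyInj₂ (E := E) (Y := Y.mapGraph T) (Chain.standard N) d
      (fun s => T.map (seqGraph.incl X (Chain.step.{w} s))) ≫
        Gamma.mulHom hE (Y.mapGraph T) ⟨0⟩ ⟨Fin.last N⟩ =
      E.str.sub d (fun s => T.obj (X s)) ≫ seqInclMap.{v, u, w} E T X :=
    Gamma.familyInj₂_mul hE (Y := Y.mapGraph T) (Chain.standard N) d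
      fun s => T.map (seqGraph.incl X (Chain.step.{w} s))
  have h3 := L.map_familyInj₂_homMap hT (Y := Y) (Chain.standard N) d
    fun s => seqGraph.incl X (Chain.step.{w} s)
  have h4 := L.map_mulHom_homMap Y ⟨0⟩ ⟨Fin.last N⟩
  rw [Category.assoc, L.coherenceMap_seqInclMap]
  refine (Category.assoc _ _ _).symm.trans ?_
  refine (congrArg (· ≫ L.homMap Y ⟨0⟩ ⟨Fin.last N⟩)
    ((T.map_comp _ _).symm.trans ((congrArg T.map h1.symm).trans (T.map_comp _ _)))).trans ?_
  refine (Category.assoc _ _ _).trans ?_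
  refine (congrArg (T.map _ ≫ ·) (h4.trans (Category.assoc _ _ _).symm)).trans ?_
  refine (Category.assoc _ _ _).symm.trans ?_
  refine (congrArg (· ≫ Gamma.mulHom hE (Y.mapGraph T) ⟨0⟩ ⟨Fin.last N⟩) h3).trans ?_
  refine (Category.assoc _ _ _).trans ?_
  refine (congrArg (_ ≫ ·) h2).trans ?_
  refine (Category.assoc _ _ _).symm.trans ?_
  exact congrArg (· ≫ seqInclMap.{v, u, w} E T X) (Category.assoc _ _ _)

/-- The opmonoidal monad determined by a distributive law. -/
noncomputable def coherence : OpmonoidalCoherence E T where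
  τ X := L.coherenceMap hT X
  naturality f := L.coherenceMap_naturality hT f
  unit_τ X := L.unit_coherenceMap hT X
  sub_τ d X := L.sub_coherenceMap hT d X
  η_τ X := L.unitAt_coherenceMap hT X
  μ_τ X := L.mulAt_coherenceMap hT X

end GraphDistributiveLaw

/-- Coherence maps for a monad are the same thing as distributive laws on graphs. -/
noncomputable def graphLawEquiv (hE : Multitensor.IsDistributive.{v, u, w} E)
    (hT : ∀ J : Type w, PreservesColimitsOfShape (Discrete J) T.toFunctor) :
    OpmonoidalCoherence E T ≃ GraphDistributiveLaw hE T where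
  toFun c := c.graphLaw hT hE
  invFun L := L.coherence hT
  left_inv c := by
    apply OpmonoidalCoherence.ext
    funext n X
    refine GraphDistributiveLaw.eq_of_comp_seqInclMap hE hT ?_
    refine ((c.graphLaw hT hE).coherenceMap_seqInclMap hT X).trans ?_
    refine (congrArg (T.map (seqIncl.{v, u, w} E X) ≫ ·)
      ((c.graphLaw hT hE).homMap_eq rfl _ _)).trans ?_
    exact c.map_tmap_inj_lawHom hT (seqGraph.{v, u, w} X) (Chain.standard n) _
  right_inv L := by
    refine Subtype.ext (DistributiveLaw.ext (NatTrans.ext (funext fun X => ?_)))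
    refine Eq.trans ?_ (L.app_eq X).symm
    refine congrArg EnrichedGraph.Hom.ofHoms (funext fun a => funext fun b => ?_)
    have := hT (Chain a b)
    -- Both laws are given by the same coherence maps on each summand, and `T` preserves the
    -- coproduct.
    refine ((Gamma.isCoprod_inj E X a b).map T.toFunctor).hom_ext fun p => ?_
    exact ((L.coherence hT).map_inj_lawHom hT X p).trans (L.map_inj_homMap hT p).symm

end

end MultitensorLaw

/-! ### The theorem -/

theorem mainTheorem6 {V : Type u} [Category.{v} V] (E : Multitensor V) (T : Monad V) :
    ∃ (e₁ : OpmonoidalCoherence E T ≃ CompositeMultitensor E T)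
      (e₂ : OpmonoidalCoherence E T ≃ Lifting E T),
      (∀ (c : OpmonoidalCoherence E T) {N k : ℕ} (d : Subdivision N k) (X : Fin N → V),
        (e₁ c).str.sub d X =
          E.tensor.tmap (fun i => c.τ fun j => T.obj (X (d.index i j))) ≫
            E.str.sub d (fun s => T.obj (T.obj (X s))) ≫
              E.tensor.tmap fun s => T.μ.app (X s)) ∧
      (∀ (c : OpmonoidalCoherence E T) {n : ℕ} (X : Fin n → T.Algebra),
        HEq (((e₂ c).lift.tensor n).obj X).a
          (c.τ (fun i => (X i).A) ≫ E.tensor.tmap fun i => (X i).a)) ∧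
      (∀ c : OpmonoidalCoherence E T,
        ∃ (F : MultitensorCat.{v, u, w} (e₁ c).multitensor ⥤
              MultitensorCat.{v, max u v, w} (e₂ c).lift)
          (G : MultitensorCat.{v, max u v, w} (e₂ c).lift ⥤ MultitensorCat.{v, u, w} (e₁ c).multitensor),
          F ⋙ G = 𝟭 _ ∧ G ⋙ F = 𝟭 _ ∧
          F ⋙ MultitensorCat.forget (e₂ c).lift ⋙ EnrichedGraph.mapFunctor T.forget =
            MultitensorCat.forget (e₁ c).multitensor) ∧
      (∀ [HasCoproducts.{w} V] (hE : Multitensor.IsDistributive.{v, u, w} E),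
        (∀ J : Type w, PreservesColimitsOfShape (Discrete J) T.toFunctor) →
        ∃ e₃ : OpmonoidalCoherence E T ≃ GraphDistributiveLaw hE T,
          ∀ (c : OpmonoidalCoherence E T) (X : EnrichedGraph.{v, u, w} V),
            ∃ h : ∀ a b : X.carrier, T.obj ((Gamma.onObj E X).hom a b) ⟶
                (Gamma.onObj E ((EnrichedGraph.mapFunctor T.toFunctor).obj X)).hom a b,
              (e₃ c).1.law.app X = EnrichedGraph.Hom.ofHoms h ∧
              ∀ {a b : X.carrier} (p : Chain a b),
                T.map (Gamma.inj E X p) ≫ h a b =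
                  c.τ (X.homs p) ≫
                    Gamma.inj E ((EnrichedGraph.mapFunctor T.toFunctor).obj X) p) := by
  -- The equivalences send `c` to `c.composite` and `c.actions.lifting` by definition, so the two
  -- formulas need no proof and the functors have the required types.
  refine ⟨compositeEquiv E T, liftingEquiv E T, fun _ _ _ _ _ => rfl, fun _ _ _ => HEq.rfl,
    fun c => ⟨c.toLiftedFunctor, c.ofLiftedFunctor, c.toLiftedFunctor_comp_ofLiftedFunctor,
      c.ofLiftedFunctor_comp_toLiftedFunctor, c.toLiftedFunctor_forget⟩, fun hE hT => ?_⟩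
  exact ⟨graphLawEquiv hE hT, fun c X => ⟨c.lawHom hT X, rfl, fun p => c.map_inj_lawHom hT X p⟩⟩
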